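/- Let $1<\alpha<2$. Let $S$ be one of the following spaces of real sequences $\mathbf x=(x_i)_{i\in\mathbb N}$, where $\beta_i>0$ for all $i$: $l^p_{(\beta_i)}=\{\mathbf x:\sum_i\beta_i|x_i|^p<\infty\}$ with norm $(\sum_i\beta_i|x_i|^p)^{1/p}$, $1\le p<\infty$; $l^\infty_{(\beta_i)}=\{\mathbf x:\sup_i\beta_i|x_i|<\infty\}$ with norm $\sup_i\beta_i|x_i|$; or $\mathbb R^{\mathbb N}$ with the product topology. Let $\mu$ be a Borel probability measure on $S$, let $X_i(\mathbf x)=x_i$, let $\sigma_{i^c}$ be the $\sigma$-field generated by the $X_j$, $j\ne i$, and let $\mu(dy\mid\sigma_{i^c})$ be the regular conditional distribution of $X_i$ given $\sigma_{i^c}$. Assume that for every $i$ it has a locally bounded density: $\mu(dy\mid\sigma_{i^c})=\rho(y\mid\sigma_{i^c})\,dy$ $\mu$-a.e., where $\rho\ge0$ is $\sigma_{i^c}$-measurable in $\mathbf x$ and Borel in $y$, and for every compact $K\subset\mathbb R$ there is $L<\infty$ (depending on $i$ and $K$) with $$\operatorname*{ess\,sup}_{y\in K}\rho(y\mid\sigma_{i^c})\le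 L\qquad\mu\text{-a.e.}\tag{$*$}$$ Let $\mathcal FC_0^\infty$ be the set of $\mu$-classes of functions $\mathbf x\mapsto f(x_1,\dots,x_n)$, $n\ge1$, $f\in C_0^\infty(\mathbb R^n)$, and for $u,v\in\mathcal FC_0^\infty$ let $\mathcal E_{(\alpha)}(u,v)=\sum_i\mathcal E^{(i)}_{(\alpha)}(u,v)$ with $$\mathcal E^{(i)}_{(\alpha)}(u,v)=\int_S\int_{\{y\neq x_i\}}\frac{\big(u(\mathbf x^{i,y})-u(\mathbf x)\big)\big(v(\mathbf x^{i,y})-v(\mathbf x)\big)}{|y-x_i|^{\alpha+1}}\,\mu(dy\mid\sigma_{i^c})\,\mu(d\mathbf x),$$ where $\mathbf x^{i,y}$ is $\mathbf x$ with its $i$-th entry replaced by $y$. Then in each of the following cases $\mathcal E_{(\alpha)}$ is well defined on $\mathcal FC_0^\infty$ and closable in $L^2(S;\mu)$, and its closure $(\mathcal E_{(\alpha)},\mathcal D(\mathcal E_{(\alpha)}))$ is a strictly quasi-regular (symmetric) Dirichlet form, in the sense of Ma and Röckner. i) $S=l^p_{(\beta_i)}$, and there are $\gamma_i>0$ with $\{\gamma_i^{-1/p}\}_i\in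 l^p$, an $M_0<\infty$ and numbers $L_{M,i}$ ($M,i\in\mathbb N$) such that $(*)$ holds with $L=L_{M,i}$ for $K=K_{M,i}=[-6M\beta_i^{-1/p}\gamma_i^{-1/p},\,6M\beta_i^{-1/p}\gamma_i^{-1/p}]$, and $$\mu\Big(\bigcup_{M\in\mathbb N}\{|X_i|\le M\beta_i^{-1/p}\gamma_i^{-1/p}\ \ \forall i\}\Big)=1,$$ $$\sum_{i}\big(\beta_i^{1/p}\gamma_i^{1/p}\big)^{\alpha+1}\mu\big(\beta_i^{1/p}|X_i|>M_0\gamma_i^{-1/p}\big)<\infty,$$ $$\lim_{M\to\infty}M^{-\alpha}\sum_{i}L_{M,i}\big(\beta_i^{1/p}\gamma_i^{1/p}\big)^{\alpha}\mu\big(\beta_i^{1/p}|X_i|>M\gamma_i^{-1/p}\big)\ \text{ exists and is finite.}$$ ii) $S=l^\infty_{(\beta_i)}$, and there are $0<\gamma_1\le\gamma_2\le\cdots\to\infty$, an $M_0<\infty$ and numbers $L_{M,i}$ such that $(*)$ holds with $L=L_{M,i}$ for $K=K_{M,i}=[-6M\beta_i^{-1}\gamma_i^{-1},\,6M\beta_i^{-1}\gamma_i^{-1}]$,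 and $$\mu\Big(\bigcup_{M\in\mathbb N}\{|X_i|\le M\beta_i^{-1}\gamma_i^{-1}\ \ \forall i\}\Big)=1,\qquad \sum_{i}(\beta_i\gamma_i)^{\alpha+1}\mu\big(\beta_i|X_i|>M_0\gamma_i^{-1}\big)<\infty,$$ $$\lim_{M\to\infty}M^{-\alpha}\sum_{i}L_{M,i}(\beta_i\gamma_i)^{\alpha}\mu\big(\beta_i|X_i|>M\gamma_i^{-1}\big)\ \text{ exists and is finite.}$$ iii) $S=\mathbb R^{\mathbb N}$, and there are $\gamma_i>0$ and numbers $L_{M,i}$ such that $(*)$ holds with $L=L_{M,i}$ for $K=K_{M,i}=[-6M\gamma_i,\,6M\gamma_i]$, and $$\lim_{M\to\infty}M^{-\alpha}\sum_{i}L_{M,i}\gamma_i^{-\alpha}\mu\big(|X_i|>M\gamma_i\big)\ \text{ exists and is finite.}$$ Here $(\mathcal E,\mathcal D(\mathcal E))$ is strictly quasi-regular if (a) there is a strict $\mathcal E$-nest of compact sets; (b) some $\mathcal E_1^{1/2}$-dense subset of $\mathcal D(\mathcal E)$ consists of elements that have strictly $\mathcal E$-quasi-continuous $\mu$-versions; (c)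 there are $u_n\in\mathcal D(\mathcal E)$, $n\in\mathbb N$, with strictly $\mathcal E$-quasi-continuous $\mu$-versions $\tilde u_n$ and a strictly $\mathcal E$-exceptional set $N$ such that $\{\tilde u_n\}$ separates the points of $(S\cup\{\Delta\})\setminus N$, where $\Delta$ is an isolated point added to $S$ and $\tilde u_n(\Delta)=0$. A strict $\mathcal E$-nest is an increasing sequence of closed sets $F_k$ with $\mathrm{Cap}_{1,G_1\varphi}(S\setminus F_k)\to0$ for $\varphi\in L^2(S;\mu)$, $0<\varphi\le1$ $\mu$-a.e., where $\mathrm{Cap}_{1,G_1\varphi}(U)=\sup_h\int h_U\,\varphi\,d\mu$ over the 1-excessive $h\in\mathcal D(\mathcal E)$ with $h\le1$, and $h_U$ is the element of least $\mathcal E_1$-norm among the $w\in\mathcal D(\mathcal E)$ with $w\ge h$ $\mu$-a.e. on $U$; $N$ is strictly exceptional if $N\subset\bigcap_k(S\setminus F_k)$, and $f$ is strictly quasi-continuous if all $f|_{F_k}$ are continuous, for some strict nest $(F_k)$. -/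

import Mathlib

open MeasureTheory ProbabilityTheory Filter Topology
open scoped ENNReal NNReal ContDiff

noncomputable section

/-! ### The state spaces -/

/-- A topological space of real sequences: it has continuous coordinate maps `coord i` which
separate points, and it is stable under changing one coordinate. -/
class SequenceSpace (S : Type) [TopologicalSpace S] where
  /-- the coordinate maps `X_i` -/
  coord : ℕ → S → ℝ
  continuous_coord : ∀ i, Continuous (coord i)
  ext_coord : ∀ x y : S, (∀ i, coord i x = coord i y) → x = y
  /-- `replace x i t` is the sequence `x` with its `i`-th entry replaced by `t` -/
  replace : S → ℕ → ℝ → S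
  coord_replace : ∀ x i t j, coord j (replace x i t) = if j = i then t else coord j x

/-- The space `ℝ^ℕ`, with its product topology. -/
instance : SequenceSpace (ℕ → ℝ) where
  coord i x := x i
  continuous_coord i := continuous_apply i
  ext_coord _ _ h := funext h
  replace x i t := Function.update x i t
  coord_replace x i t j := Function.update_apply x i t j

/-- The weighted space `l^p_(β)` of all real sequences with `∑ β_i |x_i|^p < ∞`. -/
def WeightedLp (p : ℝ) (β : ℕ → ℝ) : Type :=
  {x : ℕ → ℝ // Summable fun i => β i * |x i| ^ p}

namespace WeightedLp

variable {p : ℝ} {β : ℕ → ℝ}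

/-- The distance `(∑ β_i |x_i - y_i|^p)^(1/p)`. -/
instance : Dist (WeightedLp p β) where
  dist x y := (∑' i, β i * |x.1 i - y.1 i| ^ p) ^ (1 / p)

variable [hp : Fact (1 ≤ p)] [hβ : Fact (∀ i, 0 < β i)]

lemma p_pos : 0 < p := one_pos.trans_le hp.out

instance : Fact (1 ≤ ENNReal.ofReal p) := ⟨by simpa using hp.out⟩

lemma toReal_p : (ENNReal.ofReal p).toReal = p := ENNReal.toReal_ofReal (p_pos).le

lemma norm_scaled (i : ℕ) (t : ℝ) : ‖β i ^ (1 / p) * t‖ ^ p = β i * |t| ^ p := by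
  have h := hβ.out i
  rw [Real.norm_eq_abs, abs_mul, abs_of_pos (Real.rpow_pos_of_pos h _),
    Real.mul_rpow (Real.rpow_nonneg h.le _) (abs_nonneg _), ← Real.rpow_mul h.le,
    one_div_mul_cancel (p_pos (p := p)).ne', Real.rpow_one]

/-- The identification `x ↦ (β_i^(1/p) x_i)` with the unweighted space `l^p`. -/
def scaled (x : WeightedLp p β) : lp (fun _ : ℕ => ℝ) (ENNReal.ofReal p) :=
  ⟨fun i => β i ^ (1 / p) * x.1 i, memℓp_gen (by
    rw [toReal_p]; simpa only [norm_scaled] using x.2)⟩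

lemma dist_eq_scaled (x y : WeightedLp p β) : dist x y = dist (scaled x) (scaled y) := by
  have hp' : 0 < (ENNReal.ofReal p).toReal := by rw [toReal_p]; exact p_pos
  rw [dist_eq_norm, lp.norm_eq_tsum_rpow hp', toReal_p]
  change (∑' i, β i * |x.1 i - y.1 i| ^ p) ^ (1 / p) = _
  congr 1
  refine tsum_congr fun i => ?_
  rw [← norm_scaled, mul_sub]
  rfl

lemma scaled_injective : Function.Injective (scaled (p := p) (β := β)) := by
  intro x y h
  refine Subtype.ext (funext fun i => ?_)
  have h1 : β i ^ (1 / p) * x.1 i = β i ^ (1 / p) * y.1 i :=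
    congrFun (congrArg Subtype.val h) i
  exact mul_left_cancel₀ (Real.rpow_pos_of_pos (hβ.out i) _).ne' h1

instance : MetricSpace (WeightedLp p β) where
  dist_self x := by simp [dist_eq_scaled]
  dist_comm x y := by simp only [dist_eq_scaled, dist_comm]
  dist_triangle x y z := by simpa only [dist_eq_scaled] using dist_triangle _ _ _
  eq_of_dist_eq_zero {x y} h := by
    rw [dist_eq_scaled] at h
    exact scaled_injective (eq_of_dist_eq_zero h)

instance : MeasurableSpace (WeightedLp p β) := borel _
instance : BorelSpace (WeightedLp p β) := ⟨rfl⟩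

instance : SequenceSpace (WeightedLp p β) where
  coord i x := x.1 i
  continuous_coord i := by
    have h1 : Continuous (scaled (p := p) (β := β)) :=
      (Isometry.of_dist_eq fun x y => (dist_eq_scaled x y).symm).continuous
    have h2 : Continuous fun x : WeightedLp p β => (β i ^ (1 / p))⁻¹ * (scaled x) i :=
      continuous_const.mul ((lp.lipschitzWith_one_eval _ i).continuous.comp h1)
    refine h2.congr fun x => ?_
    change (β i ^ (1 / p))⁻¹ * (β i ^ (1 / p) * x.1 i) = x.1 i
    exact inv_mul_cancel_left₀ (Real.rpow_pos_of_pos (hβ.out i) _).ne' _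
  ext_coord x y h := Subtype.ext (funext h)
  replace x i t := ⟨Function.update x.1 i t, by
    refine (summable_congr_cofinite ?_).2 x.2
    filter_upwards [(Set.finite_singleton i).compl_mem_cofinite] with j hj
    rw [Function.update_of_ne (by simpa using hj)]⟩
  coord_replace x i t j := Function.update_apply x.1 i t j

end WeightedLp

/-- The weighted space `l^∞_(β)` of all real sequences with `sup β_i |x_i| < ∞`. -/
def WeightedLinf (β : ℕ → ℝ) : Type :=
  {x : ℕ → ℝ // BddAbove (Set.range fun i => β i * |x i|)}

namespace WeightedLinf

variable {β : ℕ → ℝ}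

/-- The distance `sup β_i |x_i - y_i|`. -/
instance : Dist (WeightedLinf β) where
  dist x y := ⨆ i, β i * |x.1 i - y.1 i|

variable [hβ : Fact (∀ i, 0 < β i)]

lemma norm_scaled (i : ℕ) (t : ℝ) : ‖β i * t‖ = β i * |t| := by
  rw [Real.norm_eq_abs, abs_mul, abs_of_pos (hβ.out i)]

/-- The identification `x ↦ (β_i x_i)` with the unweighted space `l^∞`. -/
def scaled (x : WeightedLinf β) : lp (fun _ : ℕ => ℝ) ∞ :=
  ⟨fun i => β i * x.1 i, memℓp_infty (by simpa only [norm_scaled] using x.2)⟩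

lemma dist_eq_scaled (x y : WeightedLinf β) : dist x y = dist (scaled x) (scaled y) := by
  rw [dist_eq_norm, lp.norm_eq_ciSup]
  change (⨆ i, β i * |x.1 i - y.1 i|) = _
  congr 1
  funext i
  rw [← norm_scaled, mul_sub]
  rfl

lemma scaled_injective : Function.Injective (scaled (β := β)) := by
  intro x y h
  refine Subtype.ext (funext fun i => ?_)
  have h1 : β i * x.1 i = β i * y.1 i := congrFun (congrArg Subtype.val h) i
  exact mul_left_cancel₀ (hβ.out i).ne' h1

instance : MetricSpace (WeightedLinf β) where
  dist_self x := by simp [dist_eq_scaled]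
  dist_comm x y := by simp only [dist_eq_scaled, dist_comm]
  dist_triangle x y z := by simpa only [dist_eq_scaled] using dist_triangle _ _ _
  eq_of_dist_eq_zero {x y} h := by
    rw [dist_eq_scaled] at h
    exact scaled_injective (eq_of_dist_eq_zero h)

instance : MeasurableSpace (WeightedLinf β) := borel _
instance : BorelSpace (WeightedLinf β) := ⟨rfl⟩

instance : SequenceSpace (WeightedLinf β) where
  coord i x := x.1 i
  continuous_coord i := by
    have h1 : Continuous (scaled (β := β)) :=
      (Isometry.of_dist_eq fun x y => (dist_eq_scaled x y).symm).continuous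
    have h2 : Continuous fun x : WeightedLinf β => (β i)⁻¹ * (scaled x) i :=
      continuous_const.mul ((lp.lipschitzWith_one_eval _ i).continuous.comp h1)
    refine h2.congr fun x => ?_
    change (β i)⁻¹ * (β i * x.1 i) = x.1 i
    exact inv_mul_cancel_left₀ (hβ.out i).ne' _
  ext_coord x y h := Subtype.ext (funext h)
  replace x i t := ⟨Function.update x.1 i t, by
    obtain ⟨C, hC⟩ := x.2
    refine ⟨max C (β i * |t|), ?_⟩
    rintro _ ⟨j, rfl⟩
    rcases eq_or_ne j i with rfl | hj
    · simp
    · simpa [Function.update_of_ne hj] using Or.inl (hC ⟨j, rfl⟩)⟩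
  coord_replace x i t j := Function.update_apply x.1 i t j

end WeightedLinf

/-! ### Conditional distributions of one coordinate given all the others -/

section Conditional

variable {S : Type} [TopologicalSpace S] [MeasurableSpace S] [BorelSpace S] [SequenceSpace S]

open SequenceSpace

/-- The map `x ↦ x \ x_i = (x_j)_{j ≠ i}`. -/
def others (i : ℕ) (x : S) : {j : ℕ // j ≠ i} → ℝ := fun j => coord j.1 x

lemma measurable_others (i : ℕ) : Measurable (others (S := S) i) :=
  measurable_pi_lambda _ fun j => (continuous_coord j.1).measurable

/-- The sub-σ-field `σ_{i^c}` generated by the coordinates other than the `i`-th one. -/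
@[reducible]
def sigmaCompl (S : Type) [TopologicalSpace S] [SequenceSpace S] (i : ℕ) : MeasurableSpace S :=
  MeasurableSpace.comap (others i) MeasurableSpace.pi

/-- The regular conditional distribution `μ(dy_i | σ_{i^c})` of the `i`-th coordinate given all
the other ones. -/
def condLaw (μ : Measure S) [IsFiniteMeasure μ] (i : ℕ) : Kernel S ℝ :=
  (condDistrib (coord i) (others i) μ).comap (others i) (measurable_others i)

/-- `ess sup_{y ∈ K} ρ(y | σ_{i^c}) ≤ L`, `μ`-a.e. -/
def CondDensityBound (μ : Measure S) (ρ : ℕ → S → ℝ → ℝ) (i : ℕ) (K : Set ℝ) (L : ℝ) : Prop :=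
  ∀ᵐ x ∂μ, ∀ᵐ y ∂(volume : Measure ℝ), y ∈ K → ρ i x y ≤ L

/-- For every `i`, `ρ i x y = ρ(y | σ_{i^c})(x)` is a locally bounded density of the conditional
distribution `μ(dy | σ_{i^c})`. -/
structure IsLocallyBoundedCondDensity (μ : Measure S) [IsFiniteMeasure μ]
    (ρ : ℕ → S → ℝ → ℝ) : Prop where
  nonneg : ∀ i x y, 0 ≤ ρ i x y
  measurable_left : ∀ i y, Measurable[sigmaCompl S i] fun x => ρ i x y
  measurable_right : ∀ i x, Measurable (ρ i x)
  density : ∀ i, ∀ᵐ x ∂μ,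
    condLaw μ i x = (volume : Measure ℝ).withDensity fun y => ENNReal.ofReal (ρ i x y)
  locally_bounded : ∀ i, ∀ K : Set ℝ, IsCompact K → ∃ L : ℝ, CondDensityBound μ ρ i K L

/-! ### The individually adapted Markovian symmetric form of index `α` on cylinder functions -/

/-- The functions `x ↦ f (x_0, …, x_n)` on `S`, where `f` is smooth with compact support on
`ℝ^(n+1)`. -/
def IsSmoothCylinder (u : S → ℝ) : Prop :=
  ∃ (n : ℕ) (f : (Fin (n + 1) → ℝ) → ℝ), ContDiff ℝ ∞ f ∧ HasCompactSupport f ∧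
    u = fun x => f fun k => coord (k : ℕ) x

/-- `Φ_α(u, v; y, y', x \ x_i)`. -/
def jumpKernel (α : ℝ) (u v : S → ℝ) (i : ℕ) (y y' : ℝ) (x : S) : ℝ :=
  1 / |y - y'| ^ (α + 1) * ((u (replace x i y) - u (replace x i y')) *
    (v (replace x i y) - v (replace x i y')))

/-- The function `(x, y) ↦ I_{y ≠ x_i} Φ_α(u, v; y, x_i, x \ x_i)`. -/
def jumpIntegrand (α : ℝ) (u v : S → ℝ) (i : ℕ) (q : S × ℝ) : ℝ :=
  if q.2 = coord i q.1 then 0 else jumpKernel α u v i q.2 (coord i q.1) q.1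

/-- `𝓔_(α)^(i)(u, v) = ∫_S { ∫_ℝ I_{y ≠ x_i} Φ_α(u, v; y, x_i, x \ x_i) μ(dy | σ_{i^c}) } μ(dx)`. -/
def formPart (α : ℝ) (μ : Measure S) [IsFiniteMeasure μ] (i : ℕ) (u v : S → ℝ) : ℝ :=
  ∫ x, ∫ y, jumpIntegrand α u v i (x, y) ∂(condLaw μ i x) ∂μ

end Conditional

/-! ### Symmetric forms on `L²` and Dirichlet forms -/

/-- A bilinear form on `L²(S; μ)` whose domain is a linear subspace. -/
structure L2Form {S : Type} [MeasurableSpace S] (μ : Measure S) where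
  /-- the domain of the form -/
  domain : Submodule ℝ (Lp ℝ 2 μ)
  /-- the form -/
  form : domain →ₗ[ℝ] domain →ₗ[ℝ] ℝ

namespace L2Form

variable {S : Type} [MeasurableSpace S] {μ : Measure S}

/-- `𝓔_1(u, v) = 𝓔(u, v) + (u, v)_{L²}`. -/
def form₁ (E : L2Form μ) (u v : E.domain) : ℝ :=
  E.form u v + inner ℝ (u : Lp ℝ 2 μ) (v : Lp ℝ 2 μ)

/-- Density of a subset of the domain with respect to the norm `𝓔_1^{1/2}`. -/
def IsDenseIn (E : L2Form μ) (A : Set E.domain) : Prop :=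
  ∀ u : E.domain, ∀ ε > 0, ∃ v ∈ A, E.form₁ (u - v) (u - v) < ε

/-- The form is closed: its domain is complete with respect to the norm `𝓔_1^{1/2}`. -/
def IsClosedForm (E : L2Form μ) : Prop :=
  ∀ u : ℕ → E.domain,
    (∀ ε > 0, ∃ N, ∀ m ≥ N, ∀ n ≥ N, E.form₁ (u m - u n) (u m - u n) < ε) →
    ∃ v : E.domain, Tendsto (fun n => E.form₁ (u n - v) (u n - v)) atTop (𝓝 0)

/-- (Symmetric) Dirichlet forms on `L²(S; μ)`. -/
structure IsDirichletForm (E : L2Form μ) : Prop where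
  dense : Dense (E.domain : Set (Lp ℝ 2 μ))
  symm : ∀ u v, E.form u v = E.form v u
  nonneg : ∀ u, 0 ≤ E.form u u
  closed : E.IsClosedForm
  /-- the unit contraction operates on the form -/
  markov : ∀ u : E.domain, ∃ v : E.domain,
    ((v : Lp ℝ 2 μ) : S → ℝ) =ᵐ[μ] (fun x => min (max (((u : Lp ℝ 2 μ) : S → ℝ) x) 0) 1) ∧
    E.form v v ≤ E.form u u

/-! ### Strict quasi-regularity -/

/-- `u` is 1-excessive: `𝓔_1(u, v) ≥ 0` for every nonnegative `v` in the domain. -/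
def IsOneExcessive (E : L2Form μ) (u : E.domain) : Prop :=
  ∀ v : E.domain, (∀ᵐ x ∂μ, 0 ≤ ((v : Lp ℝ 2 μ) : S → ℝ) x) → 0 ≤ E.form₁ u v

/-- `w` dominates `h` `μ`-a.e. on `U`. -/
def DominatesOn (E : L2Form μ) (h : E.domain) (U : Set S) (w : E.domain) : Prop :=
  ∀ᵐ x ∂μ, x ∈ U → ((h : Lp ℝ 2 μ) : S → ℝ) x ≤ ((w : Lp ℝ 2 μ) : S → ℝ) x

/-- `w` is the 1-reduced function `h_U`: the element of least `𝓔_1`-norm among the elements of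
the domain that dominate `h` on `U`. -/
def IsReduced (E : L2Form μ) (h : E.domain) (U : Set S) (w : E.domain) : Prop :=
  E.DominatesOn h U w ∧ ∀ w' : E.domain, E.DominatesOn h U w' → E.form₁ w w ≤ E.form₁ w' w'

/-- The capacity `Cap_{1, G_1 φ}(U)`: the supremum of
`Cap_{h, G_1 φ}(U) = 𝓔_1(h_U, G_1 φ) = ∫ h_U φ dμ` over all 1-excessive `h ≤ 1` in the domain. -/
def strictCap (E : L2Form μ) (φ : S → ℝ) (U : Set S) : ℝ≥0∞ :=
  ⨆ (h : E.domain) (w : E.domain) (_ : E.IsOneExcessive h)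
    (_ : ∀ᵐ x ∂μ, ((h : Lp ℝ 2 μ) : S → ℝ) x ≤ 1) (_ : E.IsReduced h U w),
    ENNReal.ofReal (∫ x, ((w : Lp ℝ 2 μ) : S → ℝ) x * φ x ∂μ)

variable [TopologicalSpace S]

/-- Strict `𝓔`-nests: increasing sequences of closed sets whose complements have capacities
`Cap_{1, G_1 φ}` that tend to zero, for `φ ∈ L²(S; μ)` with `0 < φ ≤ 1`. -/
structure IsStrictNest (E : L2Form μ) (F : ℕ → Set S) : Prop where
  closed : ∀ k, IsClosed (F k)
  mono : Monotone F
  cap : ∀ φ : S → ℝ, MemLp φ 2 μ → (∀ᵐ x ∂μ, 0 < φ x ∧ φ x ≤ 1) →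
    Tendsto (fun k => E.strictCap φ (F k)ᶜ) atTop (𝓝 0)

/-- Strictly `𝓔`-exceptional sets. -/
def IsStrictlyExceptional (E : L2Form μ) (N : Set S) : Prop :=
  ∃ F : ℕ → Set S, E.IsStrictNest F ∧ N ⊆ ⋂ k, (F k)ᶜ

/-- `f` is a strictly `𝓔`-quasi-continuous `μ`-version of `u`. The cemetery is an isolated point
at which functions vanish, so that continuity has to be checked on the sets of the nest only. -/
def IsStrictlyQuasiContinuousVersion (E : L2Form μ) (u : E.domain) (f : S → ℝ) : Prop :=
  ((u : Lp ℝ 2 μ) : S → ℝ) =ᵐ[μ] f ∧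
    ∃ F : ℕ → Set S, E.IsStrictNest F ∧ ∀ k, ContinuousOn f (F k)

/-- Strict quasi-regularity, for a state space which is not locally compact, so that the cemetery
`Δ` is adjoined as an isolated point. In the last field the two requirements on points outside the
exceptional set say that the functions, extended by `0` to `Δ`, separate the points of
`S ∪ {Δ}` outside that set. -/
structure IsStrictlyQuasiRegular (E : L2Form μ) : Prop where
  compact_nest : ∃ F : ℕ → Set S, E.IsStrictNest F ∧ ∀ k, IsCompact (F k)
  dense_quasiContinuous : ∃ A : Set E.domain, E.IsDenseIn A ∧
    ∀ u ∈ A, ∃ f : S → ℝ, E.IsStrictlyQuasiContinuousVersion u f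
  separating : ∃ (u : ℕ → E.domain) (f : ℕ → S → ℝ) (N : Set S),
    (∀ n, E.IsStrictlyQuasiContinuousVersion (u n) (f n)) ∧ E.IsStrictlyExceptional N ∧
    (∀ x ∉ N, ∀ y ∉ N, x ≠ y → ∃ n, f n x ≠ f n y) ∧ ∀ x ∉ N, ∃ n, f n x ≠ 0

/-! ### The closed form `(𝓔_(α), 𝓓(𝓔_(α)))` -/

variable [BorelSpace S] [SequenceSpace S]

/-- `E` is the closure in `L²(S; μ)` of the form
`𝓔_(α)(u, v) = ∑_i 𝓔_(α)^(i)(u, v)` on the `μ`-classes of smooth cylinder functions with compact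
base support: a closed form, which extends `𝓔_(α)` (all integrals and the sum defining the latter
being convergent), and in whose domain the classes of cylinder functions are dense. -/
structure IsClosureOfCylinderForm (α : ℝ) [IsFiniteMeasure μ] (E : L2Form μ) : Prop where
  mem : ∀ u : S → ℝ, IsSmoothCylinder u → ∃ f : E.domain, ((f : Lp ℝ 2 μ) : S → ℝ) =ᵐ[μ] u
  integrable : ∀ u v : S → ℝ, IsSmoothCylinder u → IsSmoothCylinder v →
    ∀ i, Integrable (jumpIntegrand α u v i) (μ ⊗ₘ condLaw μ i)
  hasSum : ∀ u v : S → ℝ, IsSmoothCylinder u → IsSmoothCylinder v → ∀ f g : E.domain,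
    ((f : Lp ℝ 2 μ) : S → ℝ) =ᵐ[μ] u → ((g : Lp ℝ 2 μ) : S → ℝ) =ᵐ[μ] v →
    HasSum (fun i => formPart α μ i u v) (E.form f g)
  closed : E.IsClosedForm
  dense : E.IsDenseIn {f | ∃ u : S → ℝ, IsSmoothCylinder u ∧ ((f : Lp ℝ 2 μ) : S → ℝ) =ᵐ[μ] u}

end L2Form

/-- The closure `(𝓔_(α), 𝓓(𝓔_(α)))` exists (that is, `𝓔_(α)` on cylinder functions is well
defined and closable in `L²(S; μ)`), and it is a strictly quasi-regular Dirichlet form. -/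
def ClosureIsStrictlyQuasiRegular {S : Type} [TopologicalSpace S] [MeasurableSpace S]
    [BorelSpace S] [SequenceSpace S] (α : ℝ) (μ : Measure S) [IsFiniteMeasure μ] : Prop :=
  ∃ E : L2Form μ, E.IsClosureOfCylinderForm α ∧ E.IsDirichletForm ∧ E.IsStrictlyQuasiRegular

end

/-! Write 𝓔(u, v) = (Du, Dv), where Du(i, x, y) = (u(x^{i,y}) - u(x)) / |y - x_i|^((α+1)/2) is taken
in L² of `jumpMeasure`, the sum over i of the laws of x together with a resampled i-th coordinate.
Resampling leaves μ invariant (`measurePreserving_replace`). So D acts on μ-classes, and a.e.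
convergence of u_n entails a.e. convergence of Du_n. Hence the graph of D with maximal domain is
closed (`isClosed_jumpGraph`), which is closability. The form lives on the closure `energyGraph` of
the cylinder graphs. Cylinder functions have finite energy because the conditional density is
bounded near the support and min(1, t²)/|t|^(α+1) is integrable for 0 < α < 2.

One principle does most of the remaining work: a sequence of bounded energy that converges in L² has
convex combinations that converge in the graph norm (`exists_tendsto_mem_convexHull_tail`). It shows
that single cylinder functions, not only their sums, are dense, that 1 and infinite products of
cutoffs belong to the domain, and, through smooth contractions, that the form is Markovian.

The quantitative input is that a cutoff of X_i at scale a has energy at most 2 (C L a^(-α) +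
a^(-(α+1))) μ(|X_i| > a): given the other coordinates, the old and the new value are i.i.d., and
nothing is contributed when both lie in [-a, a]. A change of one coordinate moves one factor of a
product only, so a product of cutoffs has at most the sum of their energies.

In the cases of l^p and l^∞ the hypotheses bound the total energy of the cutoffs at scales M r_i for
all large M. The functions 1 - ∏ cutoff equal 1 off the box {|x_i| ≤ 2 M r_i} and tend to 0 in L²,
so suitable convex combinations tend to 0 in 𝓔_1 (`nest_of_bounded_energy`). As the capacity of U is
controlled by the 𝓔_1-norm of any function that is at least 1 on U (`strictCap_jumpForm_le`), the
boxes form a strict nest; the conditions on γ make them compact. On ℝ^ℕ it suffices that each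
coordinate separately has cutoffs of bounded energy: convex combinations make the i-th cutoff cost
at most δ_i, with ∑ δ_i small (`nest_of_cutoffs`), and every product of compact intervals is
compact. -/

noncomputable section

/-! ### Convex combinations of bounded sequences -/

/-- Every bounded sequence in a Hilbert space admits a convergent sequence of convex combinations
of its tails. -/
theorem exists_tendsto_mem_convexHull_tail {H : Type*} [NormedAddCommGroup H]
    [InnerProductSpace ℝ H] [CompleteSpace H] {x : ℕ → H} {C : ℝ} (hx : ∀ k, ‖x k‖ ≤ C) :
    ∃ (c : ℕ → H) (l : H), (∀ k, c k ∈ convexHull ℝ (x '' Set.Ici k)) ∧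
      Tendsto c atTop (𝓝 l) := by
  -- The closed hulls of the tails decrease, so their elements of least norm have increasing,
  -- bounded norms. By the parallelogram law these elements form a Cauchy sequence.
  set K : ℕ → Set H := fun k => closure (convexHull ℝ (x '' Set.Ici k)) with hK
  have hKconv : ∀ k, Convex ℝ (K k) := fun k => (convex_convexHull ℝ _).closure
  have hxK : ∀ k, x k ∈ K k := fun k =>
    subset_closure (subset_convexHull ℝ _ ⟨k, Set.self_mem_Ici, rfl⟩)
  have hKanti : ∀ {k j}, k ≤ j → K j ⊆ K k := fun {k j} hkj =>
    closure_mono (convexHull_mono (Set.image_mono (Set.Ici_subset_Ici.2 hkj)))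
  have hmin : ∀ k, ∃ v ∈ K k, ∀ w ∈ K k, ‖v‖ ≤ ‖w‖ := by
    intro k
    obtain ⟨v, hv, hvm⟩ := exists_norm_eq_iInf_of_complete_convex ⟨x k, hxK k⟩
      isClosed_closure.isComplete (hKconv k) (0 : H)
    refine ⟨v, hv, fun w hw => ?_⟩
    have : ‖(0 : H) - v‖ ≤ ‖(0 : H) - w‖ := by
      rw [hvm]
      exact ciInf_le ⟨0, by rintro _ ⟨y, rfl⟩; exact norm_nonneg _⟩ (⟨w, hw⟩ : K k)
    simpa using this
  choose m hmK hmm using hmin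
  have hmono : Monotone fun k => ‖m k‖ ^ 2 := fun k j hkj =>
    pow_le_pow_left₀ (norm_nonneg _) (hmm k _ (hKanti hkj (hmK j))) 2
  have hbdd : BddAbove (Set.range fun k => ‖m k‖ ^ 2) := by
    refine ⟨C ^ 2, ?_⟩
    rintro _ ⟨k, rfl⟩
    exact pow_le_pow_left₀ (norm_nonneg _) ((hmm k _ (hxK k)).trans (hx k)) 2
  have hlim := tendsto_atTop_ciSup hmono hbdd
  have hcauchy : CauchySeq m := by
    have hdist : ∀ k j, k ≤ j → ‖m j - m k‖ ^ 2 ≤ 2 * (‖m j‖ ^ 2 - ‖m k‖ ^ 2) := by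
      intro k j hkj
      have hmid : (1 / 2 : ℝ) • m j + (1 / 2 : ℝ) • m k ∈ K k :=
        hKconv k (hKanti hkj (hmK j)) (hmK k) (by norm_num) (by norm_num) (by norm_num)
      have h1 := hmm k _ hmid
      rw [← smul_add, norm_smul] at h1
      have h2 : 2 * ‖m k‖ ≤ ‖m j + m k‖ := by
        norm_num at h1
        linarith
      have h3 := pow_le_pow_left₀ (by positivity) h2 2
      have h4 := parallelogram_law_with_norm ℝ (m j) (m k)
      nlinarith
    rw [Metric.cauchySeq_iff']
    intro ε hε
    obtain ⟨N, hN⟩ := Metric.tendsto_atTop.1 hlim (ε ^ 2 / 2) (by positivity)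
    refine ⟨N, fun n hn => ?_⟩
    have h1 := hdist N n hn
    have h2 := hN N le_rfl
    rw [Real.dist_eq, abs_sub_comm] at h2
    have h3 := (le_abs_self _).trans_lt h2
    have h4 : ‖m n‖ ^ 2 ≤ ⨆ k, ‖m k‖ ^ 2 := le_ciSup hbdd n
    rw [dist_eq_norm]
    refine lt_of_pow_lt_pow_left₀ 2 hε.le ?_
    linarith
  obtain ⟨l, hl⟩ := cauchySeq_tendsto_of_complete hcauchy
  -- The minimisers lie only in the closures. Genuine finite combinations close to them are chosen,
  -- because some properties used later survive convex combinations but not limits.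
  have hc : ∀ k, ∃ c ∈ convexHull ℝ (x '' Set.Ici k), dist (m k) c < 1 / ((k : ℝ) + 1) :=
    fun k => Metric.mem_closure_iff.1 (hmK k) _ (by positivity)
  choose c hcK hcd using hc
  refine ⟨c, l, hcK, ?_⟩
  refine tendsto_iff_dist_tendsto_zero.2 (squeeze_zero (fun _ => dist_nonneg) (fun k => ?_)
    ((tendsto_one_div_add_atTop_nhds_zero_nat (𝕜 := ℝ)).add
      (tendsto_iff_dist_tendsto_zero.1 hl) |>.trans (by simp)))
  exact (dist_triangle_left (c k) l (m k)).trans (add_le_add (hcd k).le le_rfl)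

/-- Convex combinations of the tails of `x` have the same limits as `x` under a continuous linear
map. -/
theorem tendsto_map_of_mem_convexHull_tail {H F : Type*} [NormedAddCommGroup H] [NormedSpace ℝ H]
    [NormedAddCommGroup F] [NormedSpace ℝ F] (P : H →L[ℝ] F) {x c : ℕ → H} {u : F}
    (hu : Tendsto (fun k => P (x k)) atTop (𝓝 u))
    (hc : ∀ k, c k ∈ convexHull ℝ (x '' Set.Ici k)) :
    Tendsto (fun k => P (c k)) atTop (𝓝 u) := by
  rw [Metric.tendsto_atTop] at hu ⊢
  intro ε hε
  obtain ⟨N, hN⟩ := hu ε hε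
  refine ⟨N, fun n hn => ?_⟩
  have hconv : Convex ℝ (P ⁻¹' Metric.ball u ε) :=
    (convex_ball u ε).is_linear_preimage P.toLinearMap.isLinear
  refine convexHull_min ?_ hconv (hc n)
  rintro _ ⟨k, hk, rfl⟩
  exact hN k (hn.trans hk)

/-- A bounded sequence in a closed convex set `W` whose images under `P` converge to `u`: the limit
is the image of an element of `W`. -/
theorem exists_mem_of_bounded_of_tendsto {H F : Type*} [NormedAddCommGroup H]
    [InnerProductSpace ℝ H] [CompleteSpace H] [NormedAddCommGroup F] [NormedSpace ℝ F]
    (P : H →L[ℝ] F) {W : Set H} (hW : IsClosed W) (hWc : Convex ℝ W) {x : ℕ → H} {C : ℝ}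
    (hxW : ∀ k, x k ∈ W) (hx : ∀ k, ‖x k‖ ≤ C) {u : F}
    (hu : Tendsto (fun k => P (x k)) atTop (𝓝 u)) : ∃ w ∈ W, P w = u := by
  obtain ⟨c, l, hc, hl⟩ := exists_tendsto_mem_convexHull_tail hx
  refine ⟨l, hW.mem_of_tendsto hl (Eventually.of_forall fun k => ?_), ?_⟩
  · exact convexHull_min (by rintro _ ⟨k, -, rfl⟩; exact hxW k) hWc (hc k)
  · exact tendsto_nhds_unique ((P.continuous.tendsto l).comp hl)
      (tendsto_map_of_mem_convexHull_tail P hu hc)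

/-! ### One-dimensional estimates -/

/-- The Lévy kernel `min(1, (t/a)²) / |t|^(α+1)`. -/
def levyKernel (α a t : ℝ) : ℝ≥0∞ := ENNReal.ofReal (min 1 ((t / a) ^ 2) / |t| ^ (α + 1))

@[fun_prop]
lemma measurable_levyKernel (α a : ℝ) : Measurable (levyKernel α a) := by
  unfold levyKernel
  fun_prop

/-- Near 0 the kernel is t^(1-α), integrable as α < 2; at infinity it is t^(-(α+1)), integrable as α
> 0. The negative half-line follows by reflection. -/
lemma lintegral_levyKernel_one_lt_top {α : ℝ} (hα : 0 < α) (hα₂ : α < 2) :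
    ∫⁻ t, levyKernel α 1 t < ⊤ := by
  have hpos : ∫⁻ t in Set.Ioi (0 : ℝ), levyKernel α 1 t < ⊤ := by
    rw [← Set.Ioc_union_Ioi_eq_Ioi zero_le_one]
    refine (lintegral_union_le _ _ _).trans_lt (ENNReal.add_lt_top.2 ⟨?_, ?_⟩)
    · have hi : IntegrableOn (fun t : ℝ => t ^ (1 - α)) (Set.Ioc 0 1) := by
        have := intervalIntegral.intervalIntegrable_rpow' (a := 0) (b := 1) (r := 1 - α)
          (by linarith)
        rwa [intervalIntegrable_iff_integrableOn_Ioc_of_le zero_le_one] at this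
      refine lt_of_le_of_lt (setLIntegral_mono' measurableSet_Ioc fun t ht => ?_)
        hi.lintegral_lt_top
      refine ENNReal.ofReal_le_ofReal ?_
      have ht0 : 0 < t := ht.1
      rw [abs_of_pos ht0, div_one, div_le_iff₀ (Real.rpow_pos_of_pos ht0 _), ← Real.rpow_add ht0]
      refine (min_le_right _ _).trans (le_of_eq ?_)
      rw [← Real.rpow_natCast]
      congr 1
      push_cast
      ring
    · have hi : IntegrableOn (fun t : ℝ => t ^ (-(α + 1))) (Set.Ioi 1) :=
        integrableOn_Ioi_rpow_of_lt (by linarith) one_pos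
      refine lt_of_le_of_lt (setLIntegral_mono' measurableSet_Ioi fun t ht => ?_)
        hi.lintegral_lt_top
      refine ENNReal.ofReal_le_ofReal ?_
      have ht0 : 0 < t := one_pos.trans ht
      rw [abs_of_pos ht0, Real.rpow_neg ht0.le, div_eq_mul_inv]
      exact mul_le_of_le_one_left (by positivity) (min_le_left _ _)
  have hneg : ∫⁻ t in Set.Iic (0 : ℝ), levyKernel α 1 t < ⊤ := by
    have h := lintegral_map_equiv (μ := (volume : Measure ℝ).restrict (Set.Ici 0))
      (levyKernel α 1) (MeasurableEquiv.neg ℝ)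
    have h2 : ((volume : Measure ℝ).restrict (Set.Ici 0)).map (MeasurableEquiv.neg ℝ)
        = volume.restrict (Set.Iic 0) := by
      have h3 := (MeasurableEquiv.neg ℝ).measurableEmbedding.restrict_map (volume : Measure ℝ)
        (Set.Iic 0)
      have h4 : (volume : Measure ℝ).map (MeasurableEquiv.neg ℝ) = volume :=
        Measure.map_neg_eq_self _
      rw [h4] at h3
      rw [h3]
      congr 2
      ext t
      simp
    rw [h2] at h
    rw [h]
    refine lt_of_le_of_lt (le_of_eq ?_) hpos
    rw [setLIntegral_congr Ioi_ae_eq_Ici]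
    refine lintegral_congr fun t => ?_
    simp [levyKernel]
  rw [← setLIntegral_univ, ← Set.Iic_union_Ioi (a := (0 : ℝ))]
  exact (lintegral_union_le _ _ _).trans_lt (ENNReal.add_lt_top.2 ⟨hneg, hpos⟩)

/-- Scaling: the kernel at scale a is a^(-(α+1)) times the unit kernel at t/a, and the substitution
gives back a factor a. -/
lemma lintegral_levyKernel {α a : ℝ} (ha : 0 < a) :
    ∫⁻ t, levyKernel α a t = ENNReal.ofReal (a ^ (-α)) * ∫⁻ t, levyKernel α 1 t := by
  have h1 : ∀ t, levyKernel α a t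
      = ENNReal.ofReal (a ^ (-(α + 1))) * levyKernel α 1 (a⁻¹ * t) := by
    intro t
    unfold levyKernel
    rw [← ENNReal.ofReal_mul (by positivity), div_one, abs_mul, abs_of_pos (inv_pos.2 ha),
      Real.mul_rpow (by positivity) (abs_nonneg _), Real.inv_rpow ha.le, Real.rpow_neg ha.le]
    congr 1
    rw [inv_mul_eq_div]
    have : a ^ (α + 1) ≠ 0 := (Real.rpow_pos_of_pos ha _).ne'
    field_simp
  have h2 : ∫⁻ t, levyKernel α 1 (a⁻¹ * t) = ENNReal.ofReal a * ∫⁻ t, levyKernel α 1 t := by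
    have h3 := lintegral_map (μ := (volume : Measure ℝ)) (measurable_levyKernel α 1)
      (measurable_const_mul a⁻¹)
    rw [← h3, Real.map_volume_mul_left (inv_pos.2 ha).ne', inv_inv, abs_of_pos ha,
      lintegral_smul_measure, smul_eq_mul]
  rw [lintegral_congr h1, lintegral_const_mul _ (by fun_prop), h2, ← mul_assoc,
    ← ENNReal.ofReal_mul (by positivity)]
  congr 2
  conv_lhs => rw [← Real.rpow_one a, ← Real.rpow_mul ha.le, ← Real.rpow_add ha]
  congr 1
  ring

/-- A smooth cutoff function: it equals `1` on `[-1, 1]` and vanishes off `[-2, 2]`. -/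
def unitBump : ContDiffBump (0 : ℝ) := ⟨1, 2, one_pos, one_lt_two⟩

/-- The cutoff function at scale `a`. -/
def cutoff (a t : ℝ) : ℝ := unitBump (a⁻¹ * t)

lemma contDiff_cutoff (a : ℝ) : ContDiff ℝ ∞ (cutoff a) :=
  unitBump.contDiff.comp (contDiff_const.mul contDiff_id)

lemma cutoff_nonneg (a t : ℝ) : 0 ≤ cutoff a t := unitBump.nonneg

lemma cutoff_le_one (a t : ℝ) : cutoff a t ≤ 1 := unitBump.le_one

lemma cutoff_eq_one {a t : ℝ} (ha : 0 < a) (ht : |t| ≤ a) : cutoff a t = 1 := by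
  refine unitBump.one_of_mem_closedBall ?_
  rw [mem_closedBall_zero_iff, Real.norm_eq_abs, abs_mul, abs_of_pos (inv_pos.2 ha),
    inv_mul_le_iff₀ ha]
  simpa [unitBump] using ht

lemma cutoff_eq_zero {a t : ℝ} (ha : 0 < a) (ht : 2 * a ≤ |t|) : cutoff a t = 0 := by
  refine unitBump.zero_of_le_dist ?_
  rw [dist_zero_right, Real.norm_eq_abs, abs_mul, abs_of_pos (inv_pos.2 ha),
    le_inv_mul_iff₀ ha]
  simpa [unitBump, mul_comm] using ht

lemma hasCompactSupport_cutoff {a : ℝ} (ha : 0 < a) : HasCompactSupport (cutoff a) := by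
  refine HasCompactSupport.of_support_subset_isCompact (isCompact_Icc (a := -(2 * a)) (b := 2 * a))
    fun t ht => ?_
  rw [Set.mem_Icc, ← abs_le]
  by_contra h
  exact ht (cutoff_eq_zero ha (not_le.1 h).le)

lemma tendsto_cutoff {a : ℕ → ℝ} (ha : Tendsto a atTop atTop) (t : ℝ) :
    Tendsto (fun n => cutoff (a n) t) atTop (𝓝 1) := by
  refine tendsto_const_nhds.congr' ?_
  filter_upwards [ha.eventually_ge_atTop |t|, ha.eventually_gt_atTop 0] with n h1 h2
  exact (cutoff_eq_one h2 h1).symm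

/-- The increment is at most 1 because the values lie in [0, 1], and at most a Lipschitz constant
times |t - s|/a; scaling a fixed bump makes B independent of a. -/
lemma exists_cutoff_sub_sq_le :
    ∃ B : ℝ, 0 ≤ B ∧ ∀ a s t : ℝ, (cutoff a t - cutoff a s) ^ 2 ≤ B * min 1 (((t - s) / a) ^ 2) := by
  obtain ⟨C, hC⟩ : ∃ C : ℝ≥0, LipschitzWith C (unitBump : ℝ → ℝ) :=
    ⟨_, (unitBump.contDiff (n := 1)).lipschitzWith_of_hasCompactSupport
      unitBump.hasCompactSupport (by simp) |>.choose_spec⟩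
  refine ⟨1 + C ^ 2, by positivity, fun a s t => ?_⟩
  rw [mul_min_of_nonneg _ _ (by positivity)]
  refine le_min ?_ ?_
  · have h : |cutoff a t - cutoff a s| ≤ 1 := by
      rw [abs_le]
      constructor <;>
        linarith [cutoff_nonneg a t, cutoff_nonneg a s, cutoff_le_one a t, cutoff_le_one a s]
    have := (sq_le_one_iff_abs_le_one _).2 h
    nlinarith [sq_nonneg (C : ℝ)]
  · have h := hC.dist_le_mul (a⁻¹ * t) (a⁻¹ * s)
    rw [Real.dist_eq, Real.dist_eq, ← mul_sub,
      show a⁻¹ * (t - s) = (t - s) / a from inv_mul_eq_div _ _] at h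
    have h2 := pow_le_pow_left₀ (abs_nonneg _) h 2
    rw [mul_pow, sq_abs, sq_abs] at h2
    refine h2.trans ?_
    gcongr
    linarith

/-- The squared difference quotient of the cutoff function at scale `a`. -/
def cutoffEnergy (α a s t : ℝ) : ℝ≥0∞ :=
  ENNReal.ofReal ((cutoff a t - cutoff a s) ^ 2 / |t - s| ^ (α + 1))

@[fun_prop]
lemma measurable_cutoffEnergy (α a : ℝ) : Measurable (Function.uncurry (cutoffEnergy α a)) := by
  have := (contDiff_cutoff a).continuous.measurable
  unfold cutoffEnergy Function.uncurry
  fun_prop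

lemma cutoffEnergy_comm (α a s t : ℝ) : cutoffEnergy α a s t = cutoffEnergy α a t s := by
  unfold cutoffEnergy
  rw [abs_sub_comm, sub_sq_comm]

lemma cutoffEnergy_eq_zero {α a s t : ℝ} (ha : 0 < a) (hs : |s| ≤ a) (ht : |t| ≤ a) :
    cutoffEnergy α a s t = 0 := by
  simp [cutoffEnergy, cutoff_eq_one ha hs, cutoff_eq_one ha ht]

/-- The cutoff vanishes at t. Either it vanishes at s too, or |s| < 2a and then |t - s| exceeds a
with room to spare. No information on the density beyond 6a is needed. -/
lemma cutoffEnergy_le_of_far {α a s t : ℝ} (hα : 0 < α) (ha : 0 < a) (ht : 6 * a < |t|) :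
    cutoffEnergy α a s t ≤ ENNReal.ofReal (a ^ (-(α + 1))) := by
  refine ENNReal.ofReal_le_ofReal ?_
  rw [cutoff_eq_zero ha (by linarith), zero_sub, neg_sq]
  rcases le_or_gt (2 * a) |s| with hs | hs
  · rw [cutoff_eq_zero ha hs]
    simp
    positivity
  · have h1 : a ≤ |t - s| := by
      have := abs_sub_abs_le_abs_sub t s
      linarith
    rw [Real.rpow_neg ha.le, ← one_div]
    refine div_le_div₀ zero_le_one ?_ (by positivity)
      (Real.rpow_le_rpow ha.le h1 (by linarith))
    exact pow_le_one₀ (cutoff_nonneg _ _) (cutoff_le_one _ _)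

/-- The energy of the cutoff function with respect to a measure which has a bounded density near
the support of the cutoff function. -/
theorem exists_lintegral_cutoffEnergy_le {α : ℝ} (hα : 0 < α) (hα₂ : α < 2) :
    ∃ C < ⊤, ∀ (κ : Measure ℝ) [IsProbabilityMeasure κ] (a : ℝ) (L : ℝ≥0∞), 0 < a →
      κ.restrict (Set.Icc (-(6 * a)) (6 * a)) ≤ L • volume → ∀ s,
      ∫⁻ t, cutoffEnergy α a s t ∂κ ≤
        C * (L * ENNReal.ofReal (a ^ (-α))) + ENNReal.ofReal (a ^ (-(α + 1))) := by
  obtain ⟨B, hB, hle⟩ := exists_cutoff_sub_sq_le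
  refine ⟨ENNReal.ofReal B * ∫⁻ t, levyKernel α 1 t,
    ENNReal.mul_lt_top ENNReal.ofReal_lt_top (lintegral_levyKernel_one_lt_top hα hα₂), ?_⟩
  intro κ _ a L ha hκ s
  rw [← lintegral_add_compl _ (measurableSet_Icc (a := -(6 * a)) (b := 6 * a))]
  refine add_le_add ?_ ?_
  · calc ∫⁻ t in Set.Icc (-(6 * a)) (6 * a), cutoffEnergy α a s t ∂κ
        ≤ ∫⁻ t, cutoffEnergy α a s t ∂(L • volume) := lintegral_mono' hκ le_rfl
      _ ≤ ∫⁻ t, ENNReal.ofReal B * levyKernel α a (t - s) ∂(L • volume) := by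
          refine lintegral_mono fun t => ?_
          rw [levyKernel, ← ENNReal.ofReal_mul hB, ← mul_div_assoc]
          exact ENNReal.ofReal_le_ofReal (div_le_div_of_nonneg_right (hle a s t) (by positivity))
      _ = _ := by
          rw [lintegral_smul_measure, lintegral_const_mul _ (by fun_prop),
            lintegral_sub_right_eq_self (fun t => levyKernel α a t), lintegral_levyKernel ha,
            smul_eq_mul]
          ring
  · calc ∫⁻ t in (Set.Icc (-(6 * a)) (6 * a))ᶜ, cutoffEnergy α a s t ∂κ
        ≤ ∫⁻ t in (Set.Icc (-(6 * a)) (6 * a))ᶜ, ENNReal.ofReal (a ^ (-(α + 1))) ∂κ := by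
          refine setLIntegral_mono' measurableSet_Icc.compl fun t ht => ?_
          refine cutoffEnergy_le_of_far hα ha ?_
          by_contra h
          exact ht (abs_le.1 (not_lt.1 h))
      _ ≤ ENNReal.ofReal (a ^ (-(α + 1))) := by
          rw [setLIntegral_const]
          exact mul_le_of_le_one_right' prob_le_one

/-- The energy of a bounded Lipschitz function with compact support, with respect to a measure which
has a bounded density near the support. -/
theorem lintegral_compact_energy_lt_top {α : ℝ} (hα : 0 < α) (hα₂ : α < 2) {R B : ℝ}
    (hB : 0 ≤ B) {L : ℝ≥0∞} (hL : L < ⊤) :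
    ∃ C < ⊤, ∀ (κ : Measure ℝ) [IsProbabilityMeasure κ],
      κ.restrict (Set.Icc (-(R + 1)) (R + 1)) ≤ L • volume → ∀ (s : ℝ) (D : ℝ → ℝ),
      (∀ t, |D t| ^ 2 ≤ B * min 1 ((t - s) ^ 2)) → (∀ t, R < |s| → R < |t| → D t = 0) →
      ∫⁻ t, ENNReal.ofReal (D t ^ 2 / |t - s| ^ (α + 1)) ∂κ ≤ C := by
  refine ⟨L * (ENNReal.ofReal B * ∫⁻ t, levyKernel α 1 t) + ENNReal.ofReal B,
    ENNReal.add_lt_top.2 ⟨ENNReal.mul_lt_top hL (ENNReal.mul_lt_top ENNReal.ofReal_lt_top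
      (lintegral_levyKernel_one_lt_top hα hα₂)), ENNReal.ofReal_lt_top⟩, ?_⟩
  intro κ _ hκ s D hD hD0
  rw [← lintegral_add_compl _ (measurableSet_Icc (a := -(R + 1)) (b := R + 1))]
  refine add_le_add ?_ ?_
  · calc ∫⁻ t in Set.Icc (-(R + 1)) (R + 1), ENNReal.ofReal (D t ^ 2 / |t - s| ^ (α + 1)) ∂κ
        ≤ ∫⁻ t, ENNReal.ofReal (D t ^ 2 / |t - s| ^ (α + 1)) ∂(L • volume) :=
          lintegral_mono' hκ le_rfl
      _ ≤ ∫⁻ t, ENNReal.ofReal B * levyKernel α 1 (t - s) ∂(L • volume) := by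
          refine lintegral_mono fun t => ?_
          rw [levyKernel, ← ENNReal.ofReal_mul hB, ← mul_div_assoc, div_one, ← sq_abs (D t)]
          exact ENNReal.ofReal_le_ofReal (div_le_div_of_nonneg_right (hD t) (by positivity))
      _ = _ := by
          rw [lintegral_smul_measure, lintegral_const_mul _ (by fun_prop),
            lintegral_sub_right_eq_self (fun t => levyKernel α 1 t), smul_eq_mul]
  · calc ∫⁻ t in (Set.Icc (-(R + 1)) (R + 1))ᶜ, ENNReal.ofReal (D t ^ 2 / |t - s| ^ (α + 1)) ∂κ
        ≤ ∫⁻ t in (Set.Icc (-(R + 1)) (R + 1))ᶜ, ENNReal.ofReal B ∂κ := by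
          refine setLIntegral_mono' measurableSet_Icc.compl fun t ht => ?_
          have ht' : R + 1 < |t| := by
            by_contra h
            exact ht (abs_le.1 (not_lt.1 h))
          refine ENNReal.ofReal_le_ofReal ?_
          -- If s lies beyond R as well, the increment vanishes; otherwise t and s are at distance
          -- at least 1 and the singularity plays no role.
          rcases lt_or_ge R |s| with hs | hs
          · rw [hD0 t hs (by linarith)]
            simpa using hB
          · have h1 : 1 ≤ |t - s| := by
              have := abs_sub_abs_le_abs_sub t s
              linarith
            refine (div_le_self (sq_nonneg _) (Real.one_le_rpow h1 (by linarith))).trans ?_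
            rw [← sq_abs (D t)]
            exact (hD t).trans (mul_le_of_le_one_right hB (min_le_left _ _))
      _ ≤ ENNReal.ofReal B := by
          rw [setLIntegral_const]
          exact mul_le_of_le_one_right' prob_le_one

/-! ### Conditional distributions of one coordinate -/

section ConditionalLaw

set_option linter.unusedSectionVars false

variable {S : Type} [TopologicalSpace S] [MeasurableSpace S] [BorelSpace S] [SequenceSpace S]

open SequenceSpace

lemma measurable_coord (i : ℕ) : Measurable (coord i : S → ℝ) := (continuous_coord i).measurable

lemma replace_coord (x : S) (i : ℕ) : replace x i (coord i x) = x := by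
  refine ext_coord _ _ fun j => ?_
  rw [coord_replace]
  split_ifs with h
  · rw [h]
  · rfl

variable (μ : Measure S) [IsProbabilityMeasure μ]

instance (i : ℕ) : IsMarkovKernel (condLaw μ i) := by
  unfold condLaw
  infer_instance

/-- The disintegration of the law of all coordinates with respect to the `i`-th one. -/
lemma lintegral_condLaw (i : ℕ) {F : ({j : ℕ // j ≠ i} → ℝ) × ℝ → ℝ≥0∞} (hF : Measurable F) :
    ∫⁻ x, ∫⁻ s, F (others i x, s) ∂condLaw μ i x ∂μ = ∫⁻ x, F (others i x, coord i x) ∂μ := by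
  have h1 : ∫⁻ x, F (others i x, coord i x) ∂μ
      = ∫⁻ z, F z ∂μ.map fun x => (others i x, coord i x) :=
    (lintegral_map hF ((measurable_others i).prodMk (measurable_coord i))).symm
  rw [h1, ← compProd_map_condDistrib (measurable_coord i).aemeasurable,
    Measure.lintegral_compProd hF, lintegral_map (hF.lintegral_kernel_prod_right')
      (measurable_others i)]
  rfl

/-- Given the other coordinates, the `i`-th one and its resampled value are independent and
identically distributed. -/
lemma lintegral_compProd_condLaw (i : ℕ) {F : ℝ → ℝ → ℝ≥0∞}
    (hF : Measurable (Function.uncurry F)) :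
    ∫⁻ q, F (coord i q.1) q.2 ∂(μ ⊗ₘ condLaw μ i)
      = ∫⁻ x, ∫⁻ s, ∫⁻ t, F s t ∂condLaw μ i x ∂condLaw μ i x ∂μ := by
  have hm : Measurable fun q : S × ℝ => F (coord i q.1) q.2 :=
    hF.comp (((measurable_coord i).comp measurable_fst).prodMk measurable_snd)
  rw [Measure.lintegral_compProd hm]
  -- The inner integral depends on x only through the other coordinates and the i-th one, so the
  -- disintegration `lintegral_condLaw` applies to it.
  have hG : Measurable fun z : ({j : ℕ // j ≠ i} → ℝ) × ℝ =>
      ∫⁻ t, F z.2 t ∂condDistrib (coord i) (others i) μ z.1 :=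
    Measurable.lintegral_kernel_prod_right'
      (κ := (condDistrib (coord i) (others i) μ).comap
        (Prod.fst : ({j : ℕ // j ≠ i} → ℝ) × ℝ → _) measurable_fst)
      (f := fun w : (({j : ℕ // j ≠ i} → ℝ) × ℝ) × ℝ => F w.1.2 w.2)
      (hF.comp ((measurable_snd.comp measurable_fst).prodMk measurable_snd))
  exact (lintegral_condLaw μ i hG).symm

/-- The sequence of coordinates is a measurable function of the others and the i-th one, and by the
disintegration the pair (others, resampled value) has the law of (others, old value). -/
lemma map_coords_replace (i : ℕ)
    (hrep : Measurable fun q : S × ℝ => replace q.1 i q.2) :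
    ((μ ⊗ₘ condLaw μ i).map fun q => replace q.1 i q.2).map (fun x j => coord j x)
      = μ.map (fun (x : S) (j : ℕ) => coord j x) := by
  have hpi : Measurable fun (x : S) (j : ℕ) => coord j x :=
    measurable_pi_lambda _ fun j => measurable_coord j
  have hg : Measurable fun (z : ({j : ℕ // j ≠ i} → ℝ) × ℝ) (j : ℕ) =>
      if h : j = i then z.2 else z.1 ⟨j, h⟩ := by
    refine measurable_pi_lambda _ fun j => ?_
    by_cases h : j = i
    · simpa [h] using measurable_snd
    · simp only [h, dite_false]
      exact (measurable_pi_apply _).comp measurable_fst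
  refine Measure.ext_of_lintegral _ fun f hf => ?_
  have hfm : Measurable fun x : S => f fun j => coord j x := hf.comp hpi
  rw [lintegral_map hf hpi, lintegral_map hf hpi, lintegral_map hfm hrep,
    Measure.lintegral_compProd (f := fun q : S × ℝ => f fun j => coord j (replace q.1 i q.2))
      (hfm.comp hrep)]
  have h := lintegral_condLaw μ i (hf.comp hg)
  refine Eq.trans ?_ (h.trans ?_)
  · refine lintegral_congr fun x => lintegral_congr fun s => ?_
    simp only [Function.comp_apply]
    congr 1
    ext j
    rw [coord_replace]
    rfl
  · refine lintegral_congr fun x => ?_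
    simp only [Function.comp_apply]
    congr 1
    ext j
    split_ifs with h
    · rw [h]
    · rfl

variable {μ}

/-- Finite measures on `S` with the same laws of the coordinates agree, if one of them is carried by
countably many compact sets. -/
lemma eq_of_map_coords_eq {μ' : Measure S} [IsFiniteMeasure μ']
    (hmap : μ'.map (fun (x : S) (j : ℕ) => coord j x) = μ.map (fun (x : S) (j : ℕ) => coord j x))
    {F : ℕ → Set S} (hF : ∀ k, IsCompact (F k)) (hmono : Monotone F) (hμ : μ (⋃ k, F k) = 1) :
    μ' = μ := by
  have hpic : Continuous fun (x : S) (j : ℕ) => coord j x :=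
    continuous_pi fun j => continuous_coord j
  have hinj : Function.Injective fun (x : S) (j : ℕ) => coord j x :=
    fun x y h => ext_coord x y fun j => congrFun h j
  have hT2 : T2Space S := T2Space.of_injective_continuous hinj hpic
  -- On a space like l^∞ the coordinates need not generate the Borel sets. Compact sets are
  -- nevertheless determined by the coordinates: their images in ℝ^ℕ are compact, hence measurable,
  -- and the coordinate map is injective.
  have hcpt : ∀ K : Set S, IsCompact K → μ' K = μ K := by
    intro K hK
    have h1 : μ'.map (fun (x : S) (j : ℕ) => coord j x) ((fun (x : S) (j : ℕ) => coord j x) '' K)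
        = μ.map (fun (x : S) (j : ℕ) => coord j x) ((fun (x : S) (j : ℕ) => coord j x) '' K) := by
      rw [hmap]
    rwa [Measure.map_apply hpic.measurable (hK.image hpic).measurableSet,
      Measure.map_apply hpic.measurable (hK.image hpic).measurableSet,
      Set.preimage_image_eq _ hinj] at h1
  have hU : MeasurableSet (⋃ k, F k) := .iUnion fun k => (hF k).measurableSet
  have huniv : μ' Set.univ = μ Set.univ := by
    have h1 := congrArg (fun m => m Set.univ) hmap
    simpa [Measure.map_apply hpic.measurable] using h1
  have hclosed : ∀ K : Set S, IsClosed K → μ' (K ∩ ⋃ k, F k) = μ (K ∩ ⋃ k, F k) := by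
    intro K hK
    have hm : Monotone fun k => K ∩ F k := fun a b hab =>
      Set.inter_subset_inter_right _ (hmono hab)
    rw [Set.inter_iUnion, hm.measure_iUnion, hm.measure_iUnion]
    exact iSup_congr fun k => hcpt _ ((hF k).inter_left hK)
  have hUU : μ' (⋃ k, F k) = μ (⋃ k, F k) := by simpa using hclosed _ isClosed_univ
  have hnull : μ (⋃ k, F k)ᶜ = 0 := by rw [prob_compl_eq_zero_iff hU, hμ]
  have hnull' : μ' (⋃ k, F k)ᶜ = 0 := by
    rw [measure_compl hU (measure_ne_top _ _), huniv, hUU, hμ, measure_univ, tsub_self]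
  refine ext_of_generate_finite {K : Set S | IsClosed K} ?_ isPiSystem_isClosed ?_ huniv
  · rw [BorelSpace.measurable_eq (α := S), borel_eq_generateFrom_isClosed]
  · intro K hK
    have h1 : μ' K = μ' (K ∩ ⋃ k, F k) :=
      (measure_inter_conull hnull').symm
    have h2 : μ K = μ (K ∩ ⋃ k, F k) := (measure_inter_conull hnull).symm
    rw [h1, h2, hclosed K hK]

/-- Invariance of μ under resampling one coordinate. It is what lets statements that hold `μ`-a.e.
be evaluated at the endpoint of a jump. -/
lemma measurePreserving_replace {i : ℕ} (hrep : Continuous fun q : S × ℝ => replace q.1 i q.2)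
    {F : ℕ → Set S} (hF : ∀ k, IsCompact (F k)) (hmono : Monotone F) (hμ : μ (⋃ k, F k) = 1) :
    MeasurePreserving (fun q : S × ℝ => replace q.1 i q.2) (μ ⊗ₘ condLaw μ i) μ :=
  ⟨hrep.measurable, by
    have := Measure.isProbabilityMeasure_map (μ := μ ⊗ₘ condLaw μ i) hrep.measurable.aemeasurable
    exact eq_of_map_coords_eq (map_coords_replace μ i hrep.measurable) hF hmono hμ⟩

lemma IsLocallyBoundedCondDensity.restrict_condLaw_le {ρ : ℕ → S → ℝ → ℝ}
    (hρ : IsLocallyBoundedCondDensity μ ρ) {i : ℕ} {K : Set ℝ} (hK : MeasurableSet K) {L : ℝ}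
    (hL : CondDensityBound μ ρ i K L) :
    ∀ᵐ x ∂μ, (condLaw μ i x).restrict K ≤ ENNReal.ofReal L • volume := by
  filter_upwards [hρ.density i, hL] with x h1 h2
  rw [h1, restrict_withDensity hK]
  calc (volume.restrict K).withDensity (fun y => ENNReal.ofReal (ρ i x y))
      ≤ (volume.restrict K).withDensity fun _ => ENNReal.ofReal L := by
        refine withDensity_mono ?_
        rw [EventuallyLE, ae_restrict_iff' hK]
        filter_upwards [h2] with y hy hyK using ENNReal.ofReal_le_ofReal (hy hyK)
    _ = ENNReal.ofReal L • volume.restrict K := withDensity_const _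
    _ ≤ ENNReal.ofReal L • volume := by
        gcongr
        exact Measure.restrict_le_self

/-- A bound for the integral of a symmetric function of the `i`-th coordinate and its resampled
value which vanishes if both of them belong to `[-a, a]`. -/
theorem lintegral_compProd_condLaw_le {i : ℕ} {a : ℝ} {c : ℝ≥0∞} {E : ℝ → ℝ → ℝ≥0∞}
    (hE : Measurable (Function.uncurry E)) (hsymm : ∀ s t, E s t = E t s)
    (hzero : ∀ s t, |s| ≤ a → |t| ≤ a → E s t = 0)
    (hc : ∀ᵐ x ∂μ, ∀ s, ∫⁻ t, E s t ∂condLaw μ i x ≤ c) :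
    ∫⁻ q, E (coord i q.1) q.2 ∂(μ ⊗ₘ condLaw μ i) ≤ 2 * (c * μ {x | a < |coord i x|}) := by
  obtain ⟨U, hU, hUa⟩ : ∃ U : Set ℝ, MeasurableSet U ∧ ∀ s, s ∈ U ↔ a < |s| :=
    ⟨{s | a < |s|}, measurableSet_lt measurable_const measurable_norm, fun s => Iff.rfl⟩
  obtain ⟨A, hA⟩ : ∃ A : ℝ → ℝ → ℝ≥0∞, ∀ s t, A s t = U.indicator (fun _ => E s t) s :=
    ⟨_, fun _ _ => rfl⟩
  have hAm : Measurable (Function.uncurry A) := by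
    have h1 : Function.uncurry A = (Prod.fst ⁻¹' U).indicator (Function.uncurry E) := by
      ext ⟨s, t⟩
      simp only [Function.uncurry, hA, Set.indicator]
      rfl
    rw [h1]
    exact hE.indicator (measurable_fst hU)
  have hAm' : Measurable (Function.uncurry fun s t => A t s) := hAm.comp measurable_swap
  -- A is E restricted to |s| > a. At least one argument exceeds a wherever E is nonzero, so E is at
  -- most A plus its transpose. The two values are conditionally i.i.d., so both terms have the same
  -- integral: hence the factor 2.
  have hle : ∀ s t, E s t ≤ A s t + A t s := by
    intro s t
    rw [hA, hA]
    by_cases hs : s ∈ U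
    · rw [Set.indicator_of_mem hs]
      exact le_self_add
    by_cases ht : t ∈ U
    · rw [Set.indicator_of_mem ht, hsymm t s]
      exact le_add_self
    · rw [hUa, not_lt] at hs ht
      rw [hzero s t hs ht]
      exact zero_le
  have hmain : ∫⁻ x, ∫⁻ s, ∫⁻ t, A s t ∂condLaw μ i x ∂condLaw μ i x ∂μ
      ≤ c * μ {x | a < |coord i x|} := by
    have h1 : ∫⁻ x, ∫⁻ s, ∫⁻ t, A s t ∂condLaw μ i x ∂condLaw μ i x ∂μ
        ≤ ∫⁻ x, ∫⁻ s, U.indicator (fun _ => c) s ∂condLaw μ i x ∂μ := by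
      refine lintegral_mono_ae ?_
      filter_upwards [hc] with x hx
      refine lintegral_mono fun s => ?_
      simp only [hA]
      by_cases hs : s ∈ U
      · simp only [Set.indicator_of_mem hs]
        exact hx s
      · simp only [Set.indicator_of_notMem hs, lintegral_zero, le_refl]
    have h2 := lintegral_condLaw μ i (F := fun z => U.indicator (fun _ => c) z.2)
      ((measurable_const.indicator hU).comp measurable_snd)
    have h3 : (fun x : S => U.indicator (fun _ => c) (coord i x))
        = (coord i ⁻¹' U).indicator fun _ => c := rfl
    have h4 : (coord i ⁻¹' U : Set S) = {x | a < |coord i x|} := by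
      ext x
      exact hUa _
    refine h1.trans (h2.le.trans ?_)
    rw [h3, lintegral_indicator_const (measurable_coord i hU), h4]
  have hswap : ∫⁻ x, ∫⁻ s, ∫⁻ t, A t s ∂condLaw μ i x ∂condLaw μ i x ∂μ
      = ∫⁻ x, ∫⁻ s, ∫⁻ t, A s t ∂condLaw μ i x ∂condLaw μ i x ∂μ :=
    lintegral_congr fun x => lintegral_lintegral_swap hAm'.aemeasurable
  have hAq : Measurable fun q : S × ℝ => A (coord i q.1) q.2 :=
    hAm.comp (((measurable_coord i).comp measurable_fst).prodMk measurable_snd)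
  refine (lintegral_mono fun q => hle _ _).trans ?_
  rw [lintegral_add_left hAq, lintegral_compProd_condLaw μ i hAm,
    lintegral_compProd_condLaw μ i hAm', hswap, ← two_mul]
  exact mul_le_mul_right hmain 2

/-- The energy of the cutoff functions of the `i`-th coordinate. -/
theorem exists_lintegral_cutoffEnergy_compProd_le {α : ℝ} (hα : 0 < α) (hα₂ : α < 2)
    {ρ : ℕ → S → ℝ → ℝ} (hρ : IsLocallyBoundedCondDensity μ ρ) :
    ∃ C < ⊤, ∀ (i : ℕ) (a L : ℝ), 0 < a →
      CondDensityBound μ ρ i (Set.Icc (-(6 * a)) (6 * a)) L →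
      ∫⁻ q, cutoffEnergy α a (coord i q.1) q.2 ∂(μ ⊗ₘ condLaw μ i) ≤
        2 * ((C * (ENNReal.ofReal L * ENNReal.ofReal (a ^ (-α))) +
          ENNReal.ofReal (a ^ (-(α + 1)))) * μ {x | a < |coord i x|}) := by
  obtain ⟨C, hC, h⟩ := exists_lintegral_cutoffEnergy_le hα hα₂
  refine ⟨C, hC, fun i a L ha hL => lintegral_compProd_condLaw_le (measurable_cutoffEnergy α a)
    (cutoffEnergy_comm α a) (fun s t => cutoffEnergy_eq_zero ha) ?_⟩
  filter_upwards [hρ.restrict_condLaw_le measurableSet_Icc hL] with x hx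
  exact h (condLaw μ i x) a _ ha hx

end ConditionalLaw

/-! ### The jump gradient and its graph -/

lemma eLpNorm_two_sq {X : Type*} [MeasurableSpace X] {m : Measure X} (f : X → ℝ) :
    eLpNorm f 2 m ^ 2 = ∫⁻ x, ‖f x‖ₑ ^ 2 ∂m := by
  rw [eLpNorm_eq_lintegral_rpow_enorm_toReal two_ne_zero ENNReal.ofNat_ne_top,
    ← ENNReal.rpow_natCast, ← ENNReal.rpow_mul]
  simp

section JumpGradient

set_option linter.unusedSectionVars false

variable {S : Type} [TopologicalSpace S] [MeasurableSpace S] [BorelSpace S] [SequenceSpace S]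

open SequenceSpace

/-- The measure on triples `(i, x, y)`: the sum over `i` of the laws of a point `x` and of a value
`y` of its `i`-th coordinate resampled given the other ones. -/
def jumpMeasure (μ : Measure S) [IsProbabilityMeasure μ] : Measure (ℕ × (S × ℝ)) :=
  Measure.sum fun i => (μ ⊗ₘ condLaw μ i).map (Prod.mk i)

/-- The jump gradient of `u`. -/
def jumpGrad (α : ℝ) (u : S → ℝ) (z : ℕ × (S × ℝ)) : ℝ :=
  (u (replace z.2.1 z.1 z.2.2) - u z.2.1) / |z.2.2 - coord z.1 z.2.1| ^ ((α + 1) / 2)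

lemma jumpGrad_add (α : ℝ) (u v : S → ℝ) : jumpGrad α (u + v) = jumpGrad α u + jumpGrad α v := by
  ext z
  simp only [jumpGrad, Pi.add_apply]
  ring

lemma jumpGrad_smul (α c : ℝ) (u : S → ℝ) : jumpGrad α (c • u) = c • jumpGrad α u := by
  ext z
  simp only [jumpGrad, Pi.smul_apply, smul_eq_mul]
  ring

lemma jumpGrad_one_sub (α : ℝ) (u : S → ℝ) :
    jumpGrad α (fun x => 1 - u x) = fun z => -jumpGrad α u z := by
  ext z
  simp only [jumpGrad]
  ring

lemma jumpGrad_const (α c : ℝ) : jumpGrad α (fun _ : S => c) = 0 := by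
  ext z
  simp [jumpGrad]

/-- The two exponents (α+1)/2 add up, and on the diagonal both sides vanish since no jump takes
place. Thus 𝓔 is an L² inner product of gradients. -/
lemma jumpGrad_mul_jumpGrad (α : ℝ) (u v : S → ℝ) (i : ℕ) (q : S × ℝ) :
    jumpGrad α u (i, q) * jumpGrad α v (i, q) = jumpIntegrand α u v i q := by
  unfold jumpGrad jumpIntegrand
  split_ifs with h
  · simp [h, replace_coord]
  · have h0 : 0 < |q.2 - coord i q.1| := abs_pos.2 (sub_ne_zero.2 h)
    rw [jumpKernel, replace_coord, div_mul_div_comm, ← Real.rpow_add h0, add_halves]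
    ring

lemma abs_jumpGrad_comp_le (α : ℝ) {φ : ℝ → ℝ} (hφ : ∀ s t, |φ s - φ t| ≤ |s - t|) (u : S → ℝ)
    (z : ℕ × (S × ℝ)) : |jumpGrad α (fun x => φ (u x)) z| ≤ |jumpGrad α u z| := by
  simp only [jumpGrad, abs_div]
  exact div_le_div_of_nonneg_right (hφ _ _) (abs_nonneg _)

/-- Leibniz rule for increments: v at the new point times the increment of u, plus u at the old
point times the increment of v. -/
lemma abs_jumpGrad_mul_le (α : ℝ) {u v : S → ℝ} {A B : ℝ} (hu : ∀ x, |u x| ≤ A)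
    (hv : ∀ x, |v x| ≤ B) (z : ℕ × (S × ℝ)) :
    |jumpGrad α (fun x => u x * v x) z| ≤ B * |jumpGrad α u z| + A * |jumpGrad α v z| := by
  simp only [jumpGrad, abs_div]
  rw [← mul_div_assoc, ← mul_div_assoc, ← add_div]
  refine div_le_div_of_nonneg_right ?_ (abs_nonneg _)
  set x := z.2.1
  set y := replace x z.1 z.2.2
  calc |u y * v y - u x * v x| = |v y * (u y - u x) + u x * (v y - v x)| := by ring_nf
    _ ≤ |v y| * |u y - u x| + |u x| * |v y - v x| := by
        rw [← abs_mul, ← abs_mul]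
        exact abs_add_le _ _
    _ ≤ B * |u y - u x| + A * |v y - v x| := by
        gcongr
        · exact hv y
        · exact hu x

lemma jumpGrad_coord_eq_zero (α : ℝ) (θ : ℝ → ℝ) {i j : ℕ} (hij : i ≠ j) (q : S × ℝ) :
    jumpGrad α (fun x => θ (coord j x)) (i, q) = 0 := by
  simp [jumpGrad, coord_replace, hij.symm]

lemma enorm_sq_jumpGrad_coord (α : ℝ) (θ : ℝ → ℝ) (i : ℕ) (q : S × ℝ) :
    ‖jumpGrad α (fun x => θ (coord i x)) (i, q)‖ₑ ^ 2
      = ENNReal.ofReal ((θ q.2 - θ (coord i q.1)) ^ 2 / |q.2 - coord i q.1| ^ (α + 1)) := by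
  rw [Real.enorm_eq_ofReal_abs, ← ENNReal.ofReal_pow (abs_nonneg _), sq_abs, jumpGrad]
  simp only [coord_replace, if_true]
  rw [div_pow, ← Real.rpow_natCast (_ ^ _), ← Real.rpow_mul (abs_nonneg _)]
  congr 3
  push_cast
  ring

variable {μ : Measure S} [IsProbabilityMeasure μ]

lemma ae_jumpMeasure_iff {p : ℕ × (S × ℝ) → Prop} :
    (∀ᵐ z ∂jumpMeasure μ, p z) ↔ ∀ i, ∀ᵐ q ∂(μ ⊗ₘ condLaw μ i), p (i, q) := by
  rw [jumpMeasure, Measure.ae_sum_iff]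
  exact forall_congr' fun i => (measurableEmbedding_prodMk_left i).ae_map_iff

lemma lintegral_jumpMeasure (f : ℕ × (S × ℝ) → ℝ≥0∞) :
    ∫⁻ z, f z ∂jumpMeasure μ = ∑' i, ∫⁻ q, f (i, q) ∂(μ ⊗ₘ condLaw μ i) := by
  rw [jumpMeasure, lintegral_sum_measure]
  exact tsum_congr fun i => (measurableEmbedding_prodMk_left i).lintegral_map f

lemma measurable_jumpGrad (hrep : ∀ i, Measurable fun q : S × ℝ => replace q.1 i q.2) (α : ℝ)
    {u : S → ℝ} (hu : Measurable u) : Measurable (jumpGrad α u) := by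
  refine measurable_from_prod_countable_right fun i => ?_
  have h1 := hu.comp (hrep i)
  have h2 : Measurable fun q : S × ℝ => coord i q.1 := (measurable_coord i).comp measurable_fst
  exact (h1.sub (hu.comp measurable_fst)).div ((measurable_snd.sub h2).norm.pow_const _)

/-- The energy of `u`, that is the sum of the `𝓔_(α)^(i)(u, u)`. -/
def jumpEnergy (α : ℝ) (μ : Measure S) [IsProbabilityMeasure μ] (u : S → ℝ) : ℝ≥0∞ :=
  ∫⁻ z, ‖jumpGrad α u z‖ₑ ^ 2 ∂jumpMeasure μ

lemma jumpEnergy_one_sub (α : ℝ) (u : S → ℝ) :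
    jumpEnergy α μ (fun x => 1 - u x) = jumpEnergy α μ u := by
  simp only [jumpEnergy, jumpGrad_one_sub, enorm_neg]

lemma jumpEnergy_coord (α : ℝ) (θ : ℝ → ℝ) (i : ℕ) :
    jumpEnergy α μ (fun x => θ (coord i x)) = ∫⁻ q : S × ℝ,
      ENNReal.ofReal ((θ q.2 - θ (coord i q.1)) ^ 2 / |q.2 - coord i q.1| ^ (α + 1))
        ∂(μ ⊗ₘ condLaw μ i) := by
  rw [jumpEnergy, lintegral_jumpMeasure, tsum_eq_single i]
  · exact lintegral_congr fun q => enorm_sq_jumpGrad_coord α θ i q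
  · intro j hj
    simp [jumpGrad_coord_eq_zero α θ hj]

/-- The Hilbert space `L²(μ) × L²(jumpMeasure μ)`. -/
abbrev JumpSpace (μ : Measure S) [IsProbabilityMeasure μ] : Type :=
  WithLp 2 (Lp ℝ 2 μ × Lp ℝ 2 (jumpMeasure μ))

/-- `w` is the pair of the classes of `u` and of its jump gradient. -/
def HasJumpGrad (α : ℝ) (w : JumpSpace μ) (u : S → ℝ) : Prop :=
  w.fst =ᵐ[μ] u ∧ w.snd =ᵐ[jumpMeasure μ] jumpGrad α u

namespace HasJumpGrad

variable {α : ℝ} {w w' : JumpSpace μ} {u v : S → ℝ}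

lemma add (hw : HasJumpGrad α w u) (hw' : HasJumpGrad α w' v) :
    HasJumpGrad α (w + w') (u + v) := by
  constructor
  · exact (Lp.coeFn_add w.fst w'.fst).trans (hw.1.add hw'.1)
  · rw [jumpGrad_add]
    exact (Lp.coeFn_add w.snd w'.snd).trans (hw.2.add hw'.2)

lemma smul (hw : HasJumpGrad α w u) (c : ℝ) : HasJumpGrad α (c • w) (c • u) := by
  constructor
  · exact (Lp.coeFn_smul c w.fst).trans (hw.1.const_smul c)
  · rw [jumpGrad_smul]
    exact (Lp.coeFn_smul c w.snd).trans (hw.2.const_smul c)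

lemma zero : HasJumpGrad α (0 : JumpSpace μ) 0 := by
  constructor
  · exact Lp.coeFn_zero _ _ _
  · have : jumpGrad α (0 : S → ℝ) = 0 := jumpGrad_const α 0
    rw [this]
    exact Lp.coeFn_zero _ _ _

lemma unique (hw : HasJumpGrad α w u) (hw' : HasJumpGrad α w' u) : w = w' := by
  refine WithLp.ofLp_injective 2 (Prod.ext ?_ ?_)
  · exact Lp.ext (hw.1.trans hw'.1.symm)
  · exact Lp.ext (hw.2.trans hw'.2.symm)

lemma enorm_fst_sq (hw : HasJumpGrad α w u) : ‖w.fst‖ₑ ^ 2 = ∫⁻ x, ‖u x‖ₑ ^ 2 ∂μ := by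
  rw [Lp.enorm_def, eLpNorm_congr_ae hw.1, eLpNorm_two_sq]

lemma enorm_snd_sq (hw : HasJumpGrad α w u) : ‖w.snd‖ₑ ^ 2 = jumpEnergy α μ u := by
  rw [Lp.enorm_def, eLpNorm_congr_ae hw.2, eLpNorm_two_sq, jumpEnergy]

end HasJumpGrad

lemma enorm_sq_eq_add (w : JumpSpace μ) : ‖w‖ₑ ^ 2 = ‖w.fst‖ₑ ^ 2 + ‖w.snd‖ₑ ^ 2 := by
  simp only [← ofReal_norm, ← ENNReal.ofReal_pow (norm_nonneg _)]
  rw [WithLp.prod_norm_sq_eq_of_L2, ENNReal.ofReal_add (by positivity) (by positivity)]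

lemma HasJumpGrad.enorm_sq {α : ℝ} {w : JumpSpace μ} {u : S → ℝ} (hw : HasJumpGrad α w u) :
    ‖w‖ₑ ^ 2 = ∫⁻ x, ‖u x‖ₑ ^ 2 ∂μ + jumpEnergy α μ u := by
  rw [enorm_sq_eq_add, hw.enorm_fst_sq, hw.enorm_snd_sq]

lemma exists_hasJumpGrad (hrep : ∀ i, Measurable fun q : S × ℝ => replace q.1 i q.2) {α : ℝ}
    {u : S → ℝ} (hu : Measurable u) (hu₂ : MemLp u 2 μ) (hE : jumpEnergy α μ u < ⊤) :
    ∃ w : JumpSpace μ, HasJumpGrad α w u := by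
  have hg : MemLp (jumpGrad α u) 2 (jumpMeasure μ) := by
    refine ⟨(measurable_jumpGrad hrep α hu).aestronglyMeasurable, ?_⟩
    rw [jumpEnergy, ← eLpNorm_two_sq] at hE
    by_contra h
    rw [not_lt, top_le_iff] at h
    simp [h] at hE
  exact ⟨WithLp.toLp 2 (hu₂.toLp u, hg.toLp _), hu₂.coeFn_toLp, hg.coeFn_toLp⟩

/-! ### Invariance under resampling: the gradient on classes and its closedness -/

variable (hMP : ∀ i, MeasurePreserving (fun q : S × ℝ => replace q.1 i q.2) (μ ⊗ₘ condLaw μ i) μ)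

-- Under each summand of the jump measure both the starting point and the endpoint of the jump have
-- law μ, so a μ-null set is met at either end with probability zero.
include hMP in
lemma jumpGrad_congr_ae (α : ℝ) {u v : S → ℝ} (huv : u =ᵐ[μ] v) :
    jumpGrad α u =ᵐ[jumpMeasure μ] jumpGrad α v := by
  refine ae_jumpMeasure_iff.2 fun i => ?_
  have h1 : ∀ᵐ q ∂(μ ⊗ₘ condLaw μ i), u q.1 = v q.1 := by
    have h2 : MeasurePreserving Prod.fst (μ ⊗ₘ condLaw μ i) μ :=
      ⟨measurable_fst, Measure.fst_compProd μ (condLaw μ i)⟩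
    exact h2.quasiMeasurePreserving.ae huv
  filter_upwards [h1, (hMP i).quasiMeasurePreserving.ae huv] with q hq1 hq2
  simp only [jumpGrad, hq1, hq2]

include hMP in
lemma HasJumpGrad.congr {α : ℝ} {w : JumpSpace μ} {u v : S → ℝ} (hw : HasJumpGrad α w u)
    (huv : u =ᵐ[μ] v) : HasJumpGrad α w v :=
  ⟨hw.1.trans huv, hw.2.trans (jumpGrad_congr_ae hMP α huv)⟩

/-- The graph of the jump gradient, with its maximal domain. -/
def jumpGraph (α : ℝ) : Submodule ℝ (JumpSpace μ) where
  carrier := {w | HasJumpGrad α w w.fst}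
  zero_mem' := HasJumpGrad.zero.congr hMP (Lp.coeFn_zero ℝ 2 μ).symm
  add_mem' {w w'} hw hw' := (HasJumpGrad.add hw hw').congr hMP (Lp.coeFn_add w.fst w'.fst).symm
  smul_mem' c w hw := (HasJumpGrad.smul hw c).congr hMP (Lp.coeFn_smul c w.fst).symm

lemma HasJumpGrad.mem_jumpGraph {α : ℝ} {w : JumpSpace μ} {u : S → ℝ} (hw : HasJumpGrad α w u) :
    w ∈ jumpGraph hMP α := hw.congr hMP hw.1.symm

/-- Along a subsequence u_n converges a.e., hence by invariance at both ends of a jump, so the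
gradients converge a.e. to the gradient of the limit; along a further subsequence they converge a.e.
to their L² limit, and the two agree. -/
lemma isClosed_jumpGraph (α : ℝ) : IsClosed (jumpGraph hMP α : Set (JumpSpace μ)) := by
  refine IsSeqClosed.isClosed fun w l hw hl => ⟨EventuallyEq.rfl, ?_⟩
  have h1 : Tendsto (fun n => (w n).fst) atTop (𝓝 l.fst) :=
    ((WithLp.fstL 2 ℝ (Lp ℝ 2 μ) (Lp ℝ 2 (jumpMeasure μ))).continuous.tendsto l).comp hl
  have h2 : Tendsto (fun n => (w n).snd) atTop (𝓝 l.snd) :=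
    ((WithLp.sndL 2 ℝ (Lp ℝ 2 μ) (Lp ℝ 2 (jumpMeasure μ))).continuous.tendsto l).comp hl
  obtain ⟨ns, hns, h3⟩ := (tendstoInMeasure_of_tendsto_Lp h1).exists_seq_tendsto_ae
  obtain ⟨ms, hms, h4⟩ :=
    (tendstoInMeasure_of_tendsto_Lp (h2.comp hns.tendsto_atTop)).exists_seq_tendsto_ae
  have h5 : ∀ᵐ z ∂jumpMeasure μ, ∀ n, (w n).snd z = jumpGrad α (w n).fst z :=
    ae_all_iff.2 fun n => (hw n).2
  have h6 : ∀ᵐ z ∂jumpMeasure μ,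
      Tendsto (fun n => jumpGrad α (w (ns n)).fst z) atTop (𝓝 (jumpGrad α l.fst z)) := by
    refine ae_jumpMeasure_iff.2 fun i => ?_
    have h7 : MeasurePreserving Prod.fst (μ ⊗ₘ condLaw μ i) μ :=
      ⟨measurable_fst, Measure.fst_compProd μ (condLaw μ i)⟩
    filter_upwards [h7.quasiMeasurePreserving.ae h3, (hMP i).quasiMeasurePreserving.ae h3]
      with q hq1 hq2
    exact (hq2.sub hq1).div_const _
  filter_upwards [h4, h5, h6] with z hz4 hz5 hz6
  refine tendsto_nhds_unique hz4 ?_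
  simp only [Function.comp_apply, hz5]
  exact hz6.comp hms.tendsto_atTop

/-- The graph of the jump gradient on the smooth cylinder functions of the coordinates
`0, …, n`. -/
def cylinderGraph (α : ℝ) (μ : Measure S) [IsProbabilityMeasure μ] (n : ℕ) :
    Submodule ℝ (JumpSpace μ) where
  carrier := {w | ∃ f : (Fin (n + 1) → ℝ) → ℝ, ContDiff ℝ ∞ f ∧ HasCompactSupport f ∧
    HasJumpGrad α w fun x => f fun k => coord (k : ℕ) x}
  zero_mem' := ⟨0, contDiff_const, HasCompactSupport.zero, HasJumpGrad.zero⟩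
  add_mem' := by
    rintro w w' ⟨f, hf, hfc, hw⟩ ⟨g, hg, hgc, hw'⟩
    exact ⟨f + g, hf.add hg, hfc.add hgc, hw.add hw'⟩
  smul_mem' := by
    rintro c w ⟨f, hf, hfc, hw⟩
    exact ⟨c • f, hf.const_smul c, hfc.smul_left (f := fun _ => c), hw.smul c⟩

/-- The closure of the graph of the jump gradient on smooth cylinder functions. -/
def energyGraph (α : ℝ) (μ : Measure S) [IsProbabilityMeasure μ] : Submodule ℝ (JumpSpace μ) :=
  (⨆ n, cylinderGraph α μ n).topologicalClosure

lemma isClosed_energyGraph (α : ℝ) : IsClosed (energyGraph α μ : Set (JumpSpace μ)) :=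
  Submodule.isClosed_topologicalClosure _

lemma cylinderGraph_le_energyGraph (α : ℝ) (n : ℕ) : cylinderGraph α μ n ≤ energyGraph α μ :=
  (le_iSup _ n).trans (Submodule.le_topologicalClosure _)

lemma energyGraph_le_jumpGraph (α : ℝ) : energyGraph α μ ≤ jumpGraph hMP α := by
  refine Submodule.topologicalClosure_minimal _ (iSup_le fun n => ?_) (isClosed_jumpGraph hMP α)
  rintro w ⟨f, -, -, hw⟩
  exact hw.mem_jumpGraph hMP

include hMP in
lemma HasJumpGrad.of_mem {α : ℝ} {w : JumpSpace μ} (hw : w ∈ energyGraph α μ) {u : S → ℝ}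
    (hu : w.fst =ᵐ[μ] u) : HasJumpGrad α w u :=
  HasJumpGrad.congr hMP (energyGraph_le_jumpGraph hMP α hw) hu

/-- The projection of the closure of the graph to `L²(μ)`. -/
def energyGraphFst (α : ℝ) (μ : Measure S) [IsProbabilityMeasure μ] :
    energyGraph α μ →ₗ[ℝ] Lp ℝ 2 μ :=
  (WithLp.fstL 2 ℝ (Lp ℝ 2 μ) (Lp ℝ 2 (jumpMeasure μ))).toLinearMap.domRestrict (energyGraph α μ)

-- This is closability: inside the closed graph the function determines its gradient.
include hMP in
lemma energyGraphFst_injective (α : ℝ) : Function.Injective (energyGraphFst α μ) := by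
  intro w w' h
  have h1 : w.1.fst = w'.1.fst := h
  refine Subtype.ext ((HasJumpGrad.of_mem hMP w.2 EventuallyEq.rfl).unique
    (HasJumpGrad.of_mem hMP w'.2 ?_))
  rw [h1]

/-- The lift of the domain of the form to the closure of the graph. -/
def energyLift (α : ℝ) : LinearMap.range (energyGraphFst α μ) ≃ₗ[ℝ] energyGraph α μ :=
  (LinearEquiv.ofInjective (energyGraphFst α μ) (energyGraphFst_injective hMP α)).symm

/-- The jump form `𝓔_(α)` on the closure of the cylinder functions. -/
def jumpForm (α : ℝ) : L2Form μ where
  domain := LinearMap.range (energyGraphFst α μ)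
  form :=
    let G : LinearMap.range (energyGraphFst α μ) →ₗ[ℝ] Lp ℝ 2 (jumpMeasure μ) :=
      (WithLp.sndL 2 ℝ (Lp ℝ 2 μ) (Lp ℝ 2 (jumpMeasure μ))).toLinearMap ∘ₗ
        (energyGraph α μ).subtype ∘ₗ (energyLift hMP α).toLinearMap
    (innerₗ (Lp ℝ 2 (jumpMeasure μ))).compl₁₂ G G

/-! ### The form expressed through lifts to the closed graph -/

variable {hMP} {α : ℝ}

/-- The element of the closure of the graph over an element of the domain. -/
def lift (u : (jumpForm hMP α).domain) : JumpSpace μ := (energyLift hMP α u : JumpSpace μ)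

lemma lift_mem (u : (jumpForm hMP α).domain) : lift u ∈ energyGraph α μ := (energyLift hMP α u).2

lemma lift_fst (u : (jumpForm hMP α).domain) : (lift u).fst = (u : Lp ℝ 2 μ) := by
  have h := LinearEquiv.apply_symm_apply
    (LinearEquiv.ofInjective (energyGraphFst α μ) (energyGraphFst_injective hMP α)) u
  exact congrArg Subtype.val h

lemma lift_sub (u v : (jumpForm hMP α).domain) : lift (u - v) = lift u - lift v :=
  congrArg Subtype.val (map_sub (energyLift hMP α) u v)

lemma exists_lift_eq {w : JumpSpace μ} (hw : w ∈ energyGraph α μ) :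
    ∃ u : (jumpForm hMP α).domain, lift u = w :=
  ⟨(energyLift hMP α).symm ⟨w, hw⟩,
    congrArg Subtype.val ((energyLift hMP α).apply_symm_apply ⟨w, hw⟩)⟩

lemma jumpForm_apply (u v : (jumpForm hMP α).domain) :
    (jumpForm hMP α).form u v = inner ℝ (lift u).snd (lift v).snd := rfl

lemma jumpForm_form₁ (u v : (jumpForm hMP α).domain) :
    (jumpForm hMP α).form₁ u v = inner ℝ (lift u) (lift v) := by
  rw [L2Form.form₁, jumpForm_apply, WithLp.prod_inner_apply, add_comm, ← lift_fst u, ← lift_fst v]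
  rfl

lemma jumpForm_form₁_self (u : (jumpForm hMP α).domain) :
    (jumpForm hMP α).form₁ u u = ‖lift u‖ ^ 2 := by
  rw [jumpForm_form₁, real_inner_self_eq_norm_sq]

lemma isClosedForm_jumpForm : (jumpForm hMP α).IsClosedForm := by
  intro u hu
  have hcauchy : CauchySeq fun n => lift (u n) := by
    rw [Metric.cauchySeq_iff]
    intro ε hε
    obtain ⟨N, hN⟩ := hu (ε ^ 2) (by positivity)
    refine ⟨N, fun m hm n hn => ?_⟩
    have h := hN m hm n hn
    rw [jumpForm_form₁_self, lift_sub] at h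
    rw [dist_eq_norm]
    exact lt_of_pow_lt_pow_left₀ 2 hε.le h
  obtain ⟨l, hl⟩ := cauchySeq_tendsto_of_complete hcauchy
  have hlmem : l ∈ energyGraph α μ :=
    (isClosed_energyGraph α).mem_of_tendsto hl (Eventually.of_forall fun n => lift_mem (u n))
  obtain ⟨v, rfl⟩ := exists_lift_eq (hMP := hMP) hlmem
  refine ⟨v, ?_⟩
  simp only [jumpForm_form₁_self, lift_sub]
  have := (tendsto_iff_norm_sub_tendsto_zero.1 hl).pow 2
  simpa using this

end JumpGradient

/-! ### Smooth cylinder functions -/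

section Cylinder

set_option linter.unusedSectionVars false

variable {S : Type} [TopologicalSpace S] [MeasurableSpace S] [BorelSpace S] [SequenceSpace S]

open SequenceSpace

lemma exists_bound_of_hasCompactSupport {n : ℕ} {f : (Fin n → ℝ) → ℝ} (hf : Continuous f)
    (hfc : HasCompactSupport f) : ∃ A, 0 ≤ A ∧ ∀ p, |f p| ≤ A := by
  obtain ⟨A, hA⟩ := hf.bounded_above_of_compact_support hfc
  exact ⟨A, (norm_nonneg _).trans (hA 0), hA⟩

lemma exists_radius_of_hasCompactSupport {n : ℕ} {f : (Fin n → ℝ) → ℝ}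
    (hfc : HasCompactSupport f) : ∃ R, 0 ≤ R ∧ ∀ p k, R < |p k| → f p = 0 := by
  obtain ⟨R, hR⟩ := hfc.isCompact.isBounded.subset_closedBall 0
  refine ⟨max R 0, le_max_right _ _, fun p k hp => ?_⟩
  by_contra h
  have h1 := hR (subset_tsupport f h)
  rw [mem_closedBall_zero_iff] at h1
  exact absurd ((norm_le_pi_norm p k).trans h1) (not_le.2 ((le_max_left _ _).trans_lt hp))

lemma hasCompactSupport_of_radius {n : ℕ} {f : (Fin n → ℝ) → ℝ} {R : ℝ}
    (h : ∀ p k, R < |p k| → f p = 0) : HasCompactSupport f := by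
  refine HasCompactSupport.intro (isCompact_univ_pi fun _ => isCompact_Icc (a := -R) (b := R))
    fun p hp => ?_
  simp only [Set.mem_univ_pi, not_forall] at hp
  obtain ⟨k, hk⟩ := hp
  exact h p k (by rwa [Set.mem_Icc, ← abs_le, not_le] at hk)

lemma continuous_cylinder {n : ℕ} {f : (Fin n → ℝ) → ℝ} (hf : Continuous f) :
    Continuous fun x : S => f fun k => coord (k : ℕ) x :=
  hf.comp (continuous_pi fun _ => continuous_coord _)

variable {μ : Measure S} [IsProbabilityMeasure μ]

lemma memLp_of_bound {u : S → ℝ} (hu : Measurable u) {A : ℝ} (hA : ∀ x, |u x| ≤ A) :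
    MemLp u 2 μ :=
  MemLp.of_bound hu.aestronglyMeasurable A (Eventually.of_forall hA)

/-- The form `𝓔_(α)` is finite on cylinder functions. -/
theorem jumpEnergy_cylinder_lt_top {α : ℝ} (hα : 0 < α) (hα₂ : α < 2)
    (hrep : ∀ i, Measurable fun q : S × ℝ => replace q.1 i q.2)
    {ρ : ℕ → S → ℝ → ℝ} (hρ : IsLocallyBoundedCondDensity μ ρ) {n : ℕ}
    {f : (Fin (n + 1) → ℝ) → ℝ} (hf : ContDiff ℝ ∞ f) (hfc : HasCompactSupport f) :
    jumpEnergy α μ (fun x => f fun k => coord (k : ℕ) x) < ⊤ := by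
  set u : S → ℝ := fun x => f fun k => coord (k : ℕ) x with hu
  have hum : Measurable u := (continuous_cylinder hf.continuous).measurable
  obtain ⟨A, hA0, hA⟩ := exists_bound_of_hasCompactSupport hf.continuous hfc
  have huA : ∀ x, |u x| ≤ A := fun x => hA _
  obtain ⟨R, hR0, hR⟩ := exists_radius_of_hasCompactSupport hfc
  obtain ⟨C, hC⟩ := hf.lipschitzWith_of_hasCompactSupport hfc (by simp)
  -- Only jumps in the coordinates 0, …, n change the value of u.
  rw [jumpEnergy, lintegral_jumpMeasure, tsum_eq_sum (s := Finset.range (n + 1))]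
  · refine ENNReal.sum_lt_top.2 fun i hi => ?_
    obtain ⟨L, hL⟩ := hρ.locally_bounded i (Set.Icc (-(R + 1)) (R + 1)) isCompact_Icc
    -- The constant merges two bounds on the increment: 2A from boundedness and C |t - s| from the
    -- Lipschitz property.
    obtain ⟨c, hc, hle⟩ := lintegral_compact_energy_lt_top hα hα₂ (R := R)
      (B := 4 * A ^ 2 + C ^ 2) (by positivity) (ENNReal.ofReal_lt_top (r := L))
    have hm : Measurable fun q : S × ℝ => ‖jumpGrad α u (i, q)‖ₑ ^ 2 :=
      ((measurable_jumpGrad hrep α hum).comp measurable_prodMk_left).enorm.pow_const _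
    rw [Measure.lintegral_compProd hm]
    have hbound : ∀ᵐ x ∂μ, ∫⁻ t, ‖jumpGrad α u (i, (x, t))‖ₑ ^ 2 ∂condLaw μ i x ≤ c := by
      filter_upwards [hρ.restrict_condLaw_le measurableSet_Icc hL] with x hx
      have h := hle (condLaw μ i x) hx (coord i x) (fun t => u (replace x i t) - u x) ?_ ?_
      · refine le_trans (le_of_eq (lintegral_congr fun t => ?_)) h
        rw [Real.enorm_eq_ofReal_abs, ← ENNReal.ofReal_pow (abs_nonneg _), sq_abs, jumpGrad, div_pow,
          ← Real.rpow_natCast (_ ^ _), ← Real.rpow_mul (abs_nonneg _)]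
        congr 3
        push_cast
        ring
      · intro t
        rw [mul_min_of_nonneg _ _ (by positivity)]
        refine le_min ?_ ?_
        · have h1 : |u (replace x i t) - u x| ≤ 2 * A :=
            (abs_sub _ _).trans (by linarith [huA (replace x i t), huA x])
          have h2 := pow_le_pow_left₀ (abs_nonneg _) h1 2
          nlinarith [sq_nonneg (C : ℝ)]
        · have h1 : |u (replace x i t) - u x| ≤ C * |t - coord i x| := by
            refine (hC.dist_le_mul _ _).trans ?_
            refine mul_le_mul_of_nonneg_left ?_ C.2
            rw [dist_pi_le_iff (abs_nonneg _)]
            intro k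
            rw [coord_replace]
            split_ifs with hk
            · rw [hk, Real.dist_eq]
            · rw [dist_self]
              exact abs_nonneg _
          have h2 := pow_le_pow_left₀ (abs_nonneg _) h1 2
          rw [mul_pow, sq_abs (t - _)] at h2
          nlinarith [sq_nonneg A, sq_nonneg (t - coord i x), mul_nonneg (sq_nonneg A)
            (sq_nonneg (t - coord i x))]
      · intro t hs ht
        have hi' : i < n + 1 := Finset.mem_range.1 hi
        have h1 : u (replace x i t) = 0 := hR _ ⟨i, hi'⟩ (by simpa [coord_replace] using ht)
        have h2 : u x = 0 := hR _ ⟨i, hi'⟩ hs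
        rw [h1, h2, sub_zero]
    refine (lintegral_mono_ae hbound).trans_lt ?_
    simpa using hc
  · intro i hi
    have h0 : ∀ q : S × ℝ, jumpGrad α u (i, q) = 0 := by
      intro q
      have h1 : u (replace q.1 i q.2) = u q.1 := by
        simp only [hu]
        congr 1
        ext k
        rw [coord_replace, if_neg]
        rintro rfl
        exact hi (Finset.mem_range.2 k.2)
      simp [jumpGrad, h1]
    simp [h0]

lemma exists_mem_cylinderGraph {α : ℝ} (hα : 0 < α) (hα₂ : α < 2)
    (hrep : ∀ i, Measurable fun q : S × ℝ => replace q.1 i q.2)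
    {ρ : ℕ → S → ℝ → ℝ} (hρ : IsLocallyBoundedCondDensity μ ρ) {n : ℕ}
    {f : (Fin (n + 1) → ℝ) → ℝ} (hf : ContDiff ℝ ∞ f) (hfc : HasCompactSupport f) :
    ∃ w ∈ cylinderGraph α μ n, HasJumpGrad α w fun x => f fun k => coord (k : ℕ) x := by
  obtain ⟨A, -, hA⟩ := exists_bound_of_hasCompactSupport hf.continuous hfc
  have hm : Measurable fun x : S => f fun k => coord (k : ℕ) x :=
    (continuous_cylinder hf.continuous).measurable
  obtain ⟨w, hw⟩ := exists_hasJumpGrad hrep hm (memLp_of_bound hm fun x => hA _)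
    (jumpEnergy_cylinder_lt_top hα hα₂ hrep hρ hf hfc)
  exact ⟨w, ⟨f, hf, hfc, hw⟩, hw⟩

lemma tendsto_of_dominated {w : ℕ → Lp ℝ 2 μ} {l : Lp ℝ 2 μ} {u : ℕ → S → ℝ} {v : S → ℝ} {A : ℝ}
    (hw : ∀ k, w k =ᵐ[μ] u k) (hl : l =ᵐ[μ] v) (hA : ∀ k, ∀ᵐ x ∂μ, |u k x - v x| ≤ A)
    (hu : ∀ᵐ x ∂μ, Tendsto (fun k => u k x) atTop (𝓝 (v x))) : Tendsto w atTop (𝓝 l) := by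
  have hw' : ∀ k, (w k - l : Lp ℝ 2 μ) =ᵐ[μ] fun x => u k x - v x := fun k =>
    (Lp.coeFn_sub _ _).trans ((hw k).sub hl)
  have h1 : Tendsto (fun k => ∫⁻ x, ‖(w k - l : Lp ℝ 2 μ) x‖ₑ ^ 2 ∂μ) atTop (𝓝 0) := by
    have h2 := tendsto_lintegral_of_dominated_convergence' (μ := μ)
      (F := fun k x => ‖(w k - l : Lp ℝ 2 μ) x‖ₑ ^ 2) (f := fun _ => 0)
      (fun _ => ENNReal.ofReal (A ^ 2))
      (fun k => (Lp.aestronglyMeasurable (w k - l)).enorm.pow_const 2) ?_ (by simp) ?_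
    · simpa using h2
    · intro k
      filter_upwards [hw' k, hA k] with x hx hxA
      rw [hx, Real.enorm_eq_ofReal_abs, ← ENNReal.ofReal_pow (abs_nonneg _)]
      exact ENNReal.ofReal_le_ofReal (pow_le_pow_left₀ (abs_nonneg _) hxA 2)
    · filter_upwards [ae_all_iff.2 hw', hu] with x hx hxu
      simp only [hx]
      have h3 : Tendsto (fun k => u k x - v x) atTop (𝓝 0) := by
        simpa using hxu.sub_const (v x)
      have h4 := ((ENNReal.continuous_pow 2).tendsto _).comp h3.enorm
      simpa [Function.comp_def] using h4
  rw [tendsto_iff_norm_sub_tendsto_zero]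
  have h2 : ∀ k, ∫⁻ x, ‖(w k - l : Lp ℝ 2 μ) x‖ₑ ^ 2 ∂μ = ENNReal.ofReal (‖w k - l‖ ^ 2) := by
    intro k
    rw [← eLpNorm_two_sq, ← Lp.enorm_def, ← ofReal_norm, ENNReal.ofReal_pow (norm_nonneg _)]
  simp only [h2] at h1
  have h3 := (ENNReal.tendsto_toReal ENNReal.zero_ne_top).comp h1
  simp only [Function.comp_def, ENNReal.toReal_zero,
    ENNReal.toReal_ofReal (sq_nonneg (‖_‖ : ℝ))] at h3
  have h4 := h3.sqrt
  simpa [Real.sqrt_sq (norm_nonneg _)] using h4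

/-- Closed convex sets are closed under limits in `L²(μ)` of sequences of bounded energy. -/
lemma exists_mem_of_bounded_energy {α : ℝ} {W : Set (JumpSpace μ)} (hW : IsClosed W)
    (hWc : Convex ℝ W) {w : ℕ → JumpSpace μ} {u : ℕ → S → ℝ} {v : S → ℝ} {A : ℝ} {C : ℝ≥0∞}
    (hwW : ∀ k, w k ∈ W) (hw : ∀ k, HasJumpGrad α (w k) (u k)) (hA : ∀ k x, |u k x| ≤ A)
    (hC : C < ⊤) (hE : ∀ k, jumpEnergy α μ (u k) ≤ C) (hvm : Measurable v)
    (hu : ∀ᵐ x ∂μ, Tendsto (fun k => u k x) atTop (𝓝 (v x))) :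
    ∃ l ∈ W, l.fst =ᵐ[μ] v := by
  have hvA : ∀ᵐ x ∂μ, |v x| ≤ A := by
    filter_upwards [hu] with x hx
    exact le_of_tendsto hx.abs (Eventually.of_forall fun k => hA k x)
  have hv : MemLp v 2 μ := MemLp.of_bound hvm.aestronglyMeasurable A hvA
  have h1 : Tendsto (fun k => (w k).fst) atTop (𝓝 (hv.toLp v)) := by
    refine tendsto_of_dominated (A := 2 * A) (fun k => (hw k).1) hv.coeFn_toLp (fun k => ?_) hu
    filter_upwards [hvA] with x hx
    exact (abs_sub _ _).trans (by linarith [hA k x])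
  have hbd : ∀ k, ‖w k‖ ≤ √((ENNReal.ofReal (A ^ 2) + C).toReal) := by
    intro k
    refine Real.le_sqrt_of_sq_le ?_
    have h2 : ‖w k‖ₑ ^ 2 ≤ ENNReal.ofReal (A ^ 2) + C := by
      rw [(hw k).enorm_sq]
      refine add_le_add ?_ (hE k)
      refine (lintegral_mono (g := fun _ => ENNReal.ofReal (A ^ 2)) fun x => ?_).trans
        (by simp)
      rw [Real.enorm_eq_ofReal_abs, ← ENNReal.ofReal_pow (abs_nonneg _)]
      exact ENNReal.ofReal_le_ofReal (pow_le_pow_left₀ (abs_nonneg _) (hA k x) 2)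
    have h3 := ENNReal.toReal_mono (ENNReal.add_lt_top.2 ⟨ENNReal.ofReal_lt_top, hC⟩).ne h2
    simpa using h3
  obtain ⟨l, hlW, hl⟩ := exists_mem_of_bounded_of_tendsto
    (WithLp.fstL 2 ℝ (Lp ℝ 2 μ) (Lp ℝ 2 (jumpMeasure μ))) hW hWc hwW hbd h1
  have hl' : l.fst = hv.toLp v := hl
  exact ⟨l, hlW, by rw [hl']; exact hv.coeFn_toLp⟩

lemma jumpEnergy_mul_le (hrep : ∀ i, Measurable fun q : S × ℝ => replace q.1 i q.2) {α : ℝ}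
    {u v : S → ℝ} (hum : Measurable u) {A B : ℝ} (hu : ∀ x, |u x| ≤ A) (hv : ∀ x, |v x| ≤ B) :
    jumpEnergy α μ (fun x => u x * v x) ≤
      ENNReal.ofReal (2 * B ^ 2) * jumpEnergy α μ u +
        ENNReal.ofReal (2 * A ^ 2) * jumpEnergy α μ v := by
  have hm : Measurable fun z => ‖jumpGrad α u z‖ₑ ^ 2 :=
    (measurable_jumpGrad hrep α hum).enorm.pow_const _
  rw [jumpEnergy, jumpEnergy, jumpEnergy, ← lintegral_const_mul' _ _ ENNReal.ofReal_ne_top,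
    ← lintegral_const_mul' _ _ ENNReal.ofReal_ne_top, ← lintegral_add_left (hm.const_mul _)]
  refine lintegral_mono fun z => ?_
  simp only [Real.enorm_eq_ofReal_abs, ← ENNReal.ofReal_pow (abs_nonneg _)]
  rw [← ENNReal.ofReal_mul (by positivity), ← ENNReal.ofReal_mul (by positivity),
    ← ENNReal.ofReal_add (by positivity) (by positivity)]
  refine ENNReal.ofReal_le_ofReal ?_
  have h := pow_le_pow_left₀ (abs_nonneg _) (abs_jumpGrad_mul_le α hu hv z) 2
  refine h.trans ?_
  nlinarith [sq_nonneg (B * |jumpGrad α u z| - A * |jumpGrad α v z|)]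

/-- Every coordinate has cutoff functions of bounded energy at arbitrarily large scales. -/
def HasBoundedCutoffs (α : ℝ) (μ : Measure S) [IsProbabilityMeasure μ] : Prop :=
  ∀ i, ∃ C < ⊤, ∃ a : ℕ → ℝ, Tendsto a atTop atTop ∧ ∀ k, 0 < a k ∧
    jumpEnergy α μ (fun x => cutoff (a k) (coord i x)) ≤ C

variable {α : ℝ}
  (hMP : ∀ i, MeasurePreserving (fun q : S × ℝ => replace q.1 i q.2) (μ ⊗ₘ condLaw μ i) μ)

-- A compactly supported f on ℝ^(n+1) is no longer compactly supported as a function of one more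
-- variable. Multiplied by cutoffs of bounded energy in the new coordinate it becomes so; these
-- products converge to it with bounded energy, and the gradient of the limit is unique.
include hMP in
lemma cylinderGraph_le_topologicalClosure_succ (hα : 0 < α) (hα₂ : α < 2) {ρ : ℕ → S → ℝ → ℝ}
    (hρ : IsLocallyBoundedCondDensity μ ρ) (hcut : HasBoundedCutoffs α μ) (n : ℕ) :
    cylinderGraph α μ n ≤ (cylinderGraph α μ (n + 1)).topologicalClosure := by
  rintro w ⟨f, hf, hfc, hw⟩
  have hrep := fun i => (hMP i).measurable
  set u : S → ℝ := fun x => f fun k => coord (k : ℕ) x with hu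
  have hum : Measurable u := (continuous_cylinder hf.continuous).measurable
  obtain ⟨A, hA0, hA⟩ := exists_bound_of_hasCompactSupport hf.continuous hfc
  obtain ⟨R, hR0, hR⟩ := exists_radius_of_hasCompactSupport hfc
  obtain ⟨C, hC, a, ha, haC⟩ := hcut (n + 1)
  set F : ℕ → (Fin (n + 2) → ℝ) → ℝ :=
    fun m p => f (fun k => p k.castSucc) * cutoff (a m) (p (Fin.last _)) with hF
  have hFs : ∀ m, ContDiff ℝ ∞ (F m) := fun m =>
    (hf.comp (contDiff_pi.2 fun k => contDiff_apply _ _ _)).mul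
      ((contDiff_cutoff (a m)).comp (contDiff_apply _ _ _))
  have hFc : ∀ m, HasCompactSupport (F m) := by
    intro m
    refine hasCompactSupport_of_radius (R := max R (2 * a m)) fun p k hk => ?_
    simp only [hF]
    induction k using Fin.lastCases with
    | last => rw [cutoff_eq_zero (haC m).1 ((le_max_right _ _).trans hk.le), mul_zero]
    | cast k => rw [hR _ k ((le_max_left _ _).trans_lt hk), zero_mul]
  choose v hv hvF using fun m => exists_mem_cylinderGraph (μ := μ) hα hα₂ hrep hρ (hFs m) (hFc m)
  have hFA : ∀ m (x : S), |F m fun k => coord (k : ℕ) x| ≤ A * 1 := by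
    intro m x
    simp only [hF, abs_mul]
    refine mul_le_mul (hA _) ?_ (abs_nonneg _) hA0
    rw [abs_of_nonneg (cutoff_nonneg _ _)]
    exact cutoff_le_one _ _
  have hlt : ENNReal.ofReal (2 * 1 ^ 2) * jumpEnergy α μ u + ENNReal.ofReal (2 * A ^ 2) * C < ⊤ :=
    ENNReal.add_lt_top.2 ⟨ENNReal.mul_lt_top ENNReal.ofReal_lt_top
      (jumpEnergy_cylinder_lt_top hα hα₂ hrep hρ hf hfc),
      ENNReal.mul_lt_top ENNReal.ofReal_lt_top hC⟩
  have hFE : ∀ m, jumpEnergy α μ (fun x => F m fun k => coord (k : ℕ) x) ≤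
      ENNReal.ofReal (2 * 1 ^ 2) * jumpEnergy α μ u + ENNReal.ofReal (2 * A ^ 2) * C := by
    intro m
    refine (jumpEnergy_mul_le hrep (v := fun x => cutoff (a m) (coord (n + 1) x)) hum
      (fun x => hA _) (B := 1) fun x => ?_).trans ?_
    · rw [abs_of_nonneg (cutoff_nonneg _ _)]
      exact cutoff_le_one _ _
    · gcongr
      exact (haC m).2
  have hFt : ∀ᵐ x ∂μ, Tendsto (fun m => F m fun k => coord (k : ℕ) x) atTop (𝓝 (u x)) := by
    refine Eventually.of_forall fun x => ?_
    have := (tendsto_cutoff ha (coord (n + 1) x)).const_mul (u x)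
    rw [mul_one] at this
    exact this
  obtain ⟨l, hl, hlu⟩ := exists_mem_of_bounded_energy
    (Submodule.isClosed_topologicalClosure (cylinderGraph α μ (n + 1)))
    (cylinderGraph α μ (n + 1)).topologicalClosure.convex
    (fun m => Submodule.le_topologicalClosure _ (hv m)) hvF hFA hlt hFE hum hFt
  have h1 : HasJumpGrad α l u :=
    HasJumpGrad.of_mem hMP
      ((Submodule.topologicalClosure_mono (le_iSup (cylinderGraph α μ) (n + 1))) hl) hlu
  rwa [hw.unique h1]

include hMP in
/-- The cylinder functions with compact base support are dense in the domain of the form. -/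
lemma exists_cylinderGraph_near (hα : 0 < α) (hα₂ : α < 2) {ρ : ℕ → S → ℝ → ℝ}
    (hρ : IsLocallyBoundedCondDensity μ ρ) (hcut : HasBoundedCutoffs α μ) {w : JumpSpace μ}
    (hw : w ∈ energyGraph α μ) {ε : ℝ} (hε : 0 < ε) :
    ∃ n, ∃ w' ∈ cylinderGraph α μ n, ‖w - w'‖ < ε := by
  -- The cylinder graphs need not be nested, but their closures are. The supremum of the closures is
  -- therefore a directed union, and each of its elements lies in a single one.
  have hmono : Monotone fun n => (cylinderGraph α μ n).topologicalClosure :=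
    monotone_nat_of_le_succ fun n => Submodule.topologicalClosure_minimal _
      (cylinderGraph_le_topologicalClosure_succ hMP hα hα₂ hρ hcut n)
      (Submodule.isClosed_topologicalClosure _)
  obtain ⟨w₁, hw₁, hd₁⟩ := Metric.mem_closure_iff.1 hw (ε / 2) (half_pos hε)
  have hw₂ : w₁ ∈ ⨆ n, (cylinderGraph α μ n).topologicalClosure :=
    iSup_mono (fun n => Submodule.le_topologicalClosure _) hw₁
  obtain ⟨n, hn⟩ := (Submodule.mem_iSup_of_directed _ hmono.directed_le).1 hw₂
  obtain ⟨w', hw', hd₂⟩ := Metric.mem_closure_iff.1 hn (ε / 2) (half_pos hε)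
  refine ⟨n, w', hw', ?_⟩
  rw [← dist_eq_norm]
  linarith [dist_triangle w w₁ w']

end Cylinder

/-! ### Products of cutoff functions, contractions, and the density of the domain -/

section Construction

set_option linter.unusedSectionVars false

variable {S : Type} [TopologicalSpace S] [MeasurableSpace S] [BorelSpace S] [SequenceSpace S]

open SequenceSpace

/-- A jump in coordinate i changes only the i-th factor, and the remaining factors have product at
most 1. -/
lemma abs_jumpGrad_prod_le (α : ℝ) {θ : ℕ → ℝ → ℝ} (h0 : ∀ k t, 0 ≤ θ k t) (h1 : ∀ k t, θ k t ≤ 1)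
    (s : Finset ℕ) (i : ℕ) (q : S × ℝ) :
    |jumpGrad α (fun x => ∏ k ∈ s, θ k (coord k x)) (i, q)| ≤
      |jumpGrad α (fun x => θ i (coord i x)) (i, q)| := by
  simp only [jumpGrad, abs_div]
  refine div_le_div_of_nonneg_right ?_ (abs_nonneg _)
  by_cases hi : i ∈ s
  · rw [← Finset.mul_prod_erase s (fun k => θ k (coord k (replace q.1 i q.2))) hi,
      ← Finset.mul_prod_erase s (fun k => θ k (coord k q.1)) hi]
    have h2 : ∏ k ∈ s.erase i, θ k (coord k (replace q.1 i q.2))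
        = ∏ k ∈ s.erase i, θ k (coord k q.1) := by
      refine Finset.prod_congr rfl fun k hk => ?_
      rw [coord_replace, if_neg (Finset.ne_of_mem_erase hk)]
    rw [h2, ← sub_mul, abs_mul]
    refine mul_le_of_le_one_right (abs_nonneg _) ?_
    rw [abs_of_nonneg (Finset.prod_nonneg fun k _ => h0 _ _)]
    exact Finset.prod_le_one (fun k _ => h0 _ _) fun k _ => h1 _ _
  · have h2 : ∏ k ∈ s, θ k (coord k (replace q.1 i q.2)) = ∏ k ∈ s, θ k (coord k q.1) := by
      refine Finset.prod_congr rfl fun k hk => ?_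
      rw [coord_replace, if_neg]
      rintro rfl
      exact hi hk
    rw [h2, sub_self, abs_zero]
    exact abs_nonneg _

variable {μ : Measure S} [IsProbabilityMeasure μ]

lemma jumpEnergy_prod_le (α : ℝ) {θ : ℕ → ℝ → ℝ} (h0 : ∀ k t, 0 ≤ θ k t) (h1 : ∀ k t, θ k t ≤ 1)
    (s : Finset ℕ) : jumpEnergy α μ (fun x => ∏ k ∈ s, θ k (coord k x)) ≤
      ∑' i, jumpEnergy α μ (fun x => θ i (coord i x)) := by
  rw [jumpEnergy, lintegral_jumpMeasure]
  refine ENNReal.tsum_le_tsum fun i => ?_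
  rw [jumpEnergy_coord]
  refine lintegral_mono fun q => ?_
  rw [← enorm_sq_jumpGrad_coord]
  refine pow_le_pow_left₀ zero_le ?_ 2
  rw [Real.enorm_eq_ofReal_abs, Real.enorm_eq_ofReal_abs]
  exact ENNReal.ofReal_le_ofReal (abs_jumpGrad_prod_le α h0 h1 s i q)

/-- The infinite product of the functions `θ k` of the coordinates. -/
def infProd (θ : ℕ → ℝ → ℝ) (x : S) : ℝ := ⨅ n, ∏ k ∈ Finset.range (n + 1), θ k (coord k x)

/-! ### Infinite products of functions of single coordinates -/

section InfProd

variable {θ : ℕ → ℝ → ℝ} (h0 : ∀ k t, 0 ≤ θ k t) (h1 : ∀ k t, θ k t ≤ 1)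

include h0 in
lemma bddBelow_infProd (x : S) :
    BddBelow (Set.range fun n => ∏ k ∈ Finset.range (n + 1), θ k (coord k x)) :=
  ⟨0, by rintro _ ⟨n, rfl⟩; exact Finset.prod_nonneg fun k _ => h0 _ _⟩

include h0 h1 in
lemma tendsto_infProd (x : S) :
    Tendsto (fun n => ∏ k ∈ Finset.range (n + 1), θ k (coord k x)) atTop (𝓝 (infProd θ x)) := by
  refine tendsto_atTop_ciInf (antitone_nat_of_succ_le fun n => ?_) (bddBelow_infProd h0 x)
  rw [Finset.prod_range_succ _ (n + 1)]
  exact mul_le_of_le_one_right (Finset.prod_nonneg fun k _ => h0 _ _) (h1 _ _)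

include h0 in
lemma infProd_nonneg (x : S) : 0 ≤ infProd θ x :=
  le_ciInf fun _ => Finset.prod_nonneg fun _ _ => h0 _ _

include h0 h1 in
lemma infProd_le_one (x : S) : infProd θ x ≤ 1 :=
  (ciInf_le (bddBelow_infProd h0 x) 0).trans (Finset.prod_le_one (fun _ _ => h0 _ _) fun _ _ => h1 _ _)

include h0 in
lemma infProd_eq_zero {x : S} {k : ℕ} (hk : θ k (coord k x) = 0) : infProd θ x = 0 :=
  le_antisymm ((ciInf_le (bddBelow_infProd h0 x) k).trans
    (Finset.prod_eq_zero (Finset.self_mem_range_succ k) hk).le) (infProd_nonneg h0 x)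

lemma infProd_eq_one {x : S} (hx : ∀ k, θ k (coord k x) = 1) : infProd θ x = 1 := by
  simp [infProd, hx]

include h0 h1 in
lemma measurable_infProd (hθ : ∀ k, Measurable (θ k)) : Measurable (infProd θ : S → ℝ) := by
  refine measurable_of_tendsto_metrizable (f := fun n (x : S) =>
    ∏ k ∈ Finset.range (n + 1), θ k (coord k x)) (fun n => ?_)
    (tendsto_pi_nhds.2 fun x => tendsto_infProd h0 h1 x)
  exact Finset.measurable_fun_prod _ fun k _ => (hθ k).comp (measurable_coord k)

-- Fatou's lemma, since the gradients of the partial products converge at every point and their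
-- energies have a common bound.
include h0 h1 in
lemma jumpEnergy_infProd_le (α : ℝ)
    (hrep : ∀ i, Measurable fun q : S × ℝ => replace q.1 i q.2) (hθ : ∀ k, Measurable (θ k)) :
    jumpEnergy α μ (infProd θ) ≤ ∑' i, jumpEnergy α μ (fun x => θ i (coord i x)) := by
  have hm : ∀ n, Measurable fun x : S => ∏ k ∈ Finset.range (n + 1), θ k (coord k x) := fun n =>
    Finset.measurable_fun_prod _ fun k _ => (hθ k).comp (measurable_coord k)
  have hlim : ∀ z : ℕ × (S × ℝ), Tendsto (fun n => ‖jumpGrad α (fun x =>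
      ∏ k ∈ Finset.range (n + 1), θ k (coord k x)) z‖ₑ ^ 2) atTop
      (𝓝 (‖jumpGrad α (infProd θ) z‖ₑ ^ 2)) := by
    intro z
    refine ((ENNReal.continuous_pow 2).tendsto _).comp (Tendsto.enorm ?_)
    exact ((tendsto_infProd h0 h1 _).sub (tendsto_infProd h0 h1 _)).div_const _
  calc jumpEnergy α μ (infProd θ)
      = ∫⁻ z, liminf (fun n => ‖jumpGrad α (fun x =>
          ∏ k ∈ Finset.range (n + 1), θ k (coord k x)) z‖ₑ ^ 2) atTop ∂jumpMeasure μ :=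
        lintegral_congr fun z => (hlim z).liminf_eq.symm
    _ ≤ liminf (fun n => jumpEnergy α μ fun x =>
          ∏ k ∈ Finset.range (n + 1), θ k (coord k x)) atTop :=
        lintegral_liminf_le fun n => (measurable_jumpGrad hrep α (hm n)).enorm.pow_const _
    _ ≤ ∑' i, jumpEnergy α μ (fun x => θ i (coord i x)) :=
        liminf_le_of_le (by isBoundedDefault) fun b hb => by
          obtain ⟨n, hn⟩ := hb.exists
          exact hn.trans (jumpEnergy_prod_le α h0 h1 _)

end InfProd

variable {α : ℝ}
  (hMP : ∀ i, MeasurePreserving (fun q : S × ℝ => replace q.1 i q.2) (μ ⊗ₘ condLaw μ i) μ)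

include hMP in
/-- Infinite products of cutoff functions of summable energies belong to the domain. -/
lemma exists_hasJumpGrad_infProd (hα : 0 < α) (hα₂ : α < 2) {ρ : ℕ → S → ℝ → ℝ}
    (hρ : IsLocallyBoundedCondDensity μ ρ) {θ : ℕ → ℝ → ℝ} (h0 : ∀ k t, 0 ≤ θ k t)
    (h1 : ∀ k t, θ k t ≤ 1) (hs : ∀ k, ContDiff ℝ ∞ (θ k)) (hc : ∀ k, HasCompactSupport (θ k))
    (hE : ∑' i, jumpEnergy α μ (fun x => θ i (coord i x)) < ⊤) :
    ∃ w ∈ energyGraph α μ, HasJumpGrad α w (infProd θ) := by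
  have hrep := fun i => (hMP i).measurable
  set F : ∀ n, (Fin (n + 1) → ℝ) → ℝ := fun n p => ∏ k : Fin (n + 1), θ k (p k) with hF
  have hFs : ∀ n, ContDiff ℝ ∞ (F n) := fun n =>
    contDiff_prod fun k _ => (hs k).comp (contDiff_apply _ _ _)
  have hFc : ∀ n, HasCompactSupport (F n) := by
    intro n
    refine HasCompactSupport.intro (isCompact_univ_pi fun k : Fin (n + 1) => (hc k).isCompact)
      fun p hp => ?_
    simp only [Set.mem_univ_pi, not_forall] at hp
    obtain ⟨k, hk⟩ := hp
    exact Finset.prod_eq_zero (Finset.mem_univ k) (image_eq_zero_of_notMem_tsupport hk)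
  choose v hv hvF using fun n => exists_mem_cylinderGraph (μ := μ) hα hα₂ hrep hρ (hFs n) (hFc n)
  have hFr : ∀ n, (fun x : S => F n fun k => coord (k : ℕ) x)
      = fun x => ∏ k ∈ Finset.range (n + 1), θ k (coord k x) := by
    intro n
    ext x
    rw [Finset.prod_range]
  have hFA : ∀ n (x : S), |F n fun k => coord (k : ℕ) x| ≤ 1 := by
    intro n x
    simp only [hF]
    rw [abs_of_nonneg (Finset.prod_nonneg fun k _ => h0 _ _)]
    exact Finset.prod_le_one (fun k _ => h0 _ _) fun k _ => h1 _ _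
  have hFt : ∀ᵐ x ∂μ, Tendsto (fun n => F n fun k => coord (k : ℕ) x) atTop (𝓝 (infProd θ x)) := by
    refine Eventually.of_forall fun x => ?_
    simp only [fun n => congrFun (hFr n) x]
    exact tendsto_infProd h0 h1 x
  obtain ⟨l, hl, hlu⟩ := exists_mem_of_bounded_energy (isClosed_energyGraph α)
    (energyGraph α μ).convex (fun n => cylinderGraph_le_energyGraph α n (hv n)) hvF hFA hE
    (fun n => by rw [hFr]; exact jumpEnergy_prod_le α h0 h1 _)
    (measurable_infProd h0 h1 fun k => (hs k).continuous.measurable) hFt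
  exact ⟨l, hl, HasJumpGrad.of_mem hMP hl hlu⟩

include hMP in
/-- The constant function `1` belongs to the domain. -/
lemma exists_hasJumpGrad_one (hα : 0 < α) (hα₂ : α < 2) {ρ : ℕ → S → ℝ → ℝ}
    (hρ : IsLocallyBoundedCondDensity μ ρ) (hcut : HasBoundedCutoffs α μ) :
    ∃ w ∈ energyGraph α μ, HasJumpGrad α w fun _ => 1 := by
  have hrep := fun i => (hMP i).measurable
  obtain ⟨C, hC, a, ha, haC⟩ := hcut 0
  set F : ℕ → (Fin (0 + 1) → ℝ) → ℝ := fun m p => cutoff (a m) (p 0) with hF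
  have hFs : ∀ m, ContDiff ℝ ∞ (F m) := fun m =>
    (contDiff_cutoff (a m)).comp (contDiff_apply _ _ _)
  have hFc : ∀ m, HasCompactSupport (F m) := by
    refine fun m => hasCompactSupport_of_radius (R := 2 * a m) fun p k hk => ?_
    obtain rfl : k = 0 := Fin.ext (by omega)
    exact cutoff_eq_zero (haC m).1 hk.le
  choose v hv hvF using fun n => exists_mem_cylinderGraph (μ := μ) hα hα₂ hrep hρ (hFs n) (hFc n)
  obtain ⟨l, hl, hlu⟩ := exists_mem_of_bounded_energy (isClosed_energyGraph α) (A := 1)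
    (energyGraph α μ).convex (fun n => cylinderGraph_le_energyGraph α 0 (hv n)) hvF
    (fun m x => by
      simp only [hF]
      rw [abs_of_nonneg (cutoff_nonneg _ _)]
      exact cutoff_le_one _ _) hC (fun m => (haC m).2) (v := fun _ => 1) measurable_const
    (Eventually.of_forall fun x => tendsto_cutoff ha (coord 0 x))
  exact ⟨l, hl, HasJumpGrad.of_mem hMP hl hlu⟩

/-- Smooth approximations of the unit contraction `t ↦ (t ∨ 0) ∧ 1`. -/
def smoothContraction (ε t : ℝ) : ℝ :=
  (√(t ^ 2 + ε ^ 2) - √((t - 1) ^ 2 + ε ^ 2) + √(1 + ε ^ 2) - √(ε ^ 2)) / 2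

/-- Fixing 0 is essential: compositions with compactly supported functions stay compactly supported,
and absolute values do not increase. -/
lemma smoothContraction_zero (ε : ℝ) : smoothContraction ε 0 = 0 := by
  simp [smoothContraction]

lemma contDiff_smoothContraction {ε : ℝ} (hε : ε ≠ 0) : ContDiff ℝ ∞ (smoothContraction ε) := by
  have h1 : ContDiff ℝ ∞ fun t : ℝ => √(t ^ 2 + ε ^ 2) :=
    ContDiff.sqrt (by fun_prop) fun t => by positivity
  have h2 : ContDiff ℝ ∞ fun t : ℝ => √((t - 1) ^ 2 + ε ^ 2) :=
    ContDiff.sqrt (by fun_prop) fun t => by positivity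
  unfold smoothContraction
  exact (((h1.sub h2).add contDiff_const).sub contDiff_const).div_const _

/-- The root is the Euclidean length of (s, ε), so this is the triangle inequality in the plane. -/
lemma abs_sqrt_sub_sqrt_le (ε s t : ℝ) : |√(s ^ 2 + ε ^ 2) - √(t ^ 2 + ε ^ 2)| ≤ |s - t| := by
  have key : ∀ s t : ℝ, √(s ^ 2 + ε ^ 2) ≤ √(t ^ 2 + ε ^ 2) + |s - t| := by
    intro s t
    refine Real.sqrt_le_iff.2 ⟨by positivity, ?_⟩
    have h1 := Real.sq_sqrt (show 0 ≤ t ^ 2 + ε ^ 2 by positivity)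
    have h2 : |t| ≤ √(t ^ 2 + ε ^ 2) := Real.abs_le_sqrt (by nlinarith [sq_nonneg ε])
    have h3 : t * (s - t) ≤ |t| * |s - t| := by
      rw [← abs_mul]
      exact le_abs_self _
    have h4 : |t| * |s - t| ≤ √(t ^ 2 + ε ^ 2) * |s - t| := by gcongr
    nlinarith [sq_abs (s - t)]
  rw [abs_le]
  have h1 := key s t
  have h2 := key t s
  rw [abs_sub_comm] at h2
  constructor <;> linarith

lemma abs_smoothContraction_sub_le (ε s t : ℝ) :
    |smoothContraction ε s - smoothContraction ε t| ≤ |s - t| := by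
  have h1 := abs_sqrt_sub_sqrt_le ε s t
  have h2 := abs_sqrt_sub_sqrt_le ε (s - 1) (t - 1)
  rw [sub_sub_sub_cancel_right] at h2
  have h3 : smoothContraction ε s - smoothContraction ε t
      = ((√(s ^ 2 + ε ^ 2) - √(t ^ 2 + ε ^ 2))
        - (√((s - 1) ^ 2 + ε ^ 2) - √((t - 1) ^ 2 + ε ^ 2))) / 2 := by
    unfold smoothContraction
    ring
  rw [h3, abs_div, abs_two, div_le_iff₀ two_pos]
  exact (abs_sub _ _).trans (by linarith)

lemma abs_smoothContraction_sub_contraction_le {ε : ℝ} (hε : 0 ≤ ε) (t : ℝ) :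
    |smoothContraction ε t - min (max t 0) 1| ≤ 2 * ε := by
  have key : ∀ s : ℝ, |s| ≤ √(s ^ 2 + ε ^ 2) ∧ √(s ^ 2 + ε ^ 2) ≤ |s| + ε := by
    refine fun s => ⟨Real.abs_le_sqrt (by nlinarith [sq_nonneg ε]),
      Real.sqrt_le_iff.2 ⟨by positivity, ?_⟩⟩
    nlinarith [sq_abs s, mul_nonneg (abs_nonneg s) hε]
  -- The formula for `smoothContraction` at ε = 0. Each root √(s² + ε²) exceeds |s| by at most ε.
  have h0 : min (max t 0) 1 = (|t| - |t - 1| + 1) / 2 := by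
    rcases le_total t 0 with h | h
    · rw [max_eq_right h, abs_of_nonpos h, abs_of_nonpos (by linarith), min_eq_left zero_le_one]
      ring
    · rcases le_total t 1 with h' | h'
      · rw [max_eq_left h, abs_of_nonneg h, abs_of_nonpos (by linarith), min_eq_left h']
        ring
      · rw [max_eq_left h, abs_of_nonneg h, abs_of_nonneg (by linarith), min_eq_right h']
        ring
  have h1 := key t
  have h2 := key (t - 1)
  have h3 := key 1
  rw [abs_one, one_pow] at h3
  rw [h0, smoothContraction, Real.sqrt_sq hε, abs_le]
  constructor <;> linarith [h1.1, h1.2, h2.1, h2.2, h3.1, h3.2]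

end Construction

/-! ### The Dirichlet form -/

section DirichletForm

set_option linter.unusedSectionVars false

variable {S : Type} [TopologicalSpace S] [MeasurableSpace S] [BorelSpace S] [SequenceSpace S]

open SequenceSpace

variable {μ : Measure S} [IsProbabilityMeasure μ] {α : ℝ}
  (hMP : ∀ i, MeasurePreserving (fun q : S × ℝ => replace q.1 i q.2) (μ ⊗ₘ condLaw μ i) μ)

include hMP in
/-- The unit contraction operates on the domain. -/
lemma exists_contraction_mem (hα : 0 < α) (hα₂ : α < 2) {ρ : ℕ → S → ℝ → ℝ}
    (hρ : IsLocallyBoundedCondDensity μ ρ) (hcut : HasBoundedCutoffs α μ) {w : JumpSpace μ}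
    (hw : w ∈ energyGraph α μ) :
    ∃ v ∈ energyGraph α μ, HasJumpGrad α v fun x => min (max (w.fst x) 0) 1 := by
  have hrep := fun i => (hMP i).measurable
  -- Single cylinder functions are needed here. A sum of such functions of different numbers of
  -- coordinates need not have a compactly supported base, and composing it with a contraction would
  -- not give one.
  have hex : ∀ k : ℕ, ∃ n, ∃ w' ∈ cylinderGraph α μ n, ‖w - w'‖ < 1 / ((k : ℝ) + 1) := fun k =>
    exists_cylinderGraph_near hMP hα hα₂ hρ hcut hw (by positivity)
  choose n w' hw' hd using hex
  choose f hf hfc hfw using hw'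
  set ε : ℕ → ℝ := fun k => 1 / ((k : ℝ) + 1) with hε
  have hε0 : ∀ k, 0 < ε k := fun k => by positivity
  have hεt : Tendsto ε atTop (𝓝 0) := tendsto_one_div_add_atTop_nhds_zero_nat
  set u : ℕ → S → ℝ := fun k x => f k fun j => coord (j : ℕ) x with hu
  have hs : ∀ k, ContDiff ℝ ∞ fun p => smoothContraction (ε k) (f k p) := fun k =>
    (contDiff_smoothContraction (hε0 k).ne').comp (hf k)
  have hsc : ∀ k, HasCompactSupport fun p => smoothContraction (ε k) (f k p) := fun k =>
    (hfc k).comp_left (smoothContraction_zero _)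
  choose v hv hvu using fun k =>
    exists_mem_cylinderGraph (μ := μ) hα hα₂ hrep hρ (hs k) (hsc k)
  have hlim : Tendsto w' atTop (𝓝 w) := by
    rw [tendsto_iff_norm_sub_tendsto_zero]
    refine squeeze_zero (fun _ => norm_nonneg _) (fun k => ?_) hεt
    rw [norm_sub_rev]
    exact (hd k).le
  have hfst : Tendsto (fun k => (w' k).fst) atTop (𝓝 w.fst) :=
    ((WithLp.fstL 2 ℝ (Lp ℝ 2 μ) (Lp ℝ 2 (jumpMeasure μ))).continuous.tendsto w).comp hlim
  have hcm : Measurable fun t : ℝ => min (max t 0) 1 := by fun_prop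
  have hbound : ∀ x, |min (max (w.fst x) 0) 1| ≤ 1 := fun x => by
    rw [abs_of_nonneg (le_min (le_max_right _ _) zero_le_one)]
    exact min_le_right _ _
  have hmem : MemLp (fun x => min (max (w.fst x) 0) 1) 2 μ :=
    MemLp.of_bound (hcm.comp_aemeasurable (Lp.aestronglyMeasurable w.fst).aemeasurable).aestronglyMeasurable
      1 (Eventually.of_forall hbound)
  have hconv : Tendsto (fun k => (v k).fst) atTop (𝓝 (hmem.toLp _)) := by
    rw [tendsto_iff_norm_sub_tendsto_zero]
    have hsum : Tendsto (fun k => ‖(w' k).fst - w.fst‖ + 2 * ε k) atTop (𝓝 0) := by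
      have := (tendsto_iff_norm_sub_tendsto_zero.1 hfst).add (hεt.const_mul 2)
      simpa using this
    refine squeeze_zero (fun _ => norm_nonneg _) (fun k => ?_) hsum
    have hc : MemLp (fun _ : S => 2 * ε k) 2 μ := memLp_const _
    have hcn : ‖hc.toLp _‖ = 2 * ε k := by
      rw [Lp.norm_toLp, eLpNorm_const _ two_ne_zero (IsProbabilityMeasure.ne_zero μ), measure_univ,
        ENNReal.one_rpow, mul_one, toReal_enorm, Real.norm_eq_abs,
        abs_of_nonneg (by linarith [hε0 k])]
    rw [← hcn]
    refine (Lp.norm_le_norm_of_ae_le (g := (|(w' k).fst - w.fst| + hc.toLp _ : Lp ℝ 2 μ)) ?_).trans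
      ((norm_add_le _ _).trans_eq (by rw [norm_abs_eq_norm]))
    filter_upwards [Lp.coeFn_sub (v k).fst (hmem.toLp _), (hvu k).1, hmem.coeFn_toLp,
      Lp.coeFn_add |(w' k).fst - w.fst| (hc.toLp _), Lp.coeFn_abs ((w' k).fst - w.fst),
      Lp.coeFn_sub (w' k).fst w.fst, hc.coeFn_toLp, (hfw k).1] with x h1 h2 h3 h4 h5 h6 h7 h8
    rw [h1, h4, Pi.sub_apply, Pi.add_apply, h2, h3, h5, h6, h7, Pi.sub_apply, h8, Real.norm_eq_abs,
      Real.norm_eq_abs, abs_of_nonneg (a := |_| + _) (by have := hε0 k; positivity)]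
    have h9 := abs_smoothContraction_sub_le (ε k) (u k x) (w.fst x)
    have h10 := abs_smoothContraction_sub_contraction_le (hε0 k).le (w.fst x)
    exact (abs_sub_le _ _ _).trans (add_le_add h9 h10)
  -- A contraction fixing 0 decreases the function and its gradient pointwise in absolute value, so
  -- the approximants stay bounded in the graph norm.
  have hEle : ∀ k, ‖v k‖ₑ ^ 2 ≤ ‖w' k‖ₑ ^ 2 := by
    intro k
    rw [(hvu k).enorm_sq, (hfw k).enorm_sq]
    refine add_le_add (lintegral_mono fun x => ?_) (lintegral_mono fun z => ?_)
    · refine pow_le_pow_left₀ zero_le ?_ 2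
      rw [Real.enorm_eq_ofReal_abs, Real.enorm_eq_ofReal_abs]
      refine ENNReal.ofReal_le_ofReal ?_
      simpa [smoothContraction_zero] using abs_smoothContraction_sub_le (ε k) (u k x) 0
    · refine pow_le_pow_left₀ zero_le ?_ 2
      rw [Real.enorm_eq_ofReal_abs, Real.enorm_eq_ofReal_abs]
      exact ENNReal.ofReal_le_ofReal
        (abs_jumpGrad_comp_le α (abs_smoothContraction_sub_le (ε k)) (u k) z)
  have hbd : ∀ k, ‖v k‖ ≤ ‖w‖ + 1 := by
    intro k
    have h1 : ‖v k‖ ≤ ‖w' k‖ := by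
      have h2 := ENNReal.toReal_mono (by simp) (hEle k)
      simp only [ENNReal.toReal_pow, toReal_enorm] at h2
      exact le_of_sq_le_sq h2 (norm_nonneg _)
    have h2 : ‖w' k‖ ≤ ‖w‖ + ‖w - w' k‖ := by
      rw [norm_sub_rev]
      exact norm_le_norm_add_norm_sub' _ _
    have h3 : 1 / ((k : ℝ) + 1) ≤ 1 := by
      rw [div_le_one (by positivity)]
      linarith [k.cast_nonneg (α := ℝ)]
    linarith [hd k]
  obtain ⟨l, hl, hlu⟩ := exists_mem_of_bounded_of_tendsto
    (WithLp.fstL 2 ℝ (Lp ℝ 2 μ) (Lp ℝ 2 (jumpMeasure μ))) (isClosed_energyGraph α)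
    (energyGraph α μ).convex (fun k => cylinderGraph_le_energyGraph α _ (hv k)) hbd hconv
  have hlu' : l.fst = hmem.toLp _ := hlu
  exact ⟨l, hl, HasJumpGrad.of_mem hMP hl (by rw [hlu']; exact hmem.coeFn_toLp)⟩

/-- A compact set is the intersection of the cylinder sets over its projections. -/
lemma exists_notMem_thickening {K : Set S} (hK : IsCompact K) {x : S} (hx : x ∉ K) :
    ∃ N : ℕ, ∀ n ≥ N, (fun k : Fin (n + 1) => coord (k : ℕ) x) ∉
      Metric.thickening (1 / ((n : ℝ) + 1))
        ((fun y (k : Fin (n + 1)) => coord (k : ℕ) y) '' K) := by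
  by_contra hcon
  push Not at hcon
  -- The points of K whose first coordinates are close to those of x. If x were in all thickened
  -- projections, these decreasing compact sets would be nonempty, and a common point has all the
  -- coordinates of x.
  set t : ℕ → Set S := fun n => {y ∈ K | ∀ j ≤ n, |coord j x - coord j y| ≤ 1 / ((n : ℝ) + 1)}
    with ht
  have hanti : Antitone t := by
    intro n m hnm y hy
    refine ⟨hy.1, fun j hj => (hy.2 j (hj.trans hnm)).trans ?_⟩
    exact one_div_le_one_div_of_le (by positivity) (by exact_mod_cast Nat.succ_le_succ hnm)
  have hne : ∀ n, (t n).Nonempty := by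
    intro n
    obtain ⟨m, hm, hxm⟩ := hcon n
    obtain ⟨_, ⟨y, hy, rfl⟩, hd⟩ := Metric.mem_thickening_iff.1 hxm
    refine ⟨y, hanti hm ⟨hy, fun j hj => ?_⟩⟩
    have := (dist_le_pi_dist _ _ (⟨j, Nat.lt_succ_of_le hj⟩ : Fin (m + 1))).trans hd.le
    rwa [Real.dist_eq] at this
  have hclosed : ∀ n, IsClosed {y : S | ∀ j ≤ n, |coord j x - coord j y| ≤ 1 / ((n : ℝ) + 1)} := by
    intro n
    simp only [Set.ofPred_forall]
    refine isClosed_iInter fun j => isClosed_iInter fun _ => ?_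
    exact isClosed_le (continuous_const.sub (continuous_coord j)).abs continuous_const
  have hT2 : T2Space S := T2Space.of_injective_continuous
    (f := fun (x : S) (j : ℕ) => coord j x) (fun x y h => ext_coord x y fun j => congrFun h j)
    (continuous_pi fun j => continuous_coord j)
  obtain ⟨y, hy⟩ := IsCompact.nonempty_iInter_of_sequence_nonempty_isCompact_isClosed t
    (fun n => hanti n.le_succ) hne (hK.inter_right (hclosed 0))
    (fun n => hK.isClosed.inter (hclosed n))
  rw [Set.mem_iInter] at hy
  refine hx ?_
  rw [ext_coord x y fun j => ?_]
  · exact (hy 0).1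
  · refine sub_eq_zero.1 (abs_nonpos_iff.1 ?_)
    refine ge_of_tendsto (tendsto_one_div_add_atTop_nhds_zero_nat (𝕜 := ℝ)) ?_
    filter_upwards [eventually_ge_atTop j] with n hn
    exact (hy n).2 j hn

/-- The class of the indicator function of `B` belongs to the closure of the domain. -/
def IndicatorMem (α : ℝ) (μ : Measure S) [IsProbabilityMeasure μ] (B : Set S) : Prop :=
  ∃ l ∈ (LinearMap.range (energyGraphFst α μ)).topologicalClosure,
    l =ᵐ[μ] B.indicator fun _ => (1 : ℝ)

lemma abs_indicator_sub_indicator_le (A B : Set S) (x : S) :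
    |A.indicator (fun _ => (1 : ℝ)) x - B.indicator (fun _ => 1) x| ≤ 1 := by
  by_cases hA : x ∈ A <;> by_cases hB : x ∈ B <;> simp [hA, hB]

lemma IndicatorMem.of_tendsto {B : ℕ → Set S} {B' : Set S} (hB : ∀ n, IndicatorMem α μ (B n))
    (hB' : MeasurableSet B') (h : ∀ᵐ x ∂μ, Tendsto (fun n => (B n).indicator (fun _ => (1 : ℝ)) x)
      atTop (𝓝 (B'.indicator (fun _ => 1) x))) : IndicatorMem α μ B' := by
  choose l hl hlB using hB
  have hm : MemLp (B'.indicator fun _ => (1 : ℝ)) 2 μ :=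
    (memLp_const (1 : ℝ)).indicator hB'
  refine ⟨hm.toLp _, ?_, hm.coeFn_toLp⟩
  exact (Submodule.isClosed_topologicalClosure _).mem_of_tendsto
    (tendsto_of_dominated hlB hm.coeFn_toLp (A := 1)
      (fun k => Eventually.of_forall fun x => abs_indicator_sub_indicator_le _ _ x) h)
    (Eventually.of_forall hl)

-- Smooth bumps equal to 1 on the projection of K and supported in its 1/(n+1)-thickening converge
-- pointwise to the indicator, because K is determined by its projections.
include hMP in
lemma indicatorMem_of_isCompact (hα : 0 < α) (hα₂ : α < 2) {ρ : ℕ → S → ℝ → ℝ}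
    (hρ : IsLocallyBoundedCondDensity μ ρ) {K : Set S} (hK : IsCompact K) :
    IndicatorMem α μ K := by
  have hrep := fun i => (hMP i).measurable
  have hcont : ∀ n, Continuous fun (y : S) (k : Fin (n + 1)) => coord (k : ℕ) y := fun n =>
    continuous_pi fun k => continuous_coord _
  have hT2 : T2Space S := T2Space.of_injective_continuous
    (f := fun (x : S) (j : ℕ) => coord j x) (fun x y h => ext_coord x y fun j => congrFun h j)
    (continuous_pi fun j => continuous_coord j)
  set Q : ∀ n, Set (Fin (n + 1) → ℝ) := fun n => (fun y (k : Fin (n + 1)) => coord (k : ℕ) y) '' K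
  have hQ : ∀ n, IsCompact (Q n) := fun n => hK.image (hcont n)
  have hex : ∀ n : ℕ, ∃ f : (Fin (n + 1) → ℝ) → ℝ, ContDiff ℝ ∞ f ∧ (∀ p, 0 ≤ f p ∧ f p ≤ 1) ∧
      Function.support f = Metric.thickening (1 / ((n : ℝ) + 1)) (Q n) ∧ ∀ p ∈ Q n, f p = 1 := by
    intro n
    obtain ⟨f, hf, hr, hs, h1⟩ := exists_contMDiff_support_eq_eq_one_iff (n := ⊤)
      (modelWithCornersSelf ℝ (Fin (n + 1) → ℝ)) Metric.isOpen_thickening (hQ n).isClosed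
      (Metric.self_subset_thickening (show (0 : ℝ) < 1 / ((n : ℝ) + 1) by positivity) _)
    exact ⟨f, hf.contDiff, fun p => hr ⟨p, rfl⟩, hs, fun p hp => (h1 p).1 hp⟩
  choose f hf hf01 hfs hf1 using hex
  have hfc : ∀ n, HasCompactSupport (f n) := by
    intro n
    refine HasCompactSupport.of_support_subset_isCompact ((hQ n).cthickening (r := 1 / ((n : ℝ) + 1)))
      ?_
    rw [hfs]
    exact Metric.thickening_subset_cthickening _ _
  choose v hv hvf using fun n =>
    exists_mem_cylinderGraph (μ := μ) hα hα₂ hrep hρ (hf n) (hfc n)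
  have hm : MemLp (K.indicator fun _ => (1 : ℝ)) 2 μ :=
    (memLp_const (1 : ℝ)).indicator hK.measurableSet
  have hlim : Tendsto (fun n => (v n).fst) atTop (𝓝 (hm.toLp _)) := by
    refine tendsto_of_dominated (fun n => (hvf n).1) hm.coeFn_toLp (A := 1)
      (fun n => Eventually.of_forall fun x => ?_) (Eventually.of_forall fun x => ?_)
    · have h1 := hf01 n fun k => coord (k : ℕ) x
      by_cases hx : x ∈ K
      · rw [Set.indicator_of_mem hx, abs_le]
        constructor <;> linarith
      · rw [Set.indicator_of_notMem hx, abs_le]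
        constructor <;> linarith
    · by_cases hx : x ∈ K
      · rw [Set.indicator_of_mem hx]
        refine tendsto_const_nhds.congr fun n => ?_
        exact (hf1 n _ ⟨x, hx, rfl⟩).symm
      · rw [Set.indicator_of_notMem hx]
        obtain ⟨N, hN⟩ := exists_notMem_thickening hK hx
        refine tendsto_const_nhds.congr' ?_
        filter_upwards [eventually_ge_atTop N] with n hn
        have := hN n hn
        rw [← hfs, Function.notMem_support] at this
        exact this.symm
  refine ⟨hm.toLp _, (Submodule.isClosed_topologicalClosure _).mem_of_tendsto hlim
    (Eventually.of_forall fun n => Submodule.le_topologicalClosure _ ?_), hm.coeFn_toLp⟩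
  exact ⟨⟨v n, cylinderGraph_le_energyGraph α n (hv n)⟩, rfl⟩

include hMP in
/-- The cylinder functions are dense in `L²(μ)`. -/
lemma dense_range_energyGraphFst (hα : 0 < α) (hα₂ : α < 2) {ρ : ℕ → S → ℝ → ℝ}
    (hρ : IsLocallyBoundedCondDensity μ ρ) {F : ℕ → Set S} (hF : ∀ k, IsCompact (F k))
    (hmono : Monotone F) (hμ : μ (⋃ k, F k) = 1) :
    Dense (LinearMap.range (energyGraphFst α μ) : Set (Lp ℝ 2 μ)) := by
  have hT2 : T2Space S := T2Space.of_injective_continuous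
    (f := fun (x : S) (j : ℕ) => coord j x) (fun x y h => ext_coord x y fun j => congrFun h j)
    (continuous_pi fun j => continuous_coord j)
  have hae : ∀ᵐ x ∂μ, x ∈ ⋃ k, F k := by
    rw [← prob_compl_eq_zero_iff (.iUnion fun k => (hF k).measurableSet)] at hμ
    exact hμ
  -- The sets K ∩ F k are compact and increase to K up to a null set.
  have hclosed : ∀ K : Set S, IsClosed K → IndicatorMem α μ K := by
    intro K hK
    refine IndicatorMem.of_tendsto (B := fun k => K ∩ F k)
      (fun k => indicatorMem_of_isCompact hMP hα hα₂ hρ ((hF k).inter_left hK)) hK.measurableSet ?_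
    filter_upwards [hae] with x hx
    obtain ⟨N, hN⟩ := Set.mem_iUnion.1 hx
    refine tendsto_const_nhds.congr' ?_
    filter_upwards [eventually_ge_atTop N] with n hn
    have := hmono hn hN
    by_cases hxK : x ∈ K <;> simp [hxK, this]
  -- Dynkin's π-λ argument starting from the closed sets.
  have hall : ∀ B : Set S, MeasurableSet B → IndicatorMem α μ B := by
    refine MeasurableSpace.induction_on_inter (s := {K : Set S | IsClosed K}) ?_ isPiSystem_isClosed
      (hclosed _ isClosed_empty) (fun K hK => hclosed K hK) ?_ ?_
    · rw [BorelSpace.measurable_eq (α := S), borel_eq_generateFrom_isClosed]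
    · rintro B hB ⟨l, hl, hlB⟩
      obtain ⟨l', hl', hlB'⟩ := hclosed _ isClosed_univ
      refine ⟨l' - l, sub_mem hl' hl, (Lp.coeFn_sub _ _).trans ?_⟩
      filter_upwards [hlB, hlB'] with x h1 h2
      rw [Pi.sub_apply, h1, h2]
      by_cases hx : x ∈ B <;> simp [hx]
    · intro f hd hf h
      have hfin : ∀ n, IndicatorMem α μ (⋃ k ∈ Finset.range n, f k) := by
        intro n
        induction n with
        | zero => simpa using hclosed _ isClosed_empty
        | succ n ih =>
          obtain ⟨l, hl, hlB⟩ := ih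
          obtain ⟨l', hl', hlB'⟩ := h n
          refine ⟨l' + l, add_mem hl' hl, (Lp.coeFn_add _ _).trans ?_⟩
          filter_upwards [hlB, hlB'] with x h1 h2
          rw [Pi.add_apply, h1, h2, Finset.range_add_one, Finset.set_biUnion_insert,
            Set.indicator_union_of_disjoint]
          rw [Set.disjoint_iUnion₂_right]
          intro k hk
          exact hd (Finset.mem_range.1 hk).ne'
      refine IndicatorMem.of_tendsto hfin (.iUnion hf) (Eventually.of_forall fun x => ?_)
      by_cases hx : x ∈ ⋃ k, f k
      · obtain ⟨N, hN⟩ := Set.mem_iUnion.1 hx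
        refine tendsto_const_nhds.congr' ?_
        filter_upwards [eventually_gt_atTop N] with n hn
        rw [Set.indicator_of_mem hx, Set.indicator_of_mem]
        exact Set.mem_biUnion (Finset.mem_coe.2 (Finset.mem_range.2 hn)) hN
      · refine tendsto_const_nhds.congr fun n => ?_
        rw [Set.indicator_of_notMem hx, Set.indicator_of_notMem]
        intro hx'
        exact hx (Set.iUnion₂_subset (fun k _ => Set.subset_iUnion f k) hx')
  rw [Submodule.dense_iff_topologicalClosure_eq_top, eq_top_iff]
  intro g _
  refine Lp.induction ENNReal.ofNat_ne_top
    (motive := fun g => g ∈ (LinearMap.range (energyGraphFst α μ)).topologicalClosure) ?_ ?_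
    (Submodule.isClosed_topologicalClosure _) g
  · intro c B hB hBμ
    obtain ⟨l, hl, hlB⟩ := hall B hB
    have h1 : ((Lp.simpleFunc.indicatorConst 2 hB hBμ.ne c : Lp.simpleFunc ℝ 2 μ) : Lp ℝ 2 μ)
        = c • l := by
      refine Lp.ext ?_
      rw [Lp.simpleFunc.coe_indicatorConst]
      filter_upwards [indicatorConstLp_coeFn (p := 2) (hs := hB) (hμs := hBμ.ne) (c := c),
        Lp.coeFn_smul c l, hlB] with x h1 h2 h3
      rw [h1, h2, Pi.smul_apply, h3]
      by_cases hx : x ∈ B <;> simp [hx]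
    rw [h1]
    exact Submodule.smul_mem _ _ hl
  · intro f g hf hg _ h1 h2
    exact add_mem h1 h2

end DirichletForm

/-! ### Strict quasi-regularity from a nest of compact sets -/

section QuasiRegular

set_option linter.unusedSectionVars false

variable {S : Type} [TopologicalSpace S] [MeasurableSpace S] [BorelSpace S] [SequenceSpace S]

open SequenceSpace

variable {μ : Measure S} [IsProbabilityMeasure μ] {α : ℝ}
  {hMP : ∀ i, MeasurePreserving (fun q : S × ℝ => replace q.1 i q.2) (μ ⊗ₘ condLaw μ i) μ}

/-! ### Identification of the form with the sum of its parts -/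

lemma integrable_jumpGrad_mul {w w' : JumpSpace μ} {u v : S → ℝ} (hw : HasJumpGrad α w u)
    (hw' : HasJumpGrad α w' v) :
    Integrable (fun z => jumpGrad α u z * jumpGrad α v z) (jumpMeasure μ) := by
  refine (MemLp.integrable_mul (Lp.memLp w.snd) (Lp.memLp w'.snd)).congr ?_
  filter_upwards [hw.2, hw'.2] with z h1 h2
  rw [Pi.mul_apply, h1, h2]

lemma integrable_jumpIntegrand {w w' : JumpSpace μ} {u v : S → ℝ} (hw : HasJumpGrad α w u)
    (hw' : HasJumpGrad α w' v) (i : ℕ) :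
    Integrable (jumpIntegrand α u v i) (μ ⊗ₘ condLaw μ i) := by
  have h1 := (integrable_jumpGrad_mul hw hw').mono_measure
    (Measure.le_sum (fun i => (μ ⊗ₘ condLaw μ i).map (Prod.mk i)) i)
  rw [(measurableEmbedding_prodMk_left i).integrable_map_iff] at h1
  refine h1.congr (Eventually.of_forall fun q => ?_)
  exact jumpGrad_mul_jumpGrad α u v i q

/-- Integration against the sum measure `jumpMeasure` is summation over i. Convergence is automatic,
the product of two L² gradients being integrable. -/
lemma hasSum_formPart {w w' : JumpSpace μ} {u v : S → ℝ} (hw : HasJumpGrad α w u)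
    (hw' : HasJumpGrad α w' v) :
    HasSum (fun i => formPart α μ i u v) (inner ℝ w.snd w'.snd) := by
  have h1 := hasSum_integral_measure (integrable_jumpGrad_mul hw hw')
  have h2 : ∫ z, jumpGrad α u z * jumpGrad α v z ∂jumpMeasure μ = inner ℝ w.snd w'.snd := by
    rw [L2.inner_def]
    refine integral_congr_ae ?_
    filter_upwards [hw.2, hw'.2] with z h1 h2
    rw [h1, h2, real_inner_eq_re_inner]
    simp [mul_comm]
  rw [← h2]
  have h3 : ∀ i, formPart α μ i u v = ∫ z, jumpGrad α u z * jumpGrad α v z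
      ∂((μ ⊗ₘ condLaw μ i).map (Prod.mk i)) := by
    intro i
    rw [(measurableEmbedding_prodMk_left i).integral_map, formPart,
      ← Measure.integral_compProd (integrable_jumpIntegrand hw hw' i)]
    exact integral_congr_ae (Eventually.of_forall fun q => (jumpGrad_mul_jumpGrad α u v i q).symm)
  simp only [h3]
  exact h1

lemma isClosureOfCylinderForm_jumpForm (hα : 0 < α) (hα₂ : α < 2) {ρ : ℕ → S → ℝ → ℝ}
    (hρ : IsLocallyBoundedCondDensity μ ρ) (hcut : HasBoundedCutoffs α μ) :
    (jumpForm hMP α).IsClosureOfCylinderForm α where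
  mem := by
    rintro u ⟨n, f, hf, hfc, rfl⟩
    obtain ⟨w, hw, hwu⟩ := exists_mem_cylinderGraph (μ := μ) hα hα₂
      (fun i => (hMP i).measurable) hρ hf hfc
    obtain ⟨e, he⟩ := exists_lift_eq (hMP := hMP) (cylinderGraph_le_energyGraph α n hw)
    refine ⟨e, ?_⟩
    rw [← lift_fst, he]
    exact hwu.1
  integrable := by
    rintro u v ⟨n, f, hf, hfc, rfl⟩ ⟨m, g, hg, hgc, rfl⟩ i
    obtain ⟨w, -, hwu⟩ := exists_mem_cylinderGraph (μ := μ) hα hα₂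
      (fun i => (hMP i).measurable) hρ hf hfc
    obtain ⟨w', -, hwu'⟩ := exists_mem_cylinderGraph (μ := μ) hα hα₂
      (fun i => (hMP i).measurable) hρ hg hgc
    exact integrable_jumpIntegrand hwu hwu' i
  hasSum := by
    intro u v _ _ f g hf hg
    rw [jumpForm_apply]
    rw [← lift_fst] at hf hg
    exact hasSum_formPart (HasJumpGrad.of_mem hMP (lift_mem f) hf)
      (HasJumpGrad.of_mem hMP (lift_mem g) hg)
  closed := isClosedForm_jumpForm
  dense := by
    intro u ε hε
    obtain ⟨n, w, hw, hd⟩ := exists_cylinderGraph_near hMP hα hα₂ hρ hcut (lift_mem u)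
      (Real.sqrt_pos.2 hε)
    obtain ⟨e, he⟩ := exists_lift_eq (hMP := hMP) (cylinderGraph_le_energyGraph α n hw)
    obtain ⟨f, hf, hfc, hwf⟩ := hw
    refine ⟨e, ⟨_, ⟨n, f, hf, hfc, rfl⟩, ?_⟩, ?_⟩
    · rw [← lift_fst, he]
      exact hwf.1
    · rw [jumpForm_form₁_self, lift_sub, he]
      exact (Real.lt_sqrt (norm_nonneg _)).1 hd

lemma abs_contraction_sub_le (s t : ℝ) :
    |min (max s 0) 1 - min (max t 0) 1| ≤ |s - t| := by
  refine (abs_min_sub_min_le_max _ _ _ _).trans ?_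
  rw [sub_self, abs_zero]
  refine max_le ((abs_max_sub_max_le_max _ _ _ _).trans ?_) (abs_nonneg _)
  simp

lemma isDirichletForm_jumpForm (hα : 0 < α) (hα₂ : α < 2) {ρ : ℕ → S → ℝ → ℝ}
    (hρ : IsLocallyBoundedCondDensity μ ρ) (hcut : HasBoundedCutoffs α μ)
    {F : ℕ → Set S} (hF : ∀ k, IsCompact (F k)) (hmono : Monotone F) (hμ : μ (⋃ k, F k) = 1) :
    (jumpForm hMP α).IsDirichletForm where
  dense := dense_range_energyGraphFst hMP hα hα₂ hρ hF hmono hμ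
  symm u v := by
    rw [jumpForm_apply, jumpForm_apply, real_inner_comm]
  nonneg u := by
    rw [jumpForm_apply]
    exact real_inner_self_nonneg
  closed := isClosedForm_jumpForm
  markov := by
    intro u
    obtain ⟨v, hv, hvu⟩ := exists_contraction_mem hMP hα hα₂ hρ hcut (lift_mem u)
    obtain ⟨e, rfl⟩ := exists_lift_eq (hMP := hMP) hv
    refine ⟨e, ?_, ?_⟩
    · rw [← lift_fst, ← lift_fst]
      exact hvu.1
    · rw [jumpForm_apply, jumpForm_apply, real_inner_self_eq_norm_sq, real_inner_self_eq_norm_sq]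
      have h1 : ‖(lift e).snd‖ₑ ^ 2 ≤ ‖(lift u).snd‖ₑ ^ 2 := by
        rw [hvu.enorm_snd_sq,
          (HasJumpGrad.of_mem hMP (lift_mem u) EventuallyEq.rfl).enorm_snd_sq]
        refine lintegral_mono fun z => pow_le_pow_left₀ zero_le ?_ 2
        rw [Real.enorm_eq_ofReal_abs, Real.enorm_eq_ofReal_abs]
        exact ENNReal.ofReal_le_ofReal (abs_jumpGrad_comp_le α abs_contraction_sub_le _ z)
      have h2 := ENNReal.toReal_mono (by simp) h1
      simpa only [ENNReal.toReal_pow, toReal_enorm] using h2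

/-- The capacity of `U` is controlled by the norm of any function of the domain which is at least
`1` on `U`. -/
lemma strictCap_jumpForm_le {φ : S → ℝ} (hφ : MemLp φ 2 μ) {U : Set S} {w : JumpSpace μ}
    (hw : w ∈ energyGraph α μ) (hwU : ∀ᵐ x ∂μ, x ∈ U → 1 ≤ w.fst x) :
    (jumpForm hMP α).strictCap φ U ≤ ENNReal.ofReal (‖w‖ * ‖hφ.toLp φ‖) := by
  obtain ⟨e, rfl⟩ := exists_lift_eq (hMP := hMP) hw
  refine iSup_le fun h => iSup_le fun v => iSup_le fun _ => iSup_le fun hh => iSup_le fun hv => ?_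
  refine ENNReal.ofReal_le_ofReal ?_
  -- As h ≤ 1 and e ≥ 1 on U, e competes in the minimisation that defines the reduced function,
  -- whose 𝓔_1-norm is therefore at most that of e, whatever h is.
  have hdom : (jumpForm hMP α).DominatesOn h U e := by
    filter_upwards [hwU, hh] with x h1 h2 hx
    rw [← lift_fst e]
    exact h2.trans (h1 hx)
  have h1 := hv.2 e hdom
  rw [jumpForm_form₁_self, jumpForm_form₁_self] at h1
  have h2 : ‖lift v‖ ≤ ‖lift e‖ := le_of_sq_le_sq h1 (norm_nonneg _)
  have h3 : ‖(v : Lp ℝ 2 μ)‖ ≤ ‖lift v‖ := by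
    rw [← lift_fst]
    refine le_of_sq_le_sq ?_ (norm_nonneg _)
    rw [WithLp.prod_norm_sq_eq_of_L2]
    exact le_add_of_nonneg_right (sq_nonneg _)
  have h4 : ∫ x, (v : Lp ℝ 2 μ) x * φ x ∂μ = inner ℝ (v : Lp ℝ 2 μ) (hφ.toLp φ) := by
    rw [L2.inner_def]
    refine integral_congr_ae ?_
    filter_upwards [hφ.coeFn_toLp] with x hx
    rw [hx, real_inner_eq_re_inner]
    simp [mul_comm]
  rw [h4]
  exact (real_inner_le_norm _ _).trans
    (mul_le_mul_of_nonneg_right (h3.trans h2) (norm_nonneg _))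

lemma isStrictNest_jumpForm {F : ℕ → Set S} (hF : ∀ k, IsClosed (F k)) (hmono : Monotone F)
    (hcap : ∀ ε > 0, ∃ k, ∃ w ∈ energyGraph α μ, ‖w‖ < ε ∧ ∀ᵐ x ∂μ, x ∉ F k → 1 ≤ w.fst x) :
    (jumpForm hMP α).IsStrictNest F where
  closed := hF
  mono := hmono
  cap := by
    intro φ hφ _
    rw [ENNReal.tendsto_atTop_zero]
    intro ε hε
    rcases eq_or_ne ε ⊤ with rfl | hεt
    · exact ⟨0, fun _ _ => le_top⟩
    have hε' : 0 < ε.toReal := ENNReal.toReal_pos hε.ne' hεt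
    have hpos : 0 < ‖hφ.toLp φ‖ + 1 := by positivity
    -- The added 1 keeps the denominator positive without any assumption on the norm of φ.
    obtain ⟨k, w, hw, hwε, hwF⟩ := hcap (ε.toReal / (‖hφ.toLp φ‖ + 1)) (by positivity)
    refine ⟨k, fun n hn => (strictCap_jumpForm_le hφ hw ?_).trans ?_⟩
    · filter_upwards [hwF] with x hx hxn
      exact hx fun hxk => hxn (hmono hn hxk)
    · refine ENNReal.ofReal_le_of_le_toReal ?_
      calc ‖w‖ * ‖hφ.toLp φ‖
          ≤ ε.toReal / (‖hφ.toLp φ‖ + 1) * (‖hφ.toLp φ‖ + 1) := by gcongr; linarith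
        _ = ε.toReal := div_mul_cancel₀ _ hpos.ne'

/-- Chebyshev's inequality: w ≥ 1 off F k gives that complement measure at most the squared norm of
w. -/
lemma measure_iUnion_eq_one_of_nest {F : ℕ → Set S} (hF : ∀ k, MeasurableSet (F k))
    (hcap : ∀ ε > 0, ∃ k, ∃ w ∈ energyGraph α μ, ‖w‖ < ε ∧ ∀ᵐ x ∂μ, x ∉ F k → 1 ≤ w.fst x) :
    μ (⋃ k, F k) = 1 := by
  rw [← prob_compl_eq_zero_iff (.iUnion hF), ← nonpos_iff_eq_zero]
  refine ENNReal.le_of_forall_pos_le_add fun ε hε _ => ?_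
  rw [zero_add]
  obtain ⟨k, w, -, hwε, hwF⟩ := hcap (√ε) (Real.sqrt_pos.2 hε)
  have h1 : μ (F k)ᶜ ≤ ‖w.fst‖ₑ ^ 2 := by
    rw [Lp.enorm_def, eLpNorm_two_sq, ← lintegral_indicator_one (hF k).compl]
    refine lintegral_mono_ae ?_
    filter_upwards [hwF] with x hx
    by_cases hxk : x ∈ F k
    · simp [hxk]
    · rw [Set.indicator_of_mem hxk, Pi.one_apply, Real.enorm_eq_ofReal_abs,
        ← ENNReal.ofReal_pow (abs_nonneg _), sq_abs, ENNReal.one_le_ofReal]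
      exact one_le_pow₀ (hx hxk)
  have h2 : ‖w.fst‖ₑ ^ 2 ≤ ‖w‖ₑ ^ 2 := by
    rw [enorm_sq_eq_add w]
    exact le_self_add
  have h3 : ‖w‖ₑ ^ 2 ≤ ε := by
    rw [← ofReal_norm, ← ENNReal.ofReal_pow (norm_nonneg _)]
    refine ENNReal.ofReal_le_of_le_toReal ?_
    exact ((Real.lt_sqrt (norm_nonneg _)).1 hwε).le
  exact (measure_mono (Set.compl_subset_compl.2 (Set.subset_iUnion F k))).trans
    (h1.trans (h2.trans h3))

/-- Countably many cylinder functions which separate points and vanish nowhere simultaneously. -/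
def separatingBase (i m : ℕ) (p : Fin (i + 1) → ℝ) : ℝ :=
  Real.exp (p (Fin.last i)) * ∏ k, cutoff ((m : ℝ) + 1) (p k)

lemma contDiff_separatingBase (i m : ℕ) : ContDiff ℝ ∞ (separatingBase i m) :=
  (Real.contDiff_exp.comp (contDiff_apply _ _ _)).mul
    (contDiff_prod fun _ _ => (contDiff_cutoff _).comp (contDiff_apply _ _ _))

lemma hasCompactSupport_separatingBase (i m : ℕ) : HasCompactSupport (separatingBase i m) := by
  refine hasCompactSupport_of_radius (R := 2 * ((m : ℝ) + 1)) fun p k hk => ?_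
  rw [separatingBase, Finset.prod_eq_zero (Finset.mem_univ k), mul_zero]
  exact cutoff_eq_zero (by positivity) hk.le

/-- For m above all the finitely many coordinates involved every cutoff is 1 at both points. The
exponential is used because it is injective, which separates points, and positive, which separates
them from the cemetery. -/
lemma exists_separatingBase_eq_exp (x y : S) (i : ℕ) : ∃ m : ℕ,
    (separatingBase i m fun k => coord (k : ℕ) x) = Real.exp (coord i x) ∧
      (separatingBase i m fun k => coord (k : ℕ) y) = Real.exp (coord i y) := by
  obtain ⟨m, hm⟩ := exists_nat_ge
    (∑ k ∈ Finset.range (i + 1), (|coord k x| + |coord k y|))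
  have hle : ∀ k ∈ Finset.range (i + 1), |coord k x| + |coord k y| ≤ m := fun k hk =>
    (Finset.single_le_sum (f := fun k => |coord k x| + |coord k y|)
      (fun j _ => by positivity) hk).trans hm
  refine ⟨m, ?_, ?_⟩
  all_goals
    rw [separatingBase, Finset.prod_eq_one, mul_one, Fin.val_last]
    intro k _
    refine cutoff_eq_one (by positivity) ?_
    have := hle k (Finset.mem_range.2 k.2)
    linarith [abs_nonneg (coord (k : ℕ) x), abs_nonneg (coord (k : ℕ) y)]

variable (hMP)

include hMP in
/-- The closure of the cylinder form is a strictly quasi-regular Dirichlet form if there is a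
sequence of compact sets outside of which functions of small `𝓔_1`-norm are at least `1`. -/
theorem closureIsStrictlyQuasiRegular_of_nest (hα : 0 < α) (hα₂ : α < 2) {ρ : ℕ → S → ℝ → ℝ}
    (hρ : IsLocallyBoundedCondDensity μ ρ) (hcut : HasBoundedCutoffs α μ)
    {F : ℕ → Set S} (hF : ∀ k, IsCompact (F k)) (hmono : Monotone F)
    (hcap : ∀ ε > 0, ∃ k, ∃ w ∈ energyGraph α μ, ‖w‖ < ε ∧ ∀ᵐ x ∂μ, x ∉ F k → 1 ≤ w.fst x) :
    ClosureIsStrictlyQuasiRegular α μ := by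
  have hT2 : T2Space S := T2Space.of_injective_continuous
    (f := fun (x : S) (j : ℕ) => coord j x) (fun x y h => ext_coord x y fun j => congrFun h j)
    (continuous_pi fun j => continuous_coord j)
  have hμ := measure_iUnion_eq_one_of_nest (fun k => (hF k).measurableSet) hcap
  have hnest : (jumpForm hMP α).IsStrictNest F :=
    isStrictNest_jumpForm (fun k => (hF k).isClosed) hmono hcap
  have hclos := isClosureOfCylinderForm_jumpForm (hMP := hMP) hα hα₂ hρ hcut
  refine ⟨jumpForm hMP α, hclos, isDirichletForm_jumpForm hα hα₂ hρ hcut hF hmono hμ,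
    ⟨F, hnest, hF⟩, ⟨_, hclos.dense, ?_⟩, ?_⟩
  · rintro u ⟨_, ⟨n, f, hf, -, rfl⟩, hu⟩
    exact ⟨_, hu, F, hnest, fun k => (continuous_cylinder hf.continuous).continuousOn⟩
  · choose u hu using fun n : ℕ => hclos.mem _ ⟨(Nat.unpair n).1, _,
      contDiff_separatingBase (Nat.unpair n).1 (Nat.unpair n).2,
      hasCompactSupport_separatingBase _ _, rfl⟩
    -- The separating functions work at every point, so the exceptional set can be empty.
    refine ⟨u, _, ∅, fun n => ⟨hu n, F, hnest, fun k =>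
      (continuous_cylinder (contDiff_separatingBase _ _).continuous).continuousOn⟩,
      ⟨F, hnest, Set.empty_subset _⟩, fun x _ y _ hxy => ?_, fun x _ => ?_⟩
    · obtain ⟨i, hi⟩ : ∃ i, coord i x ≠ coord i y := by
        by_contra h
        push Not at h
        exact hxy (ext_coord x y h)
      obtain ⟨m, hx, hy⟩ := exists_separatingBase_eq_exp x y i
      refine ⟨Nat.pair i m, ?_⟩
      rw [Nat.unpair_pair]
      simp only [hx, hy]
      exact fun h => hi (Real.exp_injective h)
    · obtain ⟨m, hx, -⟩ := exists_separatingBase_eq_exp x x 0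
      refine ⟨Nat.pair 0 m, ?_⟩
      rw [Nat.unpair_pair]
      simp only [hx]
      exact (Real.exp_pos _).ne'

end QuasiRegular

/-! ### Nests -/

section Nests

set_option linter.unusedSectionVars false

variable {S : Type} [TopologicalSpace S] [MeasurableSpace S] [BorelSpace S] [SequenceSpace S]

open SequenceSpace

variable {μ : Measure S} [IsProbabilityMeasure μ] {α : ℝ}
  (hMP : ∀ i, MeasurePreserving (fun q : S × ℝ => replace q.1 i q.2) (μ ⊗ₘ condLaw μ i) μ)

-- Both 1 and the infinite product belong to the domain. The constant does not contribute to the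
-- gradient, so the energy is that of the product.
include hMP in
lemma exists_hasJumpGrad_one_sub_infProd (hα : 0 < α) (hα₂ : α < 2) {ρ : ℕ → S → ℝ → ℝ}
    (hρ : IsLocallyBoundedCondDensity μ ρ) (hcut : HasBoundedCutoffs α μ) {θ : ℕ → ℝ → ℝ}
    (h0 : ∀ k t, 0 ≤ θ k t) (h1 : ∀ k t, θ k t ≤ 1) (hs : ∀ k, ContDiff ℝ ∞ (θ k))
    (hc : ∀ k, HasCompactSupport (θ k))
    (hE : ∑' i, jumpEnergy α μ (fun x => θ i (coord i x)) < ⊤) :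
    ∃ w ∈ energyGraph α μ, HasJumpGrad α w (fun x => 1 - infProd θ x) ∧
      ‖w‖ₑ ^ 2 ≤ ∫⁻ x, ‖1 - infProd θ x‖ₑ ^ 2 ∂μ +
        ∑' i, jumpEnergy α μ (fun x => θ i (coord i x)) := by
  obtain ⟨w₁, hw₁, hu₁⟩ := exists_hasJumpGrad_one hMP hα hα₂ hρ hcut
  obtain ⟨w₂, hw₂, hu₂⟩ := exists_hasJumpGrad_infProd hMP hα hα₂ hρ h0 h1 hs hc hE
  have hw : HasJumpGrad α (w₁ + (-1 : ℝ) • w₂) (fun x => 1 - infProd θ x) := by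
    have := hu₁.add (hu₂.smul (-1))
    convert this using 1
    ext x
    simp [sub_eq_add_neg]
  refine ⟨_, add_mem hw₁ (Submodule.smul_mem _ _ hw₂), hw, ?_⟩
  rw [hw.enorm_sq, jumpEnergy_one_sub]
  gcongr
  exact jumpEnergy_infProd_le h0 h1 α (fun i => (hMP i).measurable)
    fun k => (hs k).continuous.measurable

/-- Functions which are at least `1` outside of one of the sets `F k`. -/
def dominatingSet (α : ℝ) (μ : Measure S) [IsProbabilityMeasure μ] (F : ℕ → Set S) :
    Set (JumpSpace μ) :=
  {w | w ∈ energyGraph α μ ∧ ∃ k, ∀ᵐ x ∂μ, x ∉ F k → 1 ≤ w.fst x}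

/-- Two elements are both at least 1 off the larger of their two sets. The index may grow along a
sequence, so closedness is not available; this is why finite convex combinations are used. -/
lemma convex_dominatingSet {F : ℕ → Set S} (hF : Monotone F) :
    Convex ℝ (dominatingSet α μ F) := by
  rintro w ⟨hw, k, hk⟩ w' ⟨hw', k', hk'⟩ a b ha hb hab
  refine ⟨(energyGraph α μ).convex hw hw' ha hb hab, max k k', ?_⟩
  filter_upwards [hk, hk', Lp.coeFn_add (a • w.fst) (b • w'.fst), Lp.coeFn_smul a w.fst,
    Lp.coeFn_smul b w'.fst] with x h1 h2 h3 h4 h5 hx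
  have h6 := h1 fun h => hx (hF (le_max_left _ _) h)
  have h7 := h2 fun h => hx (hF (le_max_right _ _) h)
  have h8 : (a • w + b • w').fst = a • w.fst + b • w'.fst := rfl
  rw [h8, h3, Pi.add_apply, h4, h5, Pi.smul_apply, Pi.smul_apply, smul_eq_mul, smul_eq_mul]
  nlinarith

include hMP in
/-- Convex combinations of a bounded sequence in the closed graph which converges to `0` in
`L²(μ)` converge to `0`. -/
lemma exists_convexHull_tendsto_zero {w : ℕ → JumpSpace μ} {C : ℝ} (hw : ∀ k, w k ∈ jumpGraph hMP α)
    (hC : ∀ k, ‖w k‖ ≤ C) (h0 : Tendsto (fun k => (w k).fst) atTop (𝓝 0)) :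
    ∃ c : ℕ → JumpSpace μ, (∀ k, c k ∈ convexHull ℝ (Set.range w)) ∧
      Tendsto c atTop (𝓝 0) := by
  obtain ⟨c, l, hc, hl⟩ := exists_tendsto_mem_convexHull_tail hC
  have hcw : ∀ k, c k ∈ convexHull ℝ (Set.range w) := fun k =>
    convexHull_mono (Set.image_subset_range _ _) (hc k)
  have hlmem : l ∈ jumpGraph hMP α := by
    refine (isClosed_jumpGraph hMP α).mem_of_tendsto hl (Eventually.of_forall fun k => ?_)
    exact convexHull_min (by rintro _ ⟨k, rfl⟩; exact hw k) (jumpGraph hMP α).convex (hcw k)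
  -- The limit has vanishing function part and lies in the closed graph, so its gradient vanishes as
  -- well.
  have hlf : l.fst = 0 := by
    let P := WithLp.fstL 2 ℝ (Lp ℝ 2 μ) (Lp ℝ 2 (jumpMeasure μ))
    exact tendsto_nhds_unique ((P.continuous.tendsto l).comp hl)
      (tendsto_map_of_mem_convexHull_tail P h0 hc)
  have hl0 : HasJumpGrad α l 0 := by
    refine HasJumpGrad.congr hMP hlmem ?_
    rw [hlf]
    exact Lp.coeFn_zero _ _ _
  rw [hl0.unique HasJumpGrad.zero] at hl
  exact ⟨c, hcw, hl⟩

lemma norm_le_sqrt_of_enorm_sq_le {w : JumpSpace μ} {C : ℝ≥0∞} (hC : C < ⊤) (h : ‖w‖ₑ ^ 2 ≤ C) :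
    ‖w‖ ≤ √C.toReal := by
  refine Real.le_sqrt_of_sq_le ?_
  have := ENNReal.toReal_mono hC.ne h
  simpa using this

include hMP in
/-- The nest of the sets `{|x_i| ≤ k r_i for all i}`, if the total energy of the cutoff functions at
these scales is bounded. -/
lemma nest_of_bounded_energy (hα : 0 < α) (hα₂ : α < 2) {ρ : ℕ → S → ℝ → ℝ}
    (hρ : IsLocallyBoundedCondDensity μ ρ) (hcut : HasBoundedCutoffs α μ) {r : ℕ → ℝ}
    (hr : ∀ i, 0 < r i) {C : ℝ≥0∞} (hC : C < ⊤)
    (hE : ∀ᶠ M : ℕ in atTop, ∑' i, jumpEnergy α μ (fun x => cutoff (M * r i) (coord i x)) ≤ C)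
    (hμ : μ (⋃ M : ℕ, {x | ∀ i, |coord i x| ≤ M * r i}) = 1) :
    ∀ ε > 0, ∃ k : ℕ, ∃ w ∈ energyGraph α μ, ‖w‖ < ε ∧
      ∀ᵐ x ∂μ, x ∉ {x | ∀ i, |coord i x| ≤ k * r i} → 1 ≤ w.fst x := by
  have hmono : Monotone fun k : ℕ => {x : S | ∀ i, |coord i x| ≤ k * r i} := by
    intro k k' hk x hx i
    refine (hx i).trans ?_
    have := hr i
    gcongr
  -- From M₀ on the energy bound holds and the scales are positive; the sequence is reindexed to
  -- start there.
  obtain ⟨M₀, hM₀⟩ := eventually_atTop.1 (hE.and (eventually_gt_atTop 0))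
  have hpos : ∀ k i, 0 < ((M₀ + k : ℕ) : ℝ) * r i := fun k i =>
    mul_pos (Nat.cast_pos.2 (hM₀ _ (Nat.le_add_right _ _)).2) (hr i)
  choose w hw hwu hwn using fun k : ℕ => exists_hasJumpGrad_one_sub_infProd hMP hα hα₂ hρ hcut
    (θ := fun i => cutoff ((M₀ + k : ℕ) * r i)) (fun _ => cutoff_nonneg _)
    (fun _ => cutoff_le_one _) (fun _ => contDiff_cutoff _)
    (fun i => hasCompactSupport_cutoff (hpos k i))
    ((hM₀ _ (Nat.le_add_right M₀ k)).1.trans_lt hC)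
  have habs : ∀ k (x : S), |1 - infProd (fun i => cutoff ((M₀ + k : ℕ) * r i)) x| ≤ 1 := by
    intro k x
    have h1 := infProd_nonneg (θ := fun i => cutoff ((M₀ + k : ℕ) * r i))
      (fun _ => cutoff_nonneg _) x
    have h2 := infProd_le_one (θ := fun i => cutoff ((M₀ + k : ℕ) * r i))
      (fun _ => cutoff_nonneg _) (fun _ => cutoff_le_one _) x
    rw [abs_le]
    constructor <;> linarith
  have hbd : ∀ k, ‖w k‖ ≤ √(1 + C).toReal := by
    intro k
    refine norm_le_sqrt_of_enorm_sq_le (ENNReal.add_lt_top.2 ⟨ENNReal.one_lt_top, hC⟩)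
      ((hwn k).trans (add_le_add ?_ (hM₀ _ (Nat.le_add_right M₀ k)).1))
    refine (lintegral_mono (g := fun _ => 1) fun x => ?_).trans (by simp)
    refine pow_le_one₀ zero_le ?_
    rw [Real.enorm_eq_ofReal_abs, ENNReal.ofReal_le_one]
    exact habs k x
  have hmeas : MeasurableSet (⋃ M : ℕ, {x : S | ∀ i, |coord i x| ≤ M * r i}) := by
    refine .iUnion fun M => ?_
    rw [Set.ofPred_forall]
    exact .iInter fun i => measurableSet_le (measurable_coord i).norm measurable_const
  have hae : ∀ᵐ x ∂μ, x ∈ ⋃ M : ℕ, {x : S | ∀ i, |coord i x| ≤ M * r i} := by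
    rw [← prob_compl_eq_zero_iff hmeas] at hμ
    exact hμ
  have hlim : Tendsto (fun k => (w k).fst) atTop (𝓝 0) := by
    refine tendsto_of_dominated (fun k => (hwu k).1) (Lp.coeFn_zero ℝ 2 μ) (A := 1)
      (fun k => Eventually.of_forall fun x => ?_) ?_
    · simpa using habs k x
    · filter_upwards [hae] with x hx
      obtain ⟨N, hN⟩ := Set.mem_iUnion.1 hx
      refine tendsto_const_nhds.congr' ?_
      filter_upwards [eventually_ge_atTop N] with k hk
      rw [infProd_eq_one, sub_self]
      · rfl
      · intro i
        exact cutoff_eq_one (hpos k i) (hmono (hk.trans (Nat.le_add_left _ _)) hN i)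
  obtain ⟨c, hc, hct⟩ := exists_convexHull_tendsto_zero hMP
    (fun k => energyGraph_le_jumpGraph hMP α (hw k)) hbd hlim
  intro ε hε
  obtain ⟨k, hk⟩ := (hct.norm.eventually_lt_const (by simpa using hε)).exists
  have hmem : c k ∈ dominatingSet α μ fun k : ℕ => {x : S | ∀ i, |coord i x| ≤ k * r i} := by
    refine convexHull_min ?_ (convex_dominatingSet hmono) (hc k)
    rintro _ ⟨j, rfl⟩
    -- A cutoff at scale a vanishes from 2a on. Off the box of twice the scale some factor is
    -- therefore 0, and the function equals 1.
    refine ⟨hw j, 2 * (M₀ + j), ?_⟩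
    filter_upwards [(hwu j).1] with x hx hxF
    rw [hx]
    simp only [not_forall, not_le] at hxF
    obtain ⟨i, hi⟩ := hxF
    rw [infProd_eq_zero (fun _ => cutoff_nonneg _) (k := i), sub_zero]
    refine cutoff_eq_zero (hpos j i) (le_trans (le_of_eq ?_) hi.le)
    push_cast
    ring
  obtain ⟨h1, n, h2⟩ := hmem
  exact ⟨n, c k, h1, hk, h2⟩

include hMP in
/-- Smooth functions of one coordinate with compact support, close to `1` in energy and in mean. -/
lemma exists_small_cutoff (hcut : HasBoundedCutoffs α μ) (i : ℕ) {δ : ℝ≥0∞} (hδ : 0 < δ) :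
    ∃ θ : ℝ → ℝ, (∀ t, 0 ≤ θ t) ∧ (∀ t, θ t ≤ 1) ∧ ContDiff ℝ ∞ θ ∧ HasCompactSupport θ ∧
      jumpEnergy α μ (fun x => θ (coord i x)) ≤ δ ∧ ∫⁻ x, ‖1 - θ (coord i x)‖ₑ ∂μ ≤ δ := by
  obtain ⟨C, hC, a, ha, haC⟩ := hcut i
  have hbound : ∀ k (x : S), |1 - cutoff (a k) (coord i x)| ≤ 1 := by
    intro k x
    rw [abs_le]
    constructor <;> linarith [cutoff_nonneg (a k) (coord i x), cutoff_le_one (a k) (coord i x)]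
  have hm : ∀ k, Measurable fun x : S => 1 - cutoff (a k) (coord i x) := fun k =>
    measurable_const.sub ((contDiff_cutoff _).continuous.measurable.comp (measurable_coord i))
  choose w hw using fun k => exists_hasJumpGrad (α := α) (μ := μ)
    (fun i => (hMP i).measurable) (hm k) (memLp_of_bound (hm k) (hbound k))
    (by rw [jumpEnergy_one_sub]; exact (haC k).2.trans_lt hC)
  have hbd : ∀ k, ‖w k‖ ≤ √(1 + C).toReal := by
    intro k
    refine norm_le_sqrt_of_enorm_sq_le (ENNReal.add_lt_top.2 ⟨ENNReal.one_lt_top, hC⟩) ?_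
    rw [(hw k).enorm_sq, jumpEnergy_one_sub]
    refine add_le_add ?_ (haC k).2
    refine (lintegral_mono (g := fun _ => 1) fun x => ?_).trans (by simp)
    refine pow_le_one₀ zero_le ?_
    rw [Real.enorm_eq_ofReal_abs, ENNReal.ofReal_le_one]
    exact hbound k x
  have hlim : Tendsto (fun k => (w k).fst) atTop (𝓝 0) := by
    refine tendsto_of_dominated (fun k => (hw k).1) (Lp.coeFn_zero ℝ 2 μ) (A := 1)
      (fun k => Eventually.of_forall fun x => ?_) (Eventually.of_forall fun x => ?_)
    · simpa using hbound k x
    · simpa using (tendsto_cutoff ha (coord i x)).const_sub 1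
  obtain ⟨c, hc, hct⟩ := exists_convexHull_tendsto_zero hMP
    (fun k => (hw k).mem_jumpGraph hMP) hbd hlim
  have hct' : Tendsto (fun k => ‖c k‖ₑ) atTop (𝓝 0) := by
    simpa using hct.enorm
  -- A norm below 1 dominates its square, so that smallness of the norm bounds both the energy and
  -- the mean by δ.
  obtain ⟨k, hkδ, hk1⟩ := ((hct'.eventually_lt_const hδ).and
    (hct'.eventually_lt_const one_pos)).exists
  -- This family is convex since averaging the functions 1 - θ averages the θ, which stay smooth,
  -- compactly supported and between 0 and 1.
  let Θ : Set (JumpSpace μ) := {w | ∃ θ : ℝ → ℝ, (∀ t, 0 ≤ θ t) ∧ (∀ t, θ t ≤ 1) ∧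
    ContDiff ℝ ∞ θ ∧ HasCompactSupport θ ∧ HasJumpGrad α w fun x => 1 - θ (coord i x)}
  have hΘ : Convex ℝ Θ := by
    rintro w ⟨θ, h0, h1, hs, hc, hw⟩ w' ⟨θ', h0', h1', hs', hc', hw'⟩ s t hs0 ht0 hst
    refine ⟨fun y => s * θ y + t * θ' y,
      fun y => add_nonneg (mul_nonneg hs0 (h0 y)) (mul_nonneg ht0 (h0' y)), fun y => ?_,
      (contDiff_const.mul hs).add (contDiff_const.mul hs'), ?_, ?_⟩
    · nlinarith [h1 y, h1' y]
    · exact (hc.mul_left (f := fun _ => s)).add (hc'.mul_left (f := fun _ => t))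
    · convert (hw.smul s).add (hw'.smul t) using 1
      ext x
      simp only [Pi.add_apply, Pi.smul_apply, smul_eq_mul]
      linear_combination -hst
  have hck : c k ∈ Θ := by
    refine convexHull_min ?_ hΘ (hc k)
    rintro _ ⟨j, rfl⟩
    exact ⟨_, cutoff_nonneg _, cutoff_le_one _, contDiff_cutoff _,
      hasCompactSupport_cutoff (haC j).1, hw j⟩
  obtain ⟨θ, h0, h1, hs, hθc, hθ⟩ := hck
  refine ⟨θ, h0, h1, hs, hθc, ?_, ?_⟩
  · rw [← jumpEnergy_one_sub, ← hθ.enorm_snd_sq]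
    calc ‖(c k).snd‖ₑ ^ 2 ≤ ‖c k‖ₑ ^ 2 := by
          rw [enorm_sq_eq_add (c k)]
          exact le_add_self
      _ ≤ ‖c k‖ₑ := pow_le_of_le_one zero_le hk1.le two_ne_zero
      _ ≤ δ := hkδ.le
  · have h2 : eLpNorm (fun x => 1 - θ (coord i x)) 1 μ ≤ eLpNorm (fun x => 1 - θ (coord i x)) 2 μ :=
      eLpNorm_le_eLpNorm_of_exponent_le one_le_two
        (measurable_const.sub (hs.continuous.measurable.comp (measurable_coord i))).aestronglyMeasurable
    rw [eLpNorm_one_eq_lintegral_enorm, ← eLpNorm_congr_ae hθ.1, ← Lp.enorm_def] at h2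
    refine h2.trans (le_trans ?_ hkδ.le)
    have h3 : ‖(c k).fst‖ₑ ^ 2 ≤ ‖c k‖ₑ ^ 2 := by
      rw [enorm_sq_eq_add (c k)]
      exact le_self_add
    exact (ENNReal.pow_le_pow_left_iff two_ne_zero).1 h3

lemma one_sub_prod_le {θ : ℕ → ℝ} (h0 : ∀ k, 0 ≤ θ k) (h1 : ∀ k, θ k ≤ 1) (n : ℕ) :
    1 - ∏ k ∈ Finset.range n, θ k ≤ ∑ k ∈ Finset.range n, (1 - θ k) := by
  induction n with
  | zero => simp
  | succ n ih =>
    rw [Finset.prod_range_succ, Finset.sum_range_succ]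
    have h2 : ∏ k ∈ Finset.range n, θ k ≤ 1 := Finset.prod_le_one (fun k _ => h0 k) fun k _ => h1 k
    nlinarith [h1 n]

/-- A union bound, 1 - ∏ θ_i ≤ ∑ (1 - θ_i), applied to the partial products; squaring is harmless
for numbers in [0, 1]. -/
lemma enorm_one_sub_infProd_sq_le {θ : ℕ → ℝ → ℝ} (h0 : ∀ k t, 0 ≤ θ k t) (h1 : ∀ k t, θ k t ≤ 1)
    (x : S) : ‖1 - infProd θ x‖ₑ ^ 2 ≤ ∑' i, ‖1 - θ i (coord i x)‖ₑ := by
  have h2 : ‖1 - infProd θ x‖ₑ ≤ 1 := by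
    rw [Real.enorm_eq_ofReal_abs, ENNReal.ofReal_le_one, abs_le]
    constructor <;> linarith [infProd_nonneg h0 x, infProd_le_one h0 h1 x]
  refine (pow_le_of_le_one zero_le h2 two_ne_zero).trans ?_
  refine le_of_tendsto ((tendsto_infProd h0 h1 x).const_sub 1).enorm (Eventually.of_forall fun n => ?_)
  refine le_trans ?_ (ENNReal.sum_le_tsum (Finset.range (n + 1)))
  have h3 : ∀ k, ‖1 - θ k (coord k x)‖ₑ = ENNReal.ofReal (1 - θ k (coord k x)) := fun k =>
    Real.enorm_of_nonneg (sub_nonneg.2 (h1 _ _))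
  simp only [h3]
  rw [← ENNReal.ofReal_sum_of_nonneg fun k _ => sub_nonneg.2 (h1 _ _), Real.enorm_of_nonneg
    (sub_nonneg.2 (Finset.prod_le_one (fun k _ => h0 _ _) fun k _ => h1 _ _))]
  exact ENNReal.ofReal_le_ofReal (one_sub_prod_le (fun k => h0 _ _) (fun k => h1 _ _) _)

include hMP in
/-- A nest of products of intervals. -/
lemma nest_of_cutoffs (hα : 0 < α) (hα₂ : α < 2) {ρ : ℕ → S → ℝ → ℝ}
    (hρ : IsLocallyBoundedCondDensity μ ρ) (hcut : HasBoundedCutoffs α μ) :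
    ∃ A : ℕ → ℕ → ℝ, Monotone A ∧ ∀ ε > 0, ∃ k, ∃ w ∈ energyGraph α μ, ‖w‖ < ε ∧
      ∀ᵐ x ∂μ, x ∉ {x | ∀ i, |coord i x| ≤ A k i} → 1 ≤ w.fst x := by
  -- The budget of the k-th product, distributed over the coordinates; it pays for the energies and
  -- for the L¹ deviations from 1.
  have hδ : ∀ k : ℕ, ∃ δ : ℕ → ℝ≥0, (∀ i, 0 < δ i) ∧
      ∑' i, (δ i : ℝ≥0∞) < ENNReal.ofReal (1 / ((k : ℝ) + 1)) := fun k =>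
    ENNReal.exists_pos_sum_of_countable
      (ENNReal.ofReal_pos.2 (by positivity : (0 : ℝ) < 1 / ((k : ℝ) + 1))).ne' ℕ
  choose δ hδ0 hδs using hδ
  choose θ h0 h1 hs hc hE hI using fun k i =>
    exists_small_cutoff hMP hcut i (ENNReal.coe_pos.2 (hδ0 k i))
  have hrad : ∀ k i, ∃ a : ℝ, 0 ≤ a ∧ ∀ t, a < |t| → θ k i t = 0 := by
    intro k i
    obtain ⟨a, ha⟩ := (hc k i).isCompact.isBounded.subset_closedBall 0
    refine ⟨max a 0, le_max_right _ _, fun t ht => ?_⟩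
    by_contra h
    have := ha (subset_tsupport _ h)
    rw [mem_closedBall_zero_iff] at this
    exact absurd this (not_le.2 ((le_max_left _ _).trans_lt ht))
  choose a ha0 ha using hrad
  -- Summing the support radii up to index k makes the boxes increase with k while they still
  -- contain the support of the k-th product.
  refine ⟨fun k i => ∑ j ∈ Finset.range (k + 1), a j i, ?_, ?_⟩
  · intro k k' hk i
    exact Finset.sum_le_sum_of_subset_of_nonneg
      (Finset.range_mono (Nat.succ_le_succ hk)) fun j _ _ => ha0 j i
  · have hsum : ∀ k, ∑' i, jumpEnergy α μ (fun x => θ k i (coord i x))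
        ≤ ENNReal.ofReal (1 / ((k : ℝ) + 1)) := fun k =>
      (ENNReal.tsum_le_tsum fun i => hE k i).trans (hδs k).le
    choose w hw hwu hwn using fun k : ℕ => exists_hasJumpGrad_one_sub_infProd hMP hα hα₂ hρ hcut
      (h0 k) (h1 k) (hs k) (hc k) ((hsum k).trans_lt ENNReal.ofReal_lt_top)
    have hnorm : ∀ k, ‖w k‖ ^ 2 ≤ 2 * (1 / ((k : ℝ) + 1)) := by
      intro k
      have h2 : ∫⁻ x, ‖1 - infProd (θ k) x‖ₑ ^ 2 ∂μ ≤ ENNReal.ofReal (1 / ((k : ℝ) + 1)) := by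
        refine (lintegral_mono fun x => enorm_one_sub_infProd_sq_le (h0 k) (h1 k) x).trans ?_
        have hm : ∀ i, Measurable fun x : S => ‖1 - θ k i (coord i x)‖ₑ := fun i =>
          (measurable_const.sub
            ((hs k i).continuous.measurable.comp (measurable_coord i))).enorm
        rw [lintegral_tsum fun i => (hm i).aemeasurable]
        exact (ENNReal.tsum_le_tsum fun i => hI k i).trans (hδs k).le
      have h3 := (hwn k).trans (add_le_add h2 (hsum k))
      rw [← ENNReal.ofReal_add (by positivity) (by positivity), ← two_mul, ← ofReal_norm,
        ← ENNReal.ofReal_pow (norm_nonneg _)] at h3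
      exact (ENNReal.ofReal_le_ofReal_iff (by positivity)).1 h3
    intro ε hε
    have hlim : Tendsto (fun k : ℕ => 2 * (1 / ((k : ℝ) + 1))) atTop (𝓝 0) := by
      simpa using (tendsto_one_div_add_atTop_nhds_zero_nat (𝕜 := ℝ)).const_mul 2
    obtain ⟨k, hk⟩ := (hlim.eventually_lt_const (show 0 < ε ^ 2 by positivity)).exists
    refine ⟨k, w k, hw k, lt_of_pow_lt_pow_left₀ 2 hε.le ((hnorm k).trans_lt hk), ?_⟩
    filter_upwards [(hwu k).1] with x hx hxF
    rw [hx]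
    simp only [not_forall, not_le] at hxF
    obtain ⟨i, hi⟩ := hxF
    rw [infProd_eq_zero (h0 k) (k := i), sub_zero]
    refine ha k i _ (lt_of_le_of_lt ?_ hi)
    exact Finset.single_le_sum (f := fun j => a j i) (fun j _ => ha0 j i)
      (Finset.self_mem_range_succ k)

end Nests

/-! ### The three state spaces -/

section StateSpaces

set_option linter.unusedSectionVars false

variable {S : Type} [TopologicalSpace S] [MeasurableSpace S] [BorelSpace S] [SequenceSpace S]

open SequenceSpace

variable {μ : Measure S} [IsProbabilityMeasure μ] {α : ℝ}

/-- The energy of the cutoff functions at the scales `M r_i`. -/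
lemma exists_jumpEnergy_cutoff_le (hα : 0 < α) (hα₂ : α < 2) {ρ : ℕ → S → ℝ → ℝ}
    (hρ : IsLocallyBoundedCondDensity μ ρ) {r : ℕ → ℝ} (hr : ∀ i, 0 < r i) {L : ℕ → ℕ → ℝ}
    (hL : ∀ M i : ℕ, CondDensityBound μ ρ i (Set.Icc (-(6 * (M * r i))) (6 * (M * r i))) (L M i)) :
    ∃ C < ⊤, ∀ M i : ℕ, 1 ≤ M → jumpEnergy α μ (fun x => cutoff (M * r i) (coord i x)) ≤
      C * (ENNReal.ofReal ((M : ℝ) ^ (-α)) * (ENNReal.ofReal (L M i * r i ^ (-α)) *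
        μ {x | M * r i < |coord i x|})) +
      2 * (ENNReal.ofReal (r i ^ (-(α + 1))) * μ {x | M * r i < |coord i x|}) := by
  obtain ⟨C, hC, h⟩ := exists_lintegral_cutoffEnergy_compProd_le hα hα₂ hρ
  refine ⟨2 * C, ENNReal.mul_lt_top ENNReal.ofNat_lt_top hC, fun M i hM => ?_⟩
  have hM' : (1 : ℝ) ≤ M := by exact_mod_cast hM
  have hpos : 0 < (M : ℝ) * r i := mul_pos (one_pos.trans_le hM') (hr i)
  rw [jumpEnergy_coord]
  refine (h i _ _ hpos (hL M i)).trans ?_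
  have h1 : ENNReal.ofReal (L M i) * ENNReal.ofReal ((M * r i) ^ (-α))
      = ENNReal.ofReal ((M : ℝ) ^ (-α)) * ENNReal.ofReal (L M i * r i ^ (-α)) := by
    rw [Real.mul_rpow (by positivity) (hr i).le, ENNReal.ofReal_mul (by positivity),
      ENNReal.ofReal_mul' (Real.rpow_nonneg (hr i).le _)]
    ring
  -- As M ≥ 1, the factor M^(-(α+1)) can be dropped.
  have h2 : ENNReal.ofReal ((M * r i) ^ (-(α + 1))) ≤ ENNReal.ofReal (r i ^ (-(α + 1))) := by
    refine ENNReal.ofReal_le_ofReal (Real.rpow_le_rpow_of_nonpos (hr i) ?_ (by linarith))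
    exact le_mul_of_one_le_left (hr i).le hM'
  rw [h1]
  calc _ ≤ 2 * ((C * (ENNReal.ofReal ((M : ℝ) ^ (-α)) * ENNReal.ofReal (L M i * r i ^ (-α))) +
        ENNReal.ofReal (r i ^ (-(α + 1)))) * μ {x | M * r i < |coord i x|}) := by gcongr
    _ = _ := by ring

/-- A finite limit bounds the weighted sums for large M, and each single term by the sum. The
remaining part of the energy of one coordinate is bounded by a constant, probabilities being at most
1. -/
lemma hasBoundedCutoffs_of_tendsto (hα : 0 < α) (hα₂ : α < 2) {ρ : ℕ → S → ℝ → ℝ}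
    (hρ : IsLocallyBoundedCondDensity μ ρ) {r : ℕ → ℝ} (hr : ∀ i, 0 < r i) {L : ℕ → ℕ → ℝ}
    (hL : ∀ M i : ℕ, CondDensityBound μ ρ i (Set.Icc (-(6 * (M * r i))) (6 * (M * r i))) (L M i))
    {c : ℝ≥0∞} (hc : c < ⊤)
    (hlim : Tendsto (fun M : ℕ => ENNReal.ofReal ((M : ℝ) ^ (-α)) *
      ∑' i, ENNReal.ofReal (L M i * r i ^ (-α)) * μ {x | M * r i < |coord i x|}) atTop (𝓝 c)) :
    HasBoundedCutoffs α μ := by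
  intro i
  obtain ⟨C, hC, h⟩ := exists_jumpEnergy_cutoff_le hα hα₂ hρ hr hL
  have hc1 : c < c + 1 := ENNReal.lt_add_right hc.ne one_ne_zero
  obtain ⟨N, hN⟩ := eventually_atTop.1 ((hlim.eventually_lt_const hc1).and (eventually_ge_atTop 1))
  refine ⟨C * (c + 1) + 2 * ENNReal.ofReal (r i ^ (-(α + 1))), ?_,
    fun k => (N + k : ℕ) * r i, ?_, fun k => ⟨?_, ?_⟩⟩
  · exact ENNReal.add_lt_top.2 ⟨ENNReal.mul_lt_top hC (ENNReal.add_lt_top.2 ⟨hc,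
      ENNReal.one_lt_top⟩), ENNReal.mul_lt_top ENNReal.ofNat_lt_top ENNReal.ofReal_lt_top⟩
  · refine Tendsto.atTop_mul_const (hr i) (tendsto_natCast_atTop_atTop.comp ?_)
    exact tendsto_atTop_mono (fun k => Nat.le_add_left k N) tendsto_id
  · exact mul_pos (Nat.cast_pos.2 (hN _ (Nat.le_add_right N k)).2) (hr i)
  · obtain ⟨h1, h2⟩ := hN _ (Nat.le_add_right N k)
    refine (h _ i h2).trans (add_le_add (mul_le_mul_right ?_ _) (mul_le_mul_right ?_ _))
    · refine le_trans (mul_le_mul_right ?_ _) h1.le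
      exact ENNReal.le_tsum (f := fun i => ENNReal.ofReal (L (N + k) i * r i ^ (-α)) *
        μ {x | (N + k : ℕ) * r i < |coord i x|}) i
    · exact mul_le_of_le_one_right' prob_le_one

/-- Strict quasi-regularity if the sets `{|x_i| ≤ M r_i for all i}` are compact. -/
theorem closureIsStrictlyQuasiRegular_of_isCompact (hα : 0 < α) (hα₂ : α < 2)
    (hrep : ∀ i, Continuous fun q : S × ℝ => replace q.1 i q.2) {ρ : ℕ → S → ℝ → ℝ}
    (hρ : IsLocallyBoundedCondDensity μ ρ) {r : ℕ → ℝ} (hr : ∀ i, 0 < r i) {L : ℕ → ℕ → ℝ}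
    (hL : ∀ M i : ℕ, CondDensityBound μ ρ i (Set.Icc (-(6 * (M * r i))) (6 * (M * r i))) (L M i))
    (hcpt : ∀ M : ℕ, IsCompact {x : S | ∀ i, |coord i x| ≤ M * r i})
    (hμ : μ (⋃ M : ℕ, {x | ∀ i, |coord i x| ≤ M * r i}) = 1) {M₀ : ℝ}
    (hsum : ∑' i, ENNReal.ofReal (r i ^ (-(α + 1))) * μ {x | M₀ * r i < |coord i x|} < ⊤)
    {c : ℝ≥0∞} (hc : c < ⊤)
    (hlim : Tendsto (fun M : ℕ => ENNReal.ofReal ((M : ℝ) ^ (-α)) *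
      ∑' i, ENNReal.ofReal (L M i * r i ^ (-α)) * μ {x | M * r i < |coord i x|}) atTop (𝓝 c)) :
    ClosureIsStrictlyQuasiRegular α μ := by
  have hmono : Monotone fun M : ℕ => {x : S | ∀ i, |coord i x| ≤ M * r i} := by
    intro k k' hk x hx i
    refine (hx i).trans ?_
    have := hr i
    gcongr
  have hMP := fun i => measurePreserving_replace (hrep i) hcpt hmono hμ
  have hcut := hasBoundedCutoffs_of_tendsto hα hα₂ hρ hr hL hc hlim
  obtain ⟨C, hC, h⟩ := exists_jumpEnergy_cutoff_le hα hα₂ hρ hr hL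
  have hc1 : c < c + 1 := ENNReal.lt_add_right hc.ne one_ne_zero
  refine closureIsStrictlyQuasiRegular_of_nest hMP hα hα₂ hρ hcut hcpt hmono
    (nest_of_bounded_energy hMP hα hα₂ hρ hcut hr (C := C * (c + 1) + 2 *
      ∑' i, ENNReal.ofReal (r i ^ (-(α + 1))) * μ {x | M₀ * r i < |coord i x|}) ?_ ?_ hμ)
  · exact ENNReal.add_lt_top.2 ⟨ENNReal.mul_lt_top hC (ENNReal.add_lt_top.2 ⟨hc,
      ENNReal.one_lt_top⟩), ENNReal.mul_lt_top ENNReal.ofNat_lt_top hsum⟩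
  · filter_upwards [hlim.eventually_lt_const hc1, eventually_ge_atTop 1,
      -- Once M ≥ M₀, the event |x_i| > M r_i is contained in |x_i| > M₀ r_i, whose weighted
      -- probabilities are summable.
      eventually_ge_atTop ⌈M₀⌉₊] with M h1 h2 h3
    refine (ENNReal.tsum_le_tsum fun i => h M i h2).trans ?_
    rw [ENNReal.tsum_add, ENNReal.tsum_mul_left, ENNReal.tsum_mul_left, ENNReal.tsum_mul_left]
    refine add_le_add (mul_le_mul_right h1.le _) (mul_le_mul_right ?_ _)
    refine ENNReal.tsum_le_tsum fun i => mul_le_mul_right (measure_mono fun x hx => ?_) _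
    have hx' : (M : ℝ) * r i < |coord i x| := hx
    exact lt_of_le_of_lt (mul_le_mul_of_nonneg_right (Nat.ceil_le.1 h3) (hr i).le) hx'

end StateSpaces

/-! ### Compactness of boxes and continuity of coordinate replacement -/

lemma isCompact_box (a : ℕ → ℝ) : IsCompact {x : ℕ → ℝ | ∀ i, |x i| ≤ a i} := by
  have h : {x : ℕ → ℝ | ∀ i, |x i| ≤ a i} = Set.univ.pi fun i => Set.Icc (-a i) (a i) := by
    ext x
    simp only [Set.mem_univ_pi, Set.mem_Icc, ← abs_le, Set.mem_ofPred_eq]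
  rw [h]
  exact isCompact_univ_pi fun i => isCompact_Icc

namespace WeightedLp

variable {p : ℝ} {β : ℕ → ℝ} [hp : Fact (1 ≤ p)] [hβ : Fact (∀ i, 0 < β i)]

lemma summable_sub (x y : WeightedLp p β) : Summable fun i => β i * |x.1 i - y.1 i| ^ p := by
  have hp' : 0 < (ENNReal.ofReal p).toReal := by rw [toReal_p]; exact p_pos
  have h := (lp.memℓp (scaled x - scaled y)).summable hp'
  rw [toReal_p] at h
  refine h.congr fun i => ?_
  rw [← norm_scaled, mul_sub]
  rfl

/-- The box is the image of the same box in ℝ^ℕ, compact by Tychonoff. The identity is continuous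
for the l^p distance because the summable bound makes the distance series converge uniformly. -/
lemma isCompact_box {a : ℕ → ℝ} (ha : Summable fun i => β i * (2 * a i) ^ p) :
    IsCompact {x : WeightedLp p β | ∀ i, |x.1 i| ≤ a i} := by
  rcases Set.eq_empty_or_nonempty {x : WeightedLp p β | ∀ i, |x.1 i| ≤ a i} with h | ⟨x₀, hx₀⟩
  · rw [h]
    exact isCompact_empty
  have ha0 : ∀ i, 0 ≤ a i := fun i => (abs_nonneg _).trans (hx₀ i)
  have hp0 : 0 < p := p_pos
  have hbound : ∀ (x y : {x : ℕ → ℝ // ∀ i, |x i| ≤ a i}) i,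
      β i * |x.1 i - y.1 i| ^ p ≤ β i * (2 * a i) ^ p := by
    intro x y i
    have h1 : |x.1 i - y.1 i| ≤ 2 * a i :=
      (abs_sub _ _).trans (by linarith [x.2 i, y.2 i])
    exact mul_le_mul_of_nonneg_left (Real.rpow_le_rpow (abs_nonneg _) h1 hp0.le) (hβ.out i).le
  have hmem : ∀ x : {x : ℕ → ℝ // ∀ i, |x i| ≤ a i}, Summable fun i => β i * |x.1 i| ^ p := by
    intro x
    refine Summable.of_nonneg_of_le (fun i => mul_nonneg (hβ.out i).le (by positivity))
      (fun i => ?_) ha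
    exact mul_le_mul_of_nonneg_left (Real.rpow_le_rpow (abs_nonneg _)
      ((x.2 i).trans (by linarith [ha0 i])) hp0.le) (hβ.out i).le
  let Φ : {x : ℕ → ℝ // ∀ i, |x i| ≤ a i} → WeightedLp p β := fun x => ⟨x.1, hmem x⟩
  have hΦ : Continuous Φ := by
    refine continuous_iff_continuousAt.2 fun x => tendsto_iff_dist_tendsto_zero.2 ?_
    have h1 : Continuous fun y : {x : ℕ → ℝ // ∀ i, |x i| ≤ a i} =>
        (∑' i, β i * |y.1 i - x.1 i| ^ p) ^ (1 / p) := by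
      refine Continuous.rpow_const (continuous_tsum (fun i => ?_) ha fun i y => ?_)
        fun _ => Or.inr (by positivity)
      · exact continuous_const.mul (Continuous.rpow_const
          ((((continuous_apply i).comp continuous_subtype_val).sub continuous_const).abs)
          fun _ => Or.inr hp0.le)
      · rw [Real.norm_of_nonneg (mul_nonneg (hβ.out i).le (by positivity))]
        exact hbound y x i
    have h2 := h1.tendsto x
    have h3 : (∑' i, β i * |x.1 i - x.1 i| ^ p) ^ (1 / p) = 0 := by
      simp [Real.zero_rpow hp0.ne', Real.zero_rpow (inv_pos.2 hp0).ne']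
    rw [h3] at h2
    exact h2
  have : CompactSpace {x : ℕ → ℝ // ∀ i, |x i| ≤ a i} :=
    isCompact_iff_compactSpace.1 (_root_.isCompact_box a)
  have hrange : {x : WeightedLp p β | ∀ i, |x.1 i| ≤ a i} = Set.range Φ := by
    ext x
    exact ⟨fun hx => ⟨⟨x.1, hx⟩, rfl⟩, by rintro ⟨y, rfl⟩; exact y.2⟩
  rw [hrange]
  exact isCompact_range hΦ

/-- The p-th power of the new distance is at most that of the old one plus the contribution of the
replaced coordinate. -/
lemma continuous_replace (i : ℕ) : Continuous fun q : WeightedLp p β × ℝ =>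
    SequenceSpace.replace q.1 i q.2 := by
  have hp0 : 0 < p := p_pos
  refine continuous_iff_continuousAt.2 fun q => tendsto_iff_dist_tendsto_zero.2 ?_
  have h1 : Continuous fun q' : WeightedLp p β × ℝ =>
      (dist q'.1 q.1 ^ p + β i * |q'.2 - q.2| ^ p) ^ (1 / p) := by
    refine Continuous.rpow_const (Continuous.add ?_ ?_) fun _ => Or.inr (by positivity)
    · exact Continuous.rpow_const (continuous_fst.dist continuous_const) fun _ => Or.inr hp0.le
    · exact continuous_const.mul (Continuous.rpow_const (continuous_snd.sub continuous_const).abs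
        fun _ => Or.inr hp0.le)
  have h2 := h1.tendsto q
  simp only [dist_self, sub_self, abs_zero, Real.zero_rpow hp0.ne', mul_zero, add_zero,
    Real.zero_rpow (one_div_pos.2 hp0).ne'] at h2
  refine squeeze_zero (fun _ => dist_nonneg) (fun q' => ?_) h2
  have hnn : ∀ (x y : WeightedLp p β) j, 0 ≤ β j * |x.1 j - y.1 j| ^ p := fun x y j =>
    mul_nonneg (hβ.out j).le (by positivity)
  refine Real.rpow_le_rpow (tsum_nonneg fun j => hnn _ _ j) ?_ (by positivity)
  have h3 : dist q'.1 q.1 ^ p = ∑' j, β j * |q'.1.1 j - q.1.1 j| ^ p := by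
    change ((∑' j, β j * |q'.1.1 j - q.1.1 j| ^ p) ^ (1 / p)) ^ p = _
    rw [← Real.rpow_mul (tsum_nonneg fun j => hnn _ _ j), one_div_mul_cancel hp0.ne',
      Real.rpow_one]
  rw [h3, ← tsum_ite_eq i (fun _ => β i * |q'.2 - q.2| ^ p),
    ← (summable_sub q'.1 q.1).tsum_add (hasSum_ite_eq i _).summable]
  refine (summable_sub _ _).tsum_le_tsum (fun j => ?_)
    ((summable_sub q'.1 q.1).add (hasSum_ite_eq i _).summable)
  change β j * |Function.update q'.1.1 i q'.2 j - Function.update q.1.1 i q.2 j| ^ p ≤ _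
  by_cases hj : j = i
  · subst hj
    simpa using hnn q'.1 q.1 j
  · simp [hj]

end WeightedLp

namespace WeightedLinf

variable {β : ℕ → ℝ} [hβ : Fact (∀ i, 0 < β i)]

lemma le_dist (x y : WeightedLinf β) (i : ℕ) : β i * |x.1 i - y.1 i| ≤ dist x y := by
  have h := lp.norm_apply_le_norm ENNReal.top_ne_zero (scaled x - scaled y) i
  rw [dist_eq_scaled, dist_eq_norm]
  refine le_trans (le_of_eq ?_) h
  rw [← norm_scaled, mul_sub]
  rfl

/-- Again the image of a compact box of ℝ^ℕ: as β_i a_i tends to 0, all but finitely many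
coordinates are uniformly small, and the others converge one by one. -/
lemma isCompact_box {a : ℕ → ℝ} (ha : Tendsto (fun i => β i * a i) atTop (𝓝 0)) :
    IsCompact {x : WeightedLinf β | ∀ i, |x.1 i| ≤ a i} := by
  have hmem : ∀ x : {x : ℕ → ℝ // ∀ i, |x i| ≤ a i},
      BddAbove (Set.range fun i => β i * |x.1 i|) := by
    intro x
    obtain ⟨C, hC⟩ := ha.bddAbove_range
    refine ⟨C, ?_⟩
    rintro _ ⟨i, rfl⟩
    exact (mul_le_mul_of_nonneg_left (x.2 i) (hβ.out i).le).trans (hC ⟨i, rfl⟩)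
  let Φ : {x : ℕ → ℝ // ∀ i, |x i| ≤ a i} → WeightedLinf β := fun x => ⟨x.1, hmem x⟩
  have hΦ : Continuous Φ := by
    refine continuous_iff_continuousAt.2 fun x => Metric.tendsto_nhds.2 fun ε hε => ?_
    obtain ⟨N, hN⟩ := eventually_atTop.1 (ha.eventually_lt_const (show 0 < ε / 4 by positivity))
    have h1 : ∀ᶠ y in 𝓝 x, ∀ i ∈ Finset.range N, β i * |y.1 i - x.1 i| < ε / 2 := by
      rw [Finset.eventually_all]
      intro i _
      have h2 : Continuous fun y : {x : ℕ → ℝ // ∀ i, |x i| ≤ a i} => β i * |y.1 i - x.1 i| :=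
        continuous_const.mul
          (((continuous_apply i).comp continuous_subtype_val).sub continuous_const).abs
      have h3 := h2.tendsto x
      rw [sub_self, abs_zero, mul_zero] at h3
      exact h3.eventually_lt_const (by positivity)
    filter_upwards [h1] with y hy
    refine lt_of_le_of_lt (ciSup_le fun i => ?_) (half_lt_self hε)
    rcases lt_or_ge i N with hi | hi
    · exact (hy i (Finset.mem_range.2 hi)).le
    · have h2 : |y.1 i - x.1 i| ≤ 2 * a i := (abs_sub _ _).trans (by linarith [y.2 i, x.2 i])
      have h3 := mul_le_mul_of_nonneg_left h2 (hβ.out i).le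
      have h4 := hN i hi
      change β i * |y.1 i - x.1 i| ≤ ε / 2
      linarith
  have : CompactSpace {x : ℕ → ℝ // ∀ i, |x i| ≤ a i} :=
    isCompact_iff_compactSpace.1 (_root_.isCompact_box a)
  have hrange : {x : WeightedLinf β | ∀ i, |x.1 i| ≤ a i} = Set.range Φ := by
    ext x
    exact ⟨fun hx => ⟨⟨x.1, hx⟩, rfl⟩, by rintro ⟨y, rfl⟩; exact y.2⟩
  rw [hrange]
  exact isCompact_range hΦ

lemma continuous_replace (i : ℕ) : Continuous fun q : WeightedLinf β × ℝ =>
    SequenceSpace.replace q.1 i q.2 := by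
  refine continuous_iff_continuousAt.2 fun q => tendsto_iff_dist_tendsto_zero.2 ?_
  have h1 : Continuous fun q' : WeightedLinf β × ℝ => dist q'.1 q.1 + β i * |q'.2 - q.2| :=
    (continuous_fst.dist continuous_const).add
      (continuous_const.mul (continuous_snd.sub continuous_const).abs)
  have h2 := h1.tendsto q
  simp only [dist_self, sub_self, abs_zero, mul_zero, add_zero] at h2
  refine squeeze_zero (fun _ => dist_nonneg) (fun q' => ciSup_le fun j => ?_) h2
  change β j * |Function.update q'.1.1 i q'.2 j - Function.update q.1.1 i q.2 j| ≤ _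
  by_cases hj : j = i
  · subst hj
    simp
  · simpa [hj] using (le_dist q'.1 q.1 j).trans
      (le_add_of_nonneg_right (mul_nonneg (hβ.out i).le (abs_nonneg _)))

end WeightedLinf

/-- Strict quasi-regularity on the space `ℝ^ℕ`. -/
theorem closureIsStrictlyQuasiRegular_pi {α : ℝ} (hα : 0 < α) (hα₂ : α < 2)
    {μ : Measure (ℕ → ℝ)} [IsProbabilityMeasure μ] {ρ : ℕ → (ℕ → ℝ) → ℝ → ℝ}
    (hρ : IsLocallyBoundedCondDensity μ ρ) (hcut : HasBoundedCutoffs α μ) :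
    ClosureIsStrictlyQuasiRegular α μ := by
  have hrep : ∀ i, Continuous fun q : (ℕ → ℝ) × ℝ => SequenceSpace.replace q.1 i q.2 := fun i =>
    Continuous.update continuous_fst i continuous_snd
  -- Here the coordinate map is the identity, so invariance needs no exhaustion by compact sets. The
  -- nest can then be constructed from it without circularity.
  have hMP : ∀ i, MeasurePreserving (fun q : (ℕ → ℝ) × ℝ => SequenceSpace.replace q.1 i q.2)
      (μ ⊗ₘ condLaw μ i) μ := by
    refine fun i => ⟨(hrep i).measurable, ?_⟩
    have h := map_coords_replace μ i (hrep i).measurable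
    have hid : (fun (x : ℕ → ℝ) (j : ℕ) => SequenceSpace.coord j x) = id := rfl
    rwa [hid, Measure.map_id, Measure.map_id] at h
  obtain ⟨A, hA, hcap⟩ := nest_of_cutoffs hMP hα hα₂ hρ hcut
  exact closureIsStrictlyQuasiRegular_of_nest hMP hα hα₂ hρ hcut (fun k => isCompact_box (A k))
    (fun k k' hk x hx i => (hx i).trans (hA hk i)) hcap

lemma rpow_neg_inv_mul_inv {s t : ℝ} (hs : 0 < s) (ht : 0 < t) (a : ℝ) :
    (s⁻¹ * t⁻¹) ^ (-a) = (s * t) ^ a := by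
  rw [← mul_inv, Real.rpow_neg (inv_pos.2 (mul_pos hs ht)).le,
    Real.inv_rpow (mul_pos hs ht).le, inv_inv]

lemma setOf_scaled_lt {S : Type} [TopologicalSpace S] [SequenceSpace S] {s : ℝ} (hs : 0 < s)
    (i : ℕ) (m t : ℝ) : {x : S | m * (s⁻¹ * t⁻¹) < |SequenceSpace.coord i x|} =
      {x : S | s * |SequenceSpace.coord i x| > m * t⁻¹} := by
  ext x
  simp only [Set.mem_ofPred_eq, gt_iff_lt]
  rw [mul_left_comm, inv_mul_lt_iff₀ hs]

end

theorem theorem3 (α : ℝ) (hα₁ : 1 < α) (hα₂ : α < 2) :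
    -- the case `S = l^p_(β)`
    (∀ (p : ℝ) (β : ℕ → ℝ) [Fact (1 ≤ p)] [Fact (∀ i, 0 < β i)]
      (μ : Measure (WeightedLp p β)) [IsProbabilityMeasure μ]
      (ρ : ℕ → WeightedLp p β → ℝ → ℝ) (_ : IsLocallyBoundedCondDensity μ ρ)
      (γ : ℕ → ℝ) (_ : ∀ i, 0 < γ i) (_ : Summable fun i => (γ i ^ (-(1 / p))) ^ p)
      (M₀ : ℝ) (L : ℕ → ℕ → ℝ)
      (_ : ∀ (M : ℕ) (i : ℕ), CondDensityBound μ ρ i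
        (Set.Icc (-(6 * (M : ℝ) * β i ^ (-(1 / p)) * γ i ^ (-(1 / p))))
          (6 * (M : ℝ) * β i ^ (-(1 / p)) * γ i ^ (-(1 / p)))) (L M i))
      (_ : μ (⋃ M : ℕ, {x | ∀ i, |SequenceSpace.coord i x| ≤
        M * β i ^ (-(1 / p)) * γ i ^ (-(1 / p))}) = 1)
      (_ : ∑' i, ENNReal.ofReal ((β i ^ (1 / p) * γ i ^ (1 / p)) ^ (α + 1)) *
        μ {x | β i ^ (1 / p) * |SequenceSpace.coord i x| > M₀ * γ i ^ (-(1 / p))} < ⊤)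
      (_ : ∃ c < ⊤, Tendsto (fun M : ℕ => ENNReal.ofReal ((M : ℝ) ^ (-α)) *
        ∑' i, ENNReal.ofReal (L M i * (β i ^ (1 / p) * γ i ^ (1 / p)) ^ α) *
          μ {x | β i ^ (1 / p) * |SequenceSpace.coord i x| > M * γ i ^ (-(1 / p))})
        atTop (𝓝 c)),
      ClosureIsStrictlyQuasiRegular α μ) ∧
    -- the case `S = l^∞_(β)`
    (∀ (β : ℕ → ℝ) [Fact (∀ i, 0 < β i)]
      (μ : Measure (WeightedLinf β)) [IsProbabilityMeasure μ]
      (ρ : ℕ → WeightedLinf β → ℝ → ℝ) (_ : IsLocallyBoundedCondDensity μ ρ)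
      (γ : ℕ → ℝ) (_ : 0 < γ 0) (_ : Monotone γ) (_ : Tendsto γ atTop atTop)
      (M₀ : ℝ) (L : ℕ → ℕ → ℝ)
      (_ : ∀ (M : ℕ) (i : ℕ), CondDensityBound μ ρ i
        (Set.Icc (-(6 * (M : ℝ) * (β i)⁻¹ * (γ i)⁻¹)) (6 * (M : ℝ) * (β i)⁻¹ * (γ i)⁻¹)) (L M i))
      (_ : μ (⋃ M : ℕ, {x | ∀ i, |SequenceSpace.coord i x| ≤ M * (β i)⁻¹ * (γ i)⁻¹}) = 1)
      (_ : ∑' i, ENNReal.ofReal ((β i * γ i) ^ (α + 1)) *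
        μ {x | β i * |SequenceSpace.coord i x| > M₀ * (γ i)⁻¹} < ⊤)
      (_ : ∃ c < ⊤, Tendsto (fun M : ℕ => ENNReal.ofReal ((M : ℝ) ^ (-α)) *
        ∑' i, ENNReal.ofReal (L M i * (β i * γ i) ^ α) *
          μ {x | β i * |SequenceSpace.coord i x| > M * (γ i)⁻¹}) atTop (𝓝 c)),
      ClosureIsStrictlyQuasiRegular α μ) ∧
    -- the case `S = ℝ^ℕ`
    (∀ (μ : Measure (ℕ → ℝ)) [IsProbabilityMeasure μ]
      (ρ : ℕ → (ℕ → ℝ) → ℝ → ℝ) (_ : IsLocallyBoundedCondDensity μ ρ)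
      (γ : ℕ → ℝ) (_ : ∀ i, 0 < γ i) (L : ℕ → ℕ → ℝ)
      (_ : ∀ (M : ℕ) (i : ℕ), CondDensityBound μ ρ i (Set.Icc (-(6 * (M : ℝ) * γ i)) (6 * (M : ℝ) * γ i)) (L M i))
      (_ : ∃ c < ⊤, Tendsto (fun M : ℕ => ENNReal.ofReal ((M : ℝ) ^ (-α)) *
        ∑' i, ENNReal.ofReal (L M i * γ i ^ (-α)) * μ {x | |x i| > M * γ i}) atTop (𝓝 c)),
      ClosureIsStrictlyQuasiRegular α μ) := by
  have hα : 0 < α := by linarith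
  refine ⟨?_, ?_, ?_⟩
  · intro p β _ hβ μ _ ρ hρ γ hγ hγp M₀ L hL hμ hsum hlim
    obtain ⟨c, hc, hlim⟩ := hlim
    have hp0 : 0 < p := WeightedLp.p_pos
    have hs : ∀ i, 0 < β i ^ (1 / p) := fun i => Real.rpow_pos_of_pos (hβ.out i) _
    have ht : ∀ i, 0 < γ i ^ (1 / p) := fun i => Real.rpow_pos_of_pos (hγ i) _
    have hs' : ∀ i, β i ^ (-(1 / p)) = (β i ^ (1 / p))⁻¹ := fun i =>
      Real.rpow_neg (hβ.out i).le _
    have ht' : ∀ i, γ i ^ (-(1 / p)) = (γ i ^ (1 / p))⁻¹ := fun i => Real.rpow_neg (hγ i).le _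
    have hcancel : ∀ i, β i * ((β i ^ (1 / p))⁻¹) ^ p = 1 := by
      intro i
      rw [Real.inv_rpow (hs i).le, ← Real.rpow_mul (hβ.out i).le, one_div_mul_cancel hp0.ne',
        Real.rpow_one, mul_inv_cancel₀ (hβ.out i).ne']
    simp only [hs', ht'] at hγp hL hμ hsum hlim
    -- With r_i = β_i^(-1/p) γ_i^(-1/p) the hypotheses take the form of the general criterion.
    refine closureIsStrictlyQuasiRegular_of_isCompact hα hα₂ WeightedLp.continuous_replace hρ
      (r := fun i => (β i ^ (1 / p))⁻¹ * (γ i ^ (1 / p))⁻¹)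
      (fun i => mul_pos (inv_pos.2 (hs i)) (inv_pos.2 (ht i))) (L := L) (fun M i => ?_)
      (fun M => WeightedLp.isCompact_box ?_) ?_ (M₀ := M₀) ?_ hc ?_
    · simpa only [mul_assoc] using hL M i
    -- The weights β_i cancel: β_i (2 M r_i)^p is (2M)^p times the p-th power of γ_i^(-1/p).
    · refine (hγp.mul_left ((2 * M : ℝ) ^ p)).congr fun i => ?_
      have h1 : (2 * ((M : ℝ) * ((β i ^ (1 / p))⁻¹ * (γ i ^ (1 / p))⁻¹))) ^ p =
          (2 * M : ℝ) ^ p * (((β i ^ (1 / p))⁻¹) ^ p * ((γ i ^ (1 / p))⁻¹) ^ p) := by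
        rw [← Real.mul_rpow (inv_pos.2 (hs i)).le (inv_pos.2 (ht i)).le, ← Real.mul_rpow
          (by positivity) (mul_pos (inv_pos.2 (hs i)) (inv_pos.2 (ht i))).le]
        congr 1
        ring
      rw [h1, mul_left_comm, ← mul_assoc (β i), hcancel, one_mul]
    · simpa only [mul_assoc] using hμ
    · simpa only [rpow_neg_inv_mul_inv (hs _) (ht _), setOf_scaled_lt (hs _)] using hsum
    · simpa only [rpow_neg_inv_mul_inv (hs _) (ht _), setOf_scaled_lt (hs _)] using hlim
  · intro β hβ μ _ ρ hρ γ hγ0 hγmono hγ M₀ L hL hμ hsum hlim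
    obtain ⟨c, hc, hlim⟩ := hlim
    have hpos : ∀ i, 0 < γ i := fun i => hγ0.trans_le (hγmono (Nat.zero_le i))
    refine closureIsStrictlyQuasiRegular_of_isCompact hα hα₂ WeightedLinf.continuous_replace hρ
      (r := fun i => (β i)⁻¹ * (γ i)⁻¹)
      (fun i => mul_pos (inv_pos.2 (hβ.out i)) (inv_pos.2 (hpos i))) (L := L) (fun M i => ?_)
      (fun M => WeightedLinf.isCompact_box ?_) ?_ (M₀ := M₀) ?_ hc ?_
    · simpa only [mul_assoc] using hL M i
    -- The weighted radii β_i M r_i are M/γ_i, which tend to 0.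
    · have h := (tendsto_inv_atTop_zero.comp hγ).const_mul (M : ℝ)
      rw [mul_zero] at h
      refine h.congr fun i => ?_
      rw [mul_left_comm (β i), mul_inv_cancel_left₀ (hβ.out i).ne']
      rfl
    · simpa only [mul_assoc] using hμ
    · simpa only [rpow_neg_inv_mul_inv (hβ.out _) (hpos _), setOf_scaled_lt (hβ.out _)] using hsum
    · simpa only [rpow_neg_inv_mul_inv (hβ.out _) (hpos _), setOf_scaled_lt (hβ.out _)] using hlim
  · intro μ _ ρ hρ γ hγ L hL hlim
    obtain ⟨c, hc, hlim⟩ := hlim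
    refine closureIsStrictlyQuasiRegular_pi hα hα₂ hρ
      (hasBoundedCutoffs_of_tendsto hα hα₂ hρ hγ (L := L) (fun M i => ?_) hc hlim)
    simpa only [mul_assoc] using hL M i
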